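/- **Theorem.** Let $(q_n)_{n\ge 1}$ be probability distributions on $\{0,1,2,\dots\}$ with generating functions $Q_n(s)=\sum_{k\ge 0} q_n(k)s^k$ satisfying $Q_n(0)=0$. The branching process in varying environment (BPVE) with environment $\{Q_n\}$ starts from one individual, the root; each individual of generation $n\ge 0$ has, independently of all others, $k$ children with probability $q_{n+1}(k)$. Let $\mathbf P_Q$ be the law of its family tree, and let $M_n=\prod_{j=1}^n Q_j'(1)$ be the expected size of generation $n$ (so $M_0=1$), where $Q_n'(1)=\sum_k k\,q_n(k)$ and $Q_n''(1)=\sum_k k(k-1)q_n(k)$, with values in $[0,\infty]$. For a locally finite rooted tree $T$, a closed set $B\subseteq\mathbb R^{\infty}$ (product topology) and a probability distribution $F$ on $\mathbb R$, let $P(T;B;F)$ be the probability that, when the vertices $v$ of $T$ carry i.i.d. labels $X(v)$ with distribution $F$, there is an infinite non-self-intersecting path $\rho,v_1,v_2,\dots$ starting at the root $\rho$ with $(X(v_1),X(v_2),\dots)\in B$. Let $\Delta$ be an infinite, locally finite rooted tree, and let $|\Delta_n|$ be the number of its vertices at distance $n$ from the root. Assume that 1. $\inf_{n\ge 1} Q_n'(1)>1$;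 2. $\sup_{n\ge 1} Q_n''(1)<\infty$; 3. $\sup_{n\ge 0} |\Delta_n|/M_n<\infty$. Then for $\mathbf P_Q$-almost every tree $\Gamma$ there is a constant $C_1\in(0,\infty)$, depending only on $\Gamma$ and $\Delta$, such that $$P(\Gamma;B;F)\ \ge\ C_1\,P(\Delta;B;F)$$ for every probability distribution $F$ on $\mathbb R$ and every closed set $B\subseteq\mathbb R^{\infty}$. -/

import Mathlib

open scoped ENNReal NNReal

/-- A rooted tree with vertex type `V`. -/
structure RootedGraphTree (V : Type*) where
  graph : SimpleGraph V
  root : V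
  isTree : graph.IsTree

namespace RootedGraphTree

variable {V : Type*}

/-- The `n`-th level: the vertices at distance `n` from the root. -/
def level (T : RootedGraphTree V) (n : ℕ) : Set V :=
  {v | T.graph.dist T.root v = n}

/-- `x` is an infinite non-self-intersecting path starting at the root. -/
def IsRay (T : RootedGraphTree V) (x : ℕ → V) : Prop :=
  x 0 = T.root ∧ (∀ n, T.graph.Adj (x n) (x (n + 1))) ∧ Function.Injective x

/-- The event that some infinite non-self-intersecting path `x 0 = root, x 1, x 2, …` has its
label sequence `(X (x 1), X (x 2), …)` in `B`. -/
def hitEvent (T : RootedGraphTree V) (B : Set (ℕ → ℝ)) : Set (V → ℝ) :=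
  {X | ∃ x, T.IsRay x ∧ (fun n => X (x (n + 1))) ∈ B}

/-- `P(T; B; F)`: the probability of `hitEvent T B` when the labels of the vertices are i.i.d.
with distribution `F`. -/
noncomputable def hitProb (T : RootedGraphTree V) (B : Set (ℕ → ℝ))
    (F : MeasureTheory.Measure ℝ) : ℝ≥0∞ :=
  MeasureTheory.Measure.infinitePi (fun _ : V => F) (T.hitEvent B)

end RootedGraphTree

section BranchingProcess

/-- Individuals are words in `ℕ`, with `i :: v` the child number `i` of `v` and `[]` the
progenitor. Given the number `N v` of children of every potential individual `v`, this singles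
out the individuals that are really born. -/
def IsBorn (N : List ℕ → ℕ) : List ℕ → Prop
  | [] => True
  | i :: v => i < N v ∧ IsBorn N v

/-- The graph on the individuals born, with an edge between each individual and its children. -/
def familyGraph (N : List ℕ → ℕ) : SimpleGraph {v // IsBorn N v} :=
  SimpleGraph.fromRel fun u v => ∃ i, v.1 = i :: u.1

theorem familyGraph_adj {N : List ℕ → ℕ} {u v : {v // IsBorn N v}} :
    (familyGraph N).Adj u v ↔ (∃ i, v.1 = i :: u.1) ∨ (∃ i, u.1 = i :: v.1) := by
  rw [familyGraph, SimpleGraph.fromRel_adj]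
  refine ⟨fun h => h.2, fun h => ⟨?_, h⟩⟩
  rintro rfl
  rcases h with ⟨i, h⟩ | ⟨i, h⟩ <;> exact absurd (congrArg List.length h) (by simp)

theorem familyGraph_reachable_root (N : List ℕ → ℕ) :
    ∀ (v : List ℕ) (hv : IsBorn N v), (familyGraph N).Reachable ⟨[], trivial⟩ ⟨v, hv⟩
  | [], _ => SimpleGraph.Reachable.refl _
  | i :: v, hv =>
    (familyGraph_reachable_root N v hv.2).trans
      (SimpleGraph.Adj.reachable (familyGraph_adj.2 (Or.inl ⟨i, rfl⟩)))

theorem familyGraph_not_reachable {N : List ℕ → ℕ} {u v : {v // IsBorn N v}} {i : ℕ}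
    (h : v.1 = i :: u.1) : ¬ ((familyGraph N).deleteEdges {s(u, v)}).Reachable v u := by
  rintro ⟨p⟩
  have key : ∀ {a b : {v // IsBorn N v}}, ((familyGraph N).deleteEdges {s(u, v)}).Walk a b →
      v.1 <:+ a.1 → v.1 <:+ b.1 := by
    intro a b p
    induction p with
    | nil => exact id
    | @cons a c b hac _ ih =>
      intro ha
      refine ih ?_
      rw [SimpleGraph.deleteEdges_adj, familyGraph_adj] at hac
      obtain ⟨⟨j, hj⟩ | ⟨j, hj⟩, hne⟩ := hac
      · rw [hj]
        exact ha.trans (List.suffix_cons _ _)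
      · rw [hj, List.suffix_cons_iff] at ha
        rcases ha with ha | ha
        · exfalso
          apply hne
          have hc : c = u := Subtype.ext (by rw [h] at ha; exact (List.cons.inj ha).2.symm)
          have hav : a = v := Subtype.ext (by rw [hj, ha])
          rw [hc, hav]
          exact Sym2.eq_swap
        · exact ha
  have := (key p (List.suffix_refl _)).length_le
  rw [h] at this
  simp at this

theorem familyGraph_isTree (N : List ℕ → ℕ) : (familyGraph N).IsTree where
  connected :=
    { preconnected := fun a b =>
        (familyGraph_reachable_root N a.1 a.2).symm.trans (familyGraph_reachable_root N b.1 b.2)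
      nonempty := ⟨⟨[], trivial⟩⟩ }
  isAcyclic := by
    refine SimpleGraph.isAcyclic_iff_forall_adj_isBridge.2 fun u v huv => ?_
    rw [SimpleGraph.isBridge_iff]
    rcases familyGraph_adj.1 huv with ⟨i, h⟩ | ⟨i, h⟩
    · exact fun hr => familyGraph_not_reachable h hr.symm
    · intro hr
      rw [Sym2.eq_swap] at hr
      exact familyGraph_not_reachable h hr

/-- The family tree, rooted at the progenitor. -/
def familyTree (N : List ℕ → ℕ) : RootedGraphTree {v // IsBorn N v} where
  graph := familyGraph N
  root := ⟨[], trivial⟩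
  isTree := familyGraph_isTree N

/-- The generating function `Q(s) = ∑ k, p(k) s ^ k` of an offspring distribution `p`, for
`s ∈ [0, ∞]`. -/
noncomputable def genFun (p : PMF ℕ) (s : ℝ≥0∞) : ℝ≥0∞ :=
  ∑' k : ℕ, p k * s ^ k

/-- The `j`-th derivative `∑ k, k (k - 1) ⋯ (k - j + 1) p(k) s ^ (k - j)` of the generating
function, a possibly infinite sum of nonnegative terms. -/
noncomputable def genFunDeriv (p : PMF ℕ) (j : ℕ) (s : ℝ≥0∞) : ℝ≥0∞ :=
  ∑' k : ℕ, (k.descFactorial j : ℝ≥0∞) * p k * s ^ (k - j)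

/-- The law of the branching process in the varying environment `q 1, q 2, …`: the numbers of
children `N v` are independent, an individual `v` of generation `n` (a word of length `n`) having
`k` children with probability `q (n + 1) k`. The random tree is `familyTree N`. -/
noncomputable def bpveLaw (q : ℕ → PMF ℕ) : MeasureTheory.Measure (List ℕ → ℕ) :=
  MeasureTheory.Measure.infinitePi fun v => (q (v.length + 1)).toMeasure

/-- `M n = ∏_{j=1}^n Q_j'(1)`, the expected size of generation `n`. -/
noncomputable def meanSize (q : ℕ → PMF ℕ) (n : ℕ) : ℝ≥0∞ :=
  ∏ j ∈ Finset.Icc 1 n, genFunDeriv (q j) 1 1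

end BranchingProcess

/-!
The two trees are compared through a series-parallel electrical network on the target set `B`. Its
nodes of height `j` are the sequences of `j` labels, weighted by `F`, and an edge that ends at
height `j` has conductance `M j`, the expected size of generation `j`; `conductance` is the
effective conductance between the root and the part of `B` at a given height. It depends on the tree
only through the numbers `M j`.

A tree whose level sizes are at most `A * M j` hits `B` with probability at most a constant times
the conductance (`LayeredTree.measure_Hit_le_conductance`). Among all trees with given level sizes,
the spherically symmetric one is the most likely to hit: minus the logarithm of the probability of
missing is superadditive in the level sizes (`sum_pot_le`), by Hölder's inequality. For the
symmetric tree, whose level sizes are allowed to be real numbers, hitting probability and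
conductance are compared one level at a time (`one_sub_rpow_le`); here it matters that the
means `M (j + 1) / M j` are bounded away from `1`.

Conversely, a tree with a generation `n` of size at least of order `M n`, in which the number of
pairs of individuals of generation `n` that split in generation `j` is at most of the order of
`M n ^ 2 / M j`, hits `B` with probability at least a constant times the conductance
(`LayeredTree.conductance_le_measure_Hit`). This is the second moment method, for the sum over the
paths of the density of the unit flow of the network at their labels. The energy of the flow, which
is at most the resistance, controls the second moment.

The branching process satisfies these conditions in infinitely many generations
(`ae_exists_frequently`). In order to make the deviations of the numbers of pairs from their
conditional means summable under a second moment assumption only, all but the first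
`L k = c * (k + 2) ^ 2` children of each individual of generation `k` are discarded, which at most
halves the means `M n` (`exists_truncation`). Since every individual has a child, the line of
descent through first children can be followed until a second child with a progeny of the order of
its mean appears (`measureReal_descCount_lt_le`), and this gives the lower bound on the generation
sizes.

The reduction to finite depths replaces `B` by the closed sets `initialHull B n`: König's lemma and
the closedness of `B` recover an infinite path from hits at all depths
(`LayeredTree.exists_branch_of_forall_mem_Hit`).
-/

open MeasureTheory ProbabilityTheory Function

/-! ### Independence of functions of disjoint sets of coordinates -/

section ProductMeasure

variable {ι : Type*} {E : ι → Type*}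

open Classical in
/-- The configuration that agrees with `ω` on `S` and with the reference `ω₀` elsewhere. -/
noncomputable def freezeOff (S : Set ι) (ω₀ ω : ∀ i, E i) : ∀ i, E i :=
  fun i => if i ∈ S then ω i else ω₀ i

theorem DependsOn.comp_freezeOff {α : Type*} {f : (∀ i, E i) → α} {S : Set ι}
    (hf : DependsOn f S) (ω₀ ω : ∀ i, E i) : f (freezeOff S ω₀ ω) = f ω :=
  hf fun i hi => by simp [freezeOff, hi]

theorem dependsOn_freezeOff (S : Set ι) (ω₀ : ∀ i, E i) : DependsOn (freezeOff S ω₀) S := by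
  intro x y hxy
  funext i
  by_cases hi : i ∈ S <;> simp [freezeOff, hi, hxy]

variable [∀ i, MeasurableSpace (E i)]

theorem measurable_freezeOff (S : Set ι) (ω₀ : ∀ i, E i) : Measurable (freezeOff S ω₀) := by
  refine measurable_pi_iff.2 fun i => ?_
  by_cases hi : i ∈ S
  · simpa [freezeOff, hi] using measurable_pi_apply i
  · simp [freezeOff, hi]

theorem comap_freezeOff_le (S : Set ι) (ω₀ : ∀ i, E i) :
    MeasurableSpace.pi.comap (freezeOff S ω₀) ≤
      ⨆ i ∈ S, (inferInstance : MeasurableSpace (E i)).comap (fun ω : ∀ i, E i => ω i) := by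
  rw [MeasurableSpace.pi, MeasurableSpace.comap_iSup]
  refine iSup_le fun i => ?_
  rw [MeasurableSpace.comap_comp]
  by_cases hi : i ∈ S
  · refine le_trans (le_of_eq ?_) (le_iSup₂_of_le (f := fun i (_ : i ∈ S) =>
        (inferInstance : MeasurableSpace (E i)).comap (fun ω : ∀ i, E i => ω i)) i hi le_rfl)
    congr 1
    funext ω
    simp [freezeOff, hi]
  · have : ((fun b : ∀ i, E i => b i) ∘ freezeOff S ω₀) = fun _ => ω₀ i := by
      funext ω
      simp [freezeOff, hi]
    rw [this, MeasurableSpace.comap_const]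
    exact bot_le

variable (μ : ∀ i, Measure (E i)) [∀ i, IsProbabilityMeasure (μ i)]

/-- Functions of disjoint sets of coordinates are independent under a product measure. -/
theorem indepFun_infinitePi_of_dependsOn {α β : Type*} [MeasurableSpace α] [MeasurableSpace β]
    {f : (∀ i, E i) → α} {g : (∀ i, E i) → β} (hf : Measurable f) (hg : Measurable g)
    {S T : Set ι} (hfS : DependsOn f S) (hgT : DependsOn g T) (hST : Disjoint S T) :
    IndepFun f g (Measure.infinitePi μ) := by
  obtain ⟨ω₀⟩ : Nonempty (∀ i, E i) := ⟨fun i => (nonempty_of_isProbabilityMeasure (μ i)).some⟩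
  have hi : iIndepFun (fun i (ω : ∀ i, E i) => ω i) (Measure.infinitePi μ) :=
    iIndepFun_infinitePi (X := fun i x => x) (fun i => measurable_id)
  have hI := indep_iSup_of_disjoint (fun i => (measurable_pi_apply i).comap_le) hi hST
  rw [← funext (hfS.comp_freezeOff ω₀), ← funext (hgT.comp_freezeOff ω₀), IndepFun_iff_Indep]
  refine indep_of_indep_of_le_left (indep_of_indep_of_le_right hI ?_) ?_
  · refine le_trans ?_ (comap_freezeOff_le T ω₀)
    exact (hg.comp (comap_measurable (freezeOff T ω₀))).comap_le
  · refine le_trans ?_ (comap_freezeOff_le S ω₀)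
    exact (hf.comp (comap_measurable (freezeOff S ω₀))).comap_le

theorem lintegral_mul_of_dependsOn {f g : (∀ i, E i) → ℝ≥0∞} (hf : Measurable f)
    (hg : Measurable g) {S T : Set ι} (hfS : DependsOn f S) (hgT : DependsOn g T)
    (hST : Disjoint S T) :
    ∫⁻ ω, f ω * g ω ∂(Measure.infinitePi μ) =
      (∫⁻ ω, f ω ∂(Measure.infinitePi μ)) * ∫⁻ ω, g ω ∂(Measure.infinitePi μ) :=
  lintegral_mul_eq_lintegral_mul_lintegral_of_indepFun hf hg
    (indepFun_infinitePi_of_dependsOn μ hf hg hfS hgT hST)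

theorem integral_mul_of_dependsOn {f g : (∀ i, E i) → ℝ} (hf : Measurable f)
    (hg : Measurable g) {S T : Set ι} (hfS : DependsOn f S) (hgT : DependsOn g T)
    (hST : Disjoint S T) :
    ∫ ω, f ω * g ω ∂(Measure.infinitePi μ) =
      (∫ ω, f ω ∂(Measure.infinitePi μ)) * ∫ ω, g ω ∂(Measure.infinitePi μ) :=
  (indepFun_infinitePi_of_dependsOn μ hf hg hfS hgT hST).integral_fun_mul_eq_mul_integral
    hf.aestronglyMeasurable hg.aestronglyMeasurable

/-- A coordinate `a` may be integrated last, if the rest of the integrand does not use it. -/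
theorem lintegral_eval_of_dependsOn {a : ι} {S : Set ι} (ha : a ∉ S)
    {f : E a × (∀ i, E i) → ℝ≥0∞} (hf : Measurable f) (hfS : ∀ y, DependsOn (fun ω => f (y, ω)) S) :
    ∫⁻ ω, f (ω a, ω) ∂(Measure.infinitePi μ) =
      ∫⁻ y, ∫⁻ ω, f (y, ω) ∂(Measure.infinitePi μ) ∂(μ a) := by
  obtain ⟨ω₀⟩ : Nonempty (∀ i, E i) := ⟨fun i => (nonempty_of_isProbabilityMeasure (μ i)).some⟩
  have hr := measurable_freezeOff S ω₀
  have hind : IndepFun (fun ω : ∀ i, E i => ω a) (freezeOff S ω₀) (Measure.infinitePi μ) :=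
    indepFun_infinitePi_of_dependsOn μ (measurable_pi_apply a) hr (S := {a})
      (fun x y h => h a rfl) (dependsOn_freezeOff S ω₀) (by simpa using ha)
  have hlaw := hind.map_prod_eq_prod_map_map (measurable_pi_apply a).aemeasurable hr.aemeasurable
  calc ∫⁻ ω, f (ω a, ω) ∂(Measure.infinitePi μ)
      = ∫⁻ ω, f (ω a, freezeOff S ω₀ ω) ∂(Measure.infinitePi μ) :=
        lintegral_congr fun ω => ((hfS (ω a)).comp_freezeOff ω₀ ω).symm
    _ = ∫⁻ z, f z ∂((Measure.infinitePi μ).map fun ω => (ω a, freezeOff S ω₀ ω)) :=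
        (lintegral_map hf ((measurable_pi_apply a).prodMk hr)).symm
    _ = ∫⁻ y, ∫⁻ ω, f (y, freezeOff S ω₀ ω) ∂(Measure.infinitePi μ) ∂(μ a) := by
        have : IsProbabilityMeasure ((Measure.infinitePi μ).map (freezeOff S ω₀)) :=
          Measure.isProbabilityMeasure_map hr.aemeasurable
        rw [hlaw, lintegral_prod _ hf.aemeasurable, Measure.infinitePi_map_eval]
        exact lintegral_congr fun y => lintegral_map (hf.comp measurable_prodMk_left) hr
    _ = _ := lintegral_congr fun y => lintegral_congr fun ω => (hfS y).comp_freezeOff ω₀ ω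

theorem integral_finset_prod_of_dependsOn {κ : Type*} (A : Finset κ) {f : κ → (∀ i, E i) → ℝ}
    {S : κ → Set ι} (hf : ∀ a ∈ A, Measurable (f a)) (hS : ∀ a ∈ A, DependsOn (f a) (S a))
    (hd : ∀ a ∈ A, ∀ b ∈ A, a ≠ b → Disjoint (S a) (S b)) :
    ∫ ω, ∏ a ∈ A, f a ω ∂(Measure.infinitePi μ) =
      ∏ a ∈ A, ∫ ω, f a ω ∂(Measure.infinitePi μ) := by
  classical
  induction A using Finset.induction_on with
  | empty => simp
  | insert a A ha ih =>
    simp only [Finset.prod_insert ha]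
    have hfA : ∀ b ∈ A, Measurable (f b) := fun b hb => hf b (Finset.mem_insert_of_mem hb)
    rw [integral_mul_of_dependsOn μ (hf a (Finset.mem_insert_self a A))
      (Finset.measurable_fun_prod A hfA) (hS a (Finset.mem_insert_self a A)) (T := ⋃ b ∈ A, S b),
      ih hfA (fun b hb => hS b (Finset.mem_insert_of_mem hb))
        fun b hb c hc => hd b (Finset.mem_insert_of_mem hb) c (Finset.mem_insert_of_mem hc)]
    · intro X Y h
      exact Finset.prod_congr rfl fun b hb => hS b (Finset.mem_insert_of_mem hb)
        fun i hi => h i (Set.mem_biUnion hb hi)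
    · refine Set.disjoint_iUnion₂_right.2 fun b hb => ?_
      exact hd a (Finset.mem_insert_self a A) b (Finset.mem_insert_of_mem hb)
        (by rintro rfl; exact ha hb)

end ProductMeasure

/-! ### Layered trees and hitting events -/

/-- A set with levels, in which each element `u` has finitely many selected children, one level
higher, and each child determines its parent. -/
structure LayeredTree (V : Type*) where
  par : V → V
  lvl : V → ℕ
  ch : V → Finset V
  par_of_mem : ∀ {u a}, a ∈ ch u → par a = u
  lvl_of_mem : ∀ {u a}, a ∈ ch u → lvl a = lvl u + 1

namespace LayeredTree

variable {V : Type*} (T : LayeredTree V)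

/-- The elements with ancestor `u`, including `u`. -/
def below (u : V) : Set V := {v | ∃ k, T.par^[k] v = u ∧ T.lvl v = T.lvl u + k}

/-- The elements with ancestor `u`, excluding `u`. -/
def sbelow (u : V) : Set V := {v | ∃ k, T.par^[k + 1] v = u ∧ T.lvl v = T.lvl u + (k + 1)}

theorem self_mem_below (u : V) : u ∈ T.below u := ⟨0, rfl, rfl⟩

theorem self_notMem_sbelow (u : V) : u ∉ T.sbelow u := by
  rintro ⟨k, -, h⟩
  omega

theorem sbelow_subset_below (u : V) : T.sbelow u ⊆ T.below u := fun _ ⟨k, h⟩ => ⟨k + 1, h⟩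

variable {T}

theorem below_subset_sbelow {u a : V} (ha : a ∈ T.ch u) : T.below a ⊆ T.sbelow u := by
  rintro v ⟨k, hk, hl⟩
  refine ⟨k, ?_, by have := T.lvl_of_mem ha; omega⟩
  rw [iterate_succ_apply', hk, T.par_of_mem ha]

theorem disjoint_below {u a b : V} (ha : a ∈ T.ch u) (hb : b ∈ T.ch u) (hab : a ≠ b) :
    Disjoint (T.below a) (T.below b) := by
  rw [Set.disjoint_left]
  rintro v ⟨k, hk, hl⟩ ⟨l, hk', hl'⟩
  have h1 := T.lvl_of_mem ha
  have h2 := T.lvl_of_mem hb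
  obtain rfl : k = l := by omega
  exact hab (hk.symm.trans hk')

variable (T)

/-- The number of descendants of `u` in the `d`-th generation after `u`. -/
def cnt : ℕ → V → ℕ
  | 0, _ => 1
  | d + 1, u => ∑ a ∈ T.ch u, cnt d a

open Classical in
/-- The number of ordered pairs of descendants of `u`, in the `d`-th generation after `u`, whose
last common ancestor is in the `i`-th generation after `u`. -/
noncomputable def pairs : ℕ → ℕ → V → ℕ
  | 0, 0, _ => 1
  | 0, _ + 1, _ => 0
  | d + 1, 0, u => ∑ a ∈ T.ch u, ∑ b ∈ T.ch u with b ≠ a, T.cnt d a * T.cnt d b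
  | d + 1, i + 1, u => ∑ a ∈ T.ch u, pairs d i a

/-- The event that some descending path of length `d` from `u` carries labels which, inserted into
the sequence `x` from the position `T.lvl u` on, yield an element of `B`. -/
def Hit (B : Set (ℕ → ℝ)) : ℕ → V → (ℕ → ℝ) → Set (V → ℝ)
  | 0, _, x => {_X | x ∈ B}
  | d + 1, u, x => {X | ∃ a ∈ T.ch u, X ∈ Hit B d a (update x (T.lvl u) (X a))}

end LayeredTree

/-! ### The network on the target and its unit flow -/

section Conductance

variable (B : Set (ℕ → ℝ)) (M : ℕ → ℝ≥0∞) (F : Measure ℝ)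

/-- The conductance, relative to `M j`, of the part of the target `B` that continues the first `j`
terms of `x` by `d` more terms, in the series-parallel network where an edge that ends at
height `i` has conductance `M i`. -/
noncomputable def conductance : ℕ → ℕ → (ℕ → ℝ) → ℝ≥0∞
  | 0, _, x => B.indicator 1 x
  | d + 1, j, x =>
    (M (j + 1) / M j * ∫⁻ y, conductance d (j + 1) (update x j y) ∂F) /
      (1 + M (j + 1) / M j * ∫⁻ y, conductance d (j + 1) (update x j y) ∂F)

/-- The density, with respect to `F`, of the term `x j` of a random sequence, given the previous
terms, when the sequence follows the unit flow of the network. -/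
noncomputable def flowDensity (d j : ℕ) (x : ℕ → ℝ) : ℝ≥0∞ :=
  conductance B M F d (j + 1) x / ∫⁻ y, conductance B M F d (j + 1) (update x j y) ∂F

/-- The second moment of the density of the next `i` terms of the flow. -/
noncomputable def flowEnergy : ℕ → ℕ → ℕ → (ℕ → ℝ) → ℝ≥0∞
  | _, _, 0, _ => 1
  | 0, _, _ + 1, _ => 0
  | d + 1, j, i + 1, x =>
    ∫⁻ y, flowDensity B M F d j (update x j y) ^ 2 * flowEnergy d (j + 1) i (update x j y) ∂F

theorem measurable_update_pair (j : ℕ) :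
    Measurable fun p : (ℕ → ℝ) × ℝ => update p.1 j p.2 := measurable_update'

theorem measurable_lintegral_update [SFinite F] {f : (ℕ → ℝ) → ℝ≥0∞} (hf : Measurable f) (j : ℕ) :
    Measurable fun x : ℕ → ℝ => ∫⁻ y, f (update x j y) ∂F :=
  (hf.comp (measurable_update_pair j)).lintegral_prod_right'

variable {B}

theorem measurable_conductance [SFinite F] (hB : MeasurableSet B) :
    ∀ d j, Measurable (conductance B M F d j)
  | 0, _ => measurable_one.indicator hB
  | d + 1, j => by
    have := measurable_lintegral_update F (measurable_conductance hB d (j + 1)) j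
    exact (this.const_mul _).div ((this.const_mul _).const_add 1)

theorem measurable_flowDensity [SFinite F] (hB : MeasurableSet B) (d j : ℕ) :
    Measurable (flowDensity B M F d j) :=
  (measurable_conductance M F hB d (j + 1)).div
    (measurable_lintegral_update F (measurable_conductance M F hB d (j + 1)) j)

theorem measurable_flowEnergy [SFinite F] (hB : MeasurableSet B) :
    ∀ d j i, Measurable (flowEnergy B M F d j i)
  | 0, _, 0 => measurable_const
  | _ + 1, _, 0 => measurable_const
  | 0, _, _ + 1 => measurable_const
  | d + 1, j, i + 1 => measurable_lintegral_update F
      (((measurable_flowDensity M F hB d j).pow_const 2).mul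
        (measurable_flowEnergy hB d (j + 1) i)) j

variable (B)

theorem conductance_le_one : ∀ d j x, conductance B M F d j x ≤ 1
  | 0, _, x => Set.indicator_le' (fun _ _ => le_rfl) (fun _ _ => zero_le) x
  | d + 1, j, x => by
    unfold conductance
    exact ENNReal.div_le_of_le_mul (by rw [one_mul]; exact le_add_self)

theorem lintegral_conductance_le_one [IsProbabilityMeasure F] (d j : ℕ) (x : ℕ → ℝ) :
    ∫⁻ y, conductance B M F d (j + 1) (update x j y) ∂F ≤ 1 := by
  calc _ ≤ ∫⁻ _, 1 ∂F := lintegral_mono fun y => conductance_le_one B M F _ _ _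
    _ = 1 := by simp

theorem lintegral_flowDensity (d j : ℕ) (x : ℕ → ℝ)
    (hm : Measurable (conductance B M F d (j + 1))) :
    ∫⁻ y, flowDensity B M F d j (update x j y) ∂F =
      (∫⁻ y, conductance B M F d (j + 1) (update x j y) ∂F) /
        ∫⁻ y, conductance B M F d (j + 1) (update x j y) ∂F := by
  simp only [flowDensity, update_idem, div_eq_mul_inv]
  rw [lintegral_mul_const]
  exact hm.comp (measurable_update x)

variable {B M F}

theorem flowDensity_eq_zero {d j : ℕ} {x : ℕ → ℝ} (h : conductance B M F d (j + 1) x = 0) :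
    flowDensity B M F d j x = 0 := by
  rw [flowDensity, h, ENNReal.zero_div]

theorem lintegral_conductance_ne_zero {d j : ℕ} {x : ℕ → ℝ}
    (h : conductance B M F (d + 1) j x ≠ 0) :
    ∫⁻ y, conductance B M F d (j + 1) (update x j y) ∂F ≠ 0 := by
  intro h0
  apply h
  rw [conductance, h0]
  simp

/-- The energy of the unit flow is at most the effective resistance of the network. -/
theorem sum_flowEnergy_le [IsProbabilityMeasure F] (hB : MeasurableSet B) (hM0 : ∀ j, M j ≠ 0)
    (hM : ∀ j, M j ≠ ∞) : ∀ d j x, conductance B M F d j x ≠ 0 →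
    ∑ i ∈ Finset.range (d + 1), flowEnergy B M F d j i x / M (j + i) ≤
      (M j * conductance B M F d j x)⁻¹
  | 0, j, x, h => by
    have : conductance B M F 0 j x = 1 := by
      unfold conductance at h ⊢
      by_cases hx : x ∈ B <;> simp_all
    rw [this]
    simp [flowEnergy]
  | d + 1, j, x, h => by
    set b := ∫⁻ y, conductance B M F d (j + 1) (update x j y) ∂F with hb
    have hb0 : b ≠ 0 := lintegral_conductance_ne_zero h
    have hb1 : b ≠ ∞ :=
      ne_top_of_le_ne_top ENNReal.one_ne_top (lintegral_conductance_le_one B M F d j x)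
    have hmc := measurable_conductance M F hB d (j + 1)
    rw [Finset.sum_range_succ']
    have hfirst : ∑ i ∈ Finset.range (d + 1), flowEnergy B M F (d + 1) j (i + 1) x / M (j + (i + 1))
        ≤ (M (j + 1) * b)⁻¹ := by
      calc ∑ i ∈ Finset.range (d + 1), flowEnergy B M F (d + 1) j (i + 1) x / M (j + (i + 1))
          = ∫⁻ y, flowDensity B M F d j (update x j y) ^ 2 * ∑ i ∈ Finset.range (d + 1),
              flowEnergy B M F d (j + 1) i (update x j y) / M (j + 1 + i) ∂F := by
            simp only [Finset.mul_sum]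
            rw [lintegral_finsetSum']
            · refine Finset.sum_congr rfl fun i _ => ?_
              rw [flowEnergy]
              simp only [div_eq_mul_inv, ← mul_assoc]
              rw [lintegral_mul_const]
              · congr 3
                omega
              · exact (((measurable_flowDensity M F hB d j).pow_const 2).mul
                  (measurable_flowEnergy M F hB d (j + 1) i)).comp (measurable_update x)
            · intro i _
              exact ((((measurable_flowDensity M F hB d j).pow_const 2).mul
                ((measurable_flowEnergy M F hB d (j + 1) i).div_const _)).comp
                  (measurable_update x)).aemeasurable
        _ ≤ ∫⁻ y, conductance B M F d (j + 1) (update x j y) * (b⁻¹ ^ 2 * (M (j + 1))⁻¹) ∂F := by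
            refine lintegral_mono fun y => ?_
            by_cases h0 : conductance B M F d (j + 1) (update x j y) = 0
            · simp [flowDensity_eq_zero h0]
            · refine (mul_le_mul_right (sum_flowEnergy_le hB hM0 hM d (j + 1) _ h0) _).trans
                (le_of_eq ?_)
              have hc1 : conductance B M F d (j + 1) (update x j y) ≠ ∞ :=
                ne_top_of_le_ne_top ENNReal.one_ne_top (conductance_le_one B M F _ _ _)
              rw [flowDensity]
              simp only [update_idem]
              rw [← hb, div_eq_mul_inv, ENNReal.mul_inv (Or.inl (hM0 _)) (Or.inl (hM _))]
              set c := conductance B M F d (j + 1) (update x j y)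
              calc (c * b⁻¹) ^ 2 * ((M (j + 1))⁻¹ * c⁻¹)
                  = (c * c⁻¹) * (c * (b⁻¹ ^ 2 * (M (j + 1))⁻¹)) := by ring
                _ = _ := by rw [ENNReal.mul_inv_cancel h0 hc1, one_mul]
        _ = (M (j + 1) * b)⁻¹ := by
            rw [lintegral_mul_const _ (by exact hmc.comp (measurable_update x)), ← hb,
              ENNReal.mul_inv (Or.inl (hM0 _)) (Or.inl (hM _))]
            calc b * (b⁻¹ ^ 2 * (M (j + 1))⁻¹) = (b * b⁻¹) * ((M (j + 1))⁻¹ * b⁻¹) := by ring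
              _ = _ := by rw [ENNReal.mul_inv_cancel hb0 hb1, one_mul]
    refine (add_le_add_left hfirst _).trans (le_of_eq ?_)
    have hs : conductance B M F (d + 1) j x =
        (M (j + 1) / M j * b) / (1 + M (j + 1) / M j * b) := rfl
    have hr0 : M (j + 1) / M j * b ≠ 0 := mul_ne_zero (ENNReal.div_ne_zero.2 ⟨hM0 _, hM _⟩) hb0
    have hr1 : M (j + 1) / M j * b ≠ ∞ := ENNReal.mul_ne_top (ENNReal.div_ne_top (hM _) (hM0 _)) hb1
    rw [hs, ENNReal.mul_inv (a := M j) (Or.inl (hM0 _)) (Or.inl (hM _)),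
      ENNReal.inv_div (Or.inl (by finiteness)) (Or.inl (by simp)),
      ENNReal.div_eq_inv_mul (b := M (j + 1) / M j * b), mul_add, mul_one, mul_add,
      ENNReal.inv_mul_cancel hr0 hr1, mul_one]
    congr 1
    · rw [← ENNReal.mul_inv (Or.inl (hM0 _)) (Or.inl (hM _)), ← mul_assoc,
        ENNReal.mul_div_cancel (hM0 _) (hM _)]
    · simp [flowEnergy]

end Conductance

/-! ### The lower bound for the hitting probability -/

namespace LayeredTree

variable {V : Type*} (T : LayeredTree V)

section FlowSum

variable (B : Set (ℕ → ℝ)) (M : ℕ → ℝ≥0∞) (F : Measure ℝ)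

/-- The sum, over the descending paths of length `d` from `u`, of the flow density at the labels of
the path. -/
noncomputable def flowSum : ℕ → V → (ℕ → ℝ) → (V → ℝ) → ℝ≥0∞
  | 0, _, x, _ => B.indicator 1 x
  | d + 1, u, x, X => ∑ a ∈ T.ch u,
      flowDensity B M F d (T.lvl u) (update x (T.lvl u) (X a)) *
        flowSum d a (update x (T.lvl u) (X a)) X

variable {B}

theorem flowSum_eq_zero_of_notMem_Hit :
    ∀ d u x X, X ∉ T.Hit B d u x → T.flowSum B M F d u x X = 0
  | 0, _, x, X, h => Set.indicator_of_notMem (s := B) h _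
  | d + 1, u, x, X, h => Finset.sum_eq_zero fun a ha => by
      rw [flowSum_eq_zero_of_notMem_Hit d a _ X fun hX => h ⟨a, ha, hX⟩, mul_zero]

theorem dependsOn_flowSum (B : Set (ℕ → ℝ)) : ∀ d u x,
    DependsOn (T.flowSum B M F d u x) (T.sbelow u)
  | 0, _, _ => fun _ _ _ => rfl
  | d + 1, u, x => fun X Y h => Finset.sum_congr rfl fun a ha => by
      have hsub := below_subset_sbelow ha
      rw [h a (hsub (T.self_mem_below a)),
        dependsOn_flowSum B d a _ fun v hv => h v (hsub (T.sbelow_subset_below a hv))]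

theorem measurable_update_eval (j : ℕ) (a : V) :
    Measurable fun p : (ℕ → ℝ) × (V → ℝ) => (update p.1 j (p.2 a), p.2) :=
  ((measurable_update_pair j).comp
    (measurable_fst.prodMk ((measurable_pi_apply a).comp measurable_snd))).prodMk measurable_snd

theorem measurable_flowSum [SFinite F] (hB : MeasurableSet B) : ∀ d u,
    Measurable fun p : (ℕ → ℝ) × (V → ℝ) => T.flowSum B M F d u p.1 p.2
  | 0, _ => (measurable_one.indicator hB).comp measurable_fst
  | d + 1, u => Finset.measurable_fun_sum _ fun a _ =>
      (((measurable_flowDensity M F hB d (T.lvl u)).comp measurable_fst).mul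
        (measurable_flowSum hB d a)).comp (measurable_update_eval (T.lvl u) a)

/-- The contribution to `flowSum` of the paths through the child `a` of `u`. -/
noncomputable def flowTerm (B : Set (ℕ → ℝ)) (d : ℕ) (u a : V) (x : ℕ → ℝ) (X : V → ℝ) : ℝ≥0∞ :=
  flowDensity B M F d (T.lvl u) (update x (T.lvl u) (X a)) *
        T.flowSum B M F d a (update x (T.lvl u) (X a)) X

theorem measurable_flowTerm [SFinite F] (hB : MeasurableSet B) (d : ℕ) (u a : V) (x : ℕ → ℝ) :
    Measurable (T.flowTerm M F B d u a x) :=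
  (((measurable_flowDensity M F hB d (T.lvl u)).comp measurable_fst).mul
        (T.measurable_flowSum M F hB d a)).comp
    ((measurable_update_eval (T.lvl u) a).comp measurable_prodMk_left)

theorem dependsOn_flowTerm (d : ℕ) (u a : V) (x : ℕ → ℝ) :
    DependsOn (T.flowTerm M F B d u a x) (T.below a) := fun X Y h => by
  unfold flowTerm
  rw [h a (T.self_mem_below a),
    T.dependsOn_flowSum M F B d a _ fun v hv => h v (T.sbelow_subset_below a hv)]

variable [IsProbabilityMeasure F]

local notation "ℙF" => Measure.infinitePi (fun _ : V => F)

theorem lintegral_flowTerm_pow (hB : MeasurableSet B) (d : ℕ) (u a : V) (x : ℕ → ℝ) (k : ℕ) :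
    ∫⁻ X, T.flowTerm M F B d u a x X ^ k ∂ℙF =
      ∫⁻ y, flowDensity B M F d (T.lvl u) (update x (T.lvl u) y) ^ k *
        ∫⁻ X, T.flowSum B M F d a (update x (T.lvl u) y) X ^ k ∂ℙF ∂F := by
  have hm : Measurable fun p : ℝ × (V → ℝ) => (update x (T.lvl u) p.1, p.2) :=
    ((measurable_update x).comp measurable_fst).prodMk measurable_snd
  have := lintegral_eval_of_dependsOn (fun _ : V => F) (T.self_notMem_sbelow a)
    (f := fun p : ℝ × (V → ℝ) => (flowDensity B M F d (T.lvl u) (update x (T.lvl u) p.1) *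
        T.flowSum B M F d a (update x (T.lvl u) p.1) p.2) ^ k)
    (((((measurable_flowDensity M F hB d (T.lvl u)).comp measurable_fst).mul
        (T.measurable_flowSum M F hB d a)).comp hm).pow_const k)
    (fun y X Y h => by simp only [T.dependsOn_flowSum M F B d a _ h])
  refine this.trans (lintegral_congr fun y => ?_)
  simp only [mul_pow]
  rw [lintegral_const_mul]
  exact ((T.measurable_flowSum M F hB d a).comp measurable_prodMk_left).pow_const k

theorem lintegral_flowSum_succ (hB : MeasurableSet B) (d : ℕ) (u : V) (x : ℕ → ℝ) :
    ∫⁻ X, T.flowSum B M F (d + 1) u x X ∂ℙF = ∑ a ∈ T.ch u,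
      ∫⁻ y, flowDensity B M F d (T.lvl u) (update x (T.lvl u) y) *
        ∫⁻ X, T.flowSum B M F d a (update x (T.lvl u) y) X ∂ℙF ∂F := by
  have h1 : T.flowSum B M F (d + 1) u x = fun X => ∑ a ∈ T.ch u, T.flowTerm M F B d u a x X := rfl
  rw [h1, lintegral_finsetSum _ fun a _ => T.measurable_flowTerm M F hB d u a x]
  refine Finset.sum_congr rfl fun a _ => ?_
  simpa using T.lintegral_flowTerm_pow M F hB d u a x 1

theorem lintegral_flowDensity_le (hB : MeasurableSet B) (d j : ℕ) (x : ℕ → ℝ) :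
    ∫⁻ y, flowDensity B M F d j (update x j y) ∂F ≤ 1 := by
  rw [lintegral_flowDensity B M F d j x (measurable_conductance M F hB d (j + 1))]
  exact ENNReal.div_self_le_one

theorem lintegral_flowSum_le (hB : MeasurableSet B) : ∀ d u x,
    ∫⁻ X, T.flowSum B M F d u x X ∂ℙF ≤ T.cnt d u
  | 0, u, x => by
    simp only [flowSum, cnt, lintegral_const, measure_univ, mul_one, Nat.cast_one]
    exact Set.indicator_le' (fun _ _ => le_rfl) (fun _ _ => zero_le) x
  | d + 1, u, x => by
    rw [lintegral_flowSum_succ T M F hB, cnt, Nat.cast_sum]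
    refine Finset.sum_le_sum fun a _ => ?_
    calc _ ≤ ∫⁻ y, flowDensity B M F d (T.lvl u) (update x (T.lvl u) y) * T.cnt d a ∂F :=
          lintegral_mono fun y => by gcongr; exact lintegral_flowSum_le hB d a _
      _ = (∫⁻ y, flowDensity B M F d (T.lvl u) (update x (T.lvl u) y) ∂F) * T.cnt d a :=
          lintegral_mul_const _ ((measurable_flowDensity M F hB d _).comp (measurable_update x))
      _ ≤ 1 * T.cnt d a := by gcongr; exact lintegral_flowDensity_le M F hB d _ x
      _ = _ := one_mul _

/-- Each path contributes the total mass of the flow, which is `1` unless the target is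
unreachable. -/
theorem lintegral_flowSum (hB : MeasurableSet B) : ∀ d u x,
    conductance B M F d (T.lvl u) x ≠ 0 → ∫⁻ X, T.flowSum B M F d u x X ∂ℙF = T.cnt d u
  | 0, u, x, h => by
    have : x ∈ B := by
      by_contra hx
      exact h (Set.indicator_of_notMem (s := B) hx _)
    simp [flowSum, cnt, this]
  | d + 1, u, x, h => by
    rw [lintegral_flowSum_succ T M F hB, cnt, Nat.cast_sum]
    refine Finset.sum_congr rfl fun a ha => ?_
    calc _ = ∫⁻ y, flowDensity B M F d (T.lvl u) (update x (T.lvl u) y) * T.cnt d a ∂F := by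
          refine lintegral_congr fun y => ?_
          by_cases h0 : conductance B M F d (T.lvl u + 1) (update x (T.lvl u) y) = 0
          · simp [flowDensity_eq_zero h0]
          · rw [lintegral_flowSum hB d a _ (by rwa [T.lvl_of_mem ha])]
      _ = (∫⁻ y, flowDensity B M F d (T.lvl u) (update x (T.lvl u) y) ∂F) * T.cnt d a :=
          lintegral_mul_const _ ((measurable_flowDensity M F hB d _).comp (measurable_update x))
      _ = 1 * T.cnt d a := by
          rw [lintegral_flowDensity B M F d _ x (measurable_conductance M F hB d _),
            ENNReal.div_self (lintegral_conductance_ne_zero h)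
              (ne_top_of_le_ne_top ENNReal.one_ne_top (lintegral_conductance_le_one B M F d _ x))]
      _ = _ := one_mul _

theorem lintegral_flowTerm_le (hB : MeasurableSet B) (d : ℕ) (u a : V) (x : ℕ → ℝ) :
    ∫⁻ X, T.flowTerm M F B d u a x X ∂ℙF ≤ T.cnt d a := by
  have := T.lintegral_flowTerm_pow M F hB d u a x 1
  simp only [pow_one] at this
  rw [this]
  calc _ ≤ ∫⁻ y, flowDensity B M F d (T.lvl u) (update x (T.lvl u) y) * T.cnt d a ∂F :=
          lintegral_mono fun y => by gcongr; exact T.lintegral_flowSum_le M F hB d a _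
      _ = (∫⁻ y, flowDensity B M F d (T.lvl u) (update x (T.lvl u) y) ∂F) * T.cnt d a :=
          lintegral_mul_const _ ((measurable_flowDensity M F hB d _).comp (measurable_update x))
      _ ≤ 1 * T.cnt d a := by gcongr; exact lintegral_flowDensity_le M F hB d _ x
      _ = _ := one_mul _

/-- The second moment of the flow sum is governed by the pairs of paths: two paths that split after
`i` steps share `i` labels, and contribute the second moment of the flow density there; the rest of
the two paths is independent. -/
theorem lintegral_flowSum_sq_le (hB : MeasurableSet B) : ∀ d u x,
    ∫⁻ X, T.flowSum B M F d u x X ^ 2 ∂ℙF ≤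
      ∑ i ∈ Finset.range (d + 1), T.pairs d i u * flowEnergy B M F d (T.lvl u) i x
  | 0, u, x => by
    simp only [flowSum, lintegral_const, measure_univ, mul_one]
    by_cases hx : x ∈ B <;> simp [hx, pairs, flowEnergy]
  | d + 1, u, x => by
    classical
    have h1 : ∀ X, T.flowSum B M F (d + 1) u x X ^ 2 =
        (∑ a ∈ T.ch u, T.flowTerm M F B d u a x X ^ 2) +
        ∑ a ∈ T.ch u, ∑ b ∈ T.ch u with b ≠ a,
          T.flowTerm M F B d u a x X * T.flowTerm M F B d u b x X := by
      intro X
      have : T.flowSum B M F (d + 1) u x X = ∑ a ∈ T.ch u, T.flowTerm M F B d u a x X := rfl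
      rw [this, sq, Finset.sum_mul_sum, ← Finset.sum_add_distrib]
      refine Finset.sum_congr rfl fun a ha => ?_
      rw [← Finset.add_sum_erase _ _ ha, sq]
      congr 1
      exact Finset.sum_congr (by ext b; simp [and_comm]) fun _ _ => rfl
    have hm := T.measurable_flowTerm M F hB d u (x := x)
    simp only [h1]
    rw [lintegral_add_left (by fun_prop), lintegral_finsetSum _ (by fun_prop),
      lintegral_finsetSum _ (by fun_prop), Finset.sum_range_succ']
    refine add_le_add ?_ ?_
    · simp only [pairs, flowEnergy]
      push_cast
      simp only [Finset.sum_mul]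
      rw [Finset.sum_comm]
      refine Finset.sum_le_sum fun a ha => ?_
      rw [T.lintegral_flowTerm_pow M F hB]
      calc _ ≤ ∫⁻ y, ∑ i ∈ Finset.range (d + 1), T.pairs d i a *
            (flowDensity B M F d (T.lvl u) (update x (T.lvl u) y) ^ 2 *
              flowEnergy B M F d (T.lvl u + 1) i (update x (T.lvl u) y)) ∂F := by
            refine lintegral_mono fun y => ?_
            refine (mul_le_mul_right (lintegral_flowSum_sq_le hB d a _) _).trans ?_
            rw [Finset.mul_sum, T.lvl_of_mem ha]
            exact Finset.sum_le_sum fun i _ => by rw [mul_left_comm]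
        _ = _ := by
            have hm' : ∀ i, Measurable fun y =>
                (flowDensity B M F d (T.lvl u) (update x (T.lvl u) y) ^ 2 *
                  flowEnergy B M F d (T.lvl u + 1) i (update x (T.lvl u) y)) := fun i =>
              (((measurable_flowDensity M F hB d _).pow_const 2).mul
                (measurable_flowEnergy M F hB d _ i)).comp (measurable_update x)
            rw [lintegral_finsetSum _ fun i _ => (hm' i).const_mul _]
            exact Finset.sum_congr rfl fun i _ => lintegral_const_mul _ (hm' i)
    · simp only [pairs, flowEnergy, mul_one]
      push_cast
      refine Finset.sum_le_sum fun a ha => ?_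
      rw [lintegral_finsetSum _ (by fun_prop)]
      refine Finset.sum_le_sum fun b hb => ?_
      rw [Finset.mem_filter] at hb
      rw [lintegral_mul_of_dependsOn (fun _ : V => F) (hm a) (hm b)
        (T.dependsOn_flowTerm M F d u a x) (T.dependsOn_flowTerm M F d u b x)
        (disjoint_below ha hb.1 hb.2.symm)]
      exact mul_le_mul' (T.lintegral_flowTerm_le M F hB d u a x)
        (T.lintegral_flowTerm_le M F hB d u b x)

/-- The second moment method: a tree in which few pairs of paths coincide for long hits the target
with probability at least its conductance, up to a factor. -/
theorem conductance_le_measure_Hit (hB : MeasurableSet B) (hM0 : ∀ j, M j ≠ 0)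
    (hM : ∀ j, M j ≠ ∞) (hM1 : M 0 = 1) {n : ℕ} {u : V} (hu : T.lvl u = 0) (x : ℕ → ℝ) {C : ℝ≥0∞}
    (hcnt : M n ≤ C * T.cnt n u)
    (hpairs : ∀ i ≤ n, T.pairs n i u * M i ≤ C * M n ^ 2) :
    conductance B M F n 0 x ≤ C ^ 3 * ℙF (T.Hit B n u x) := by
  set κ := conductance B M F n 0 x with hκ
  by_cases h0 : κ = 0
  · rw [h0]; exact zero_le
  have hκ1 : κ ≠ ∞ := ne_top_of_le_ne_top ENNReal.one_ne_top (conductance_le_one B M F _ _ _)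
  set Z := T.flowSum B M F n u x with hZ
  have hZm : Measurable Z := (T.measurable_flowSum M F hB n u).comp measurable_prodMk_left
  have hEZ : ∫⁻ X, Z X ∂ℙF = T.cnt n u := T.lintegral_flowSum M F hB n u x (by rwa [hu])
  have hEZ2 : ∫⁻ X, Z X ^ 2 ∂ℙF ≤ C * M n ^ 2 * κ⁻¹ := by
    refine (T.lintegral_flowSum_sq_le M F hB n u x).trans ?_
    calc _ ≤ ∑ i ∈ Finset.range (n + 1), C * M n ^ 2 * (flowEnergy B M F n 0 i x / M (0 + i)) := by
          refine Finset.sum_le_sum fun i hi => ?_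
          have := hpairs i (by simpa [Nat.lt_succ_iff] using hi)
          rw [hu, zero_add, div_eq_mul_inv, mul_left_comm, mul_comm (flowEnergy _ _ _ _ _ _ _),
            ← div_eq_mul_inv]
          gcongr
          exact (ENNReal.le_div_iff_mul_le (Or.inl (hM0 i)) (Or.inl (hM i))).2 this
      _ ≤ _ := by
          rw [← Finset.mul_sum]
          gcongr
          refine (sum_flowEnergy_le hB hM0 hM n 0 x h0).trans ?_
          rw [hM1, one_mul]
  -- The flow sum vanishes off the hitting event, so the Cauchy-Schwarz inequality bounds the
  -- probability of the event by the first two moments of the sum.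
  set A := toMeasurable ℙF (T.Hit B n u x) with hA
  have hZA : ∀ X, Z X = Z X * A.indicator 1 X := by
    intro X
    by_cases hX : X ∈ A
    · simp [hX]
    · have : Z X = 0 := T.flowSum_eq_zero_of_notMem_Hit M F n u x X
        fun h => hX (subset_toMeasurable _ _ h)
      simp [this]
  have hCS : (∫⁻ X, Z X ∂ℙF) ^ 2 ≤ (∫⁻ X, Z X ^ 2 ∂ℙF) * ℙF (T.Hit B n u x) := by
    have hH := ENNReal.lintegral_mul_le_Lp_mul_Lq ℙF Real.HolderConjugate.two_two
      hZm.aemeasurable (g := A.indicator 1)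
      (measurable_one.indicator (measurableSet_toMeasurable _ _)).aemeasurable
    have h2 : ∫⁻ X, (A.indicator (1 : (V → ℝ) → ℝ≥0∞) X) ^ (2 : ℝ) ∂ℙF = ℙF (T.Hit B n u x) := by
      rw [← measure_toMeasurable, ← lintegral_indicator_one (measurableSet_toMeasurable _ _)]
      refine lintegral_congr fun X => ?_
      by_cases hX : X ∈ A <;> simp [hX, ← hA]
    calc (∫⁻ X, Z X ∂ℙF) ^ 2 = (∫⁻ X, Z X * A.indicator 1 X ∂ℙF) ^ 2 := by
          congr 1; exact lintegral_congr hZA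
      _ ≤ _ := pow_le_pow_left' hH 2
      _ = _ := by
          rw [h2, mul_pow, ← ENNReal.rpow_natCast, ← ENNReal.rpow_natCast, ← ENNReal.rpow_mul,
            ← ENNReal.rpow_mul]
          norm_num
  have hMn : M n ^ 2 ≠ 0 := pow_ne_zero _ (hM0 n)
  have hMn' : M n ^ 2 ≠ ∞ := ENNReal.pow_ne_top (hM n)
  have key : M n ^ 2 * κ ≤ M n ^ 2 * (C ^ 3 * ℙF (T.Hit B n u x)) := by
    calc M n ^ 2 * κ ≤ (C * T.cnt n u) ^ 2 * κ := by gcongr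
      _ ≤ C ^ 2 * ((C * M n ^ 2 * κ⁻¹) * ℙF (T.Hit B n u x)) * κ := by
          rw [mul_pow, ← hEZ]
          gcongr
          exact hCS.trans (by gcongr)
      _ = M n ^ 2 * (C ^ 3 * ℙF (T.Hit B n u x)) * (κ⁻¹ * κ) := by ring
      _ = _ := by rw [ENNReal.inv_mul_cancel h0 hκ1, mul_one]
  exact (ENNReal.mul_le_mul_iff_right hMn hMn').1 key

end FlowSum

end LayeredTree

/-! ### Spherically symmetric trees -/

section Perspective

variable (F : Measure ℝ)

/-- The perspective `c • Λ (f / c)` of the concave functional `Λ f = - log ∫ exp (- f) dF`, with the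
value `0` at `c = 0`. -/
noncomputable def persp (c : ℝ) (f : ℝ → ℝ) : ℝ :=
  if c = 0 then 0 else c * -Real.log (∫ y, Real.exp (-(f y / c)) ∂F)

variable {F} [IsProbabilityMeasure F]

theorem integrable_exp_neg {α : Type*} [MeasurableSpace α] {μ : Measure α} [IsFiniteMeasure μ]
    {f : α → ℝ} (hf : Measurable f) (h0 : ∀ y, 0 ≤ f y) :
    Integrable (fun y => Real.exp (-f y)) μ :=
  Integrable.of_bound (C := 1) (by fun_prop) (Filter.Eventually.of_forall fun y => by
    rw [Real.norm_eq_abs, Real.abs_exp]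
    exact Real.exp_le_one_iff.2 (by linarith [h0 y]))

theorem integral_exp_neg_pos {α : Type*} [MeasurableSpace α] {μ : Measure α}
    [IsProbabilityMeasure μ] {f : α → ℝ} (hf : Measurable f) (h0 : ∀ y, 0 ≤ f y) :
    0 < ∫ y, Real.exp (-f y) ∂μ := integral_exp_pos (integrable_exp_neg hf h0)

theorem integral_exp_neg_le_one {α : Type*} [MeasurableSpace α] {μ : Measure α}
    [IsProbabilityMeasure μ] {f : α → ℝ} (hf : Measurable f) (h0 : ∀ y, 0 ≤ f y) :
    ∫ y, Real.exp (-f y) ∂μ ≤ 1 := by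
  calc ∫ y, Real.exp (-f y) ∂μ ≤ ∫ _, (1 : ℝ) ∂μ :=
        integral_mono (integrable_exp_neg hf h0) (integrable_const _)
          fun y => Real.exp_le_one_iff.2 (by linarith [h0 y])
    _ = 1 := by simp

theorem persp_nonneg {c : ℝ} (hc : 0 ≤ c) {f : ℝ → ℝ} (hf : Measurable f) (h0 : ∀ y, 0 ≤ f y) :
    0 ≤ persp F c f := by
  unfold persp
  split_ifs with h
  · exact le_rfl
  · have h0' : ∀ y, 0 ≤ f y / c := fun y => div_nonneg (h0 y) hc
    exact mul_nonneg hc (neg_nonneg.2 (Real.log_nonpos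
      (integral_exp_neg_pos (hf.div_const c) h0').le
      (integral_exp_neg_le_one (hf.div_const c) h0')))

theorem persp_mono {c : ℝ} (hc : 0 ≤ c) {f g : ℝ → ℝ} (hf : Measurable f) (hg : Measurable g)
    (h0 : ∀ y, 0 ≤ f y) (hfg : ∀ y, f y ≤ g y) : persp F c f ≤ persp F c g := by
  unfold persp
  split_ifs with h
  · exact le_rfl
  · have hf0 : ∀ y, 0 ≤ f y / c := fun y => div_nonneg (h0 y) hc
    have hg0 : ∀ y, 0 ≤ g y / c := fun y => div_nonneg ((h0 y).trans (hfg y)) hc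
    refine mul_le_mul_of_nonneg_left (neg_le_neg (Real.log_le_log
      (integral_exp_neg_pos (hg.div_const c) hg0) (integral_mono
        (integrable_exp_neg (hg.div_const c) hg0) (integrable_exp_neg (hf.div_const c) hf0)
        fun y => Real.exp_le_exp.2 (neg_le_neg ?_)))) hc
    exact div_le_div_of_nonneg_right (hfg y) hc

/-- Superadditivity of the perspective; the essential case is Hölder's inequality. -/
theorem persp_add_le {c c' : ℝ} (hc : 0 ≤ c) (hc' : 0 ≤ c') {f f' : ℝ → ℝ} (hf : Measurable f)
    (hf' : Measurable f') (h0 : ∀ y, 0 ≤ f y) (h0' : ∀ y, 0 ≤ f' y) :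
    persp F c f + persp F c' f' ≤ persp F (c + c') fun y => f y + f' y := by
  rcases hc.eq_or_lt with rfl | hcp
  · have : persp F 0 f = 0 := by simp [persp]
    rw [this, zero_add, zero_add]
    exact persp_mono hc' hf' (hf.add hf') h0' fun y => by linarith [h0 y]
  rcases hc'.eq_or_lt with rfl | hcp'
  · have : persp F 0 f' = 0 := by simp [persp]
    rw [this, add_zero, add_zero]
    exact persp_mono hc hf (hf.add hf') h0 fun y => by linarith [h0' y]
  have hs : 0 < c + c' := by linarith
  unfold persp
  rw [if_neg hcp.ne', if_neg hcp'.ne', if_neg hs.ne']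
  have hi := integrable_exp_neg (μ := F) (hf.div_const c) fun y => div_nonneg (h0 y) hc
  have hi' := integrable_exp_neg (μ := F) (hf'.div_const c') fun y => div_nonneg (h0' y) hc'
  have hp := integral_exp_neg_pos (μ := F) (hf.div_const c) fun y => div_nonneg (h0 y) hc
  have hp' := integral_exp_neg_pos (μ := F) (hf'.div_const c') fun y => div_nonneg (h0' y) hc'
  have hm0 : ∀ y, 0 ≤ (f y + f' y) / (c + c') := fun y =>
    div_nonneg (add_nonneg (h0 y) (h0' y)) hs.le
  have hj := integrable_exp_neg (μ := F) ((hf.add hf').div_const (c + c')) hm0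
  have hjp : 0 < ∫ y, Real.exp (-((f y + f' y) / (c + c'))) ∂F :=
    integral_exp_neg_pos ((hf.add hf').div_const (c + c')) hm0
  set I := ∫ y, Real.exp (-(f y / c)) ∂F
  set I' := ∫ y, Real.exp (-(f' y / c')) ∂F
  set J := ∫ y, Real.exp (-((f y + f' y) / (c + c'))) ∂F
  set p := c / (c + c') with hpdef
  set q := c' / (c + c') with hqdef
  have hpq : p + q = 1 := by rw [hpdef, hqdef]; field_simp
  have hp0 : 0 ≤ p := by positivity
  have hq0 : 0 ≤ q := by positivity
  set L := -Real.log I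
  set L' := -Real.log I'
  have hL : Real.exp L * I = 1 := by
    rw [Real.exp_neg, Real.exp_log hp, inv_mul_cancel₀ hp.ne']
  have hL' : Real.exp L' * I' = 1 := by
    rw [Real.exp_neg, Real.exp_log hp', inv_mul_cancel₀ hp'.ne']
  -- Convexity of `exp`, after normalizing both integrals to `1`
  have hpt : ∀ y, Real.exp (p * L + q * L') * Real.exp (-((f y + f' y) / (c + c'))) ≤
      p * (Real.exp L * Real.exp (-(f y / c))) + q * (Real.exp L' * Real.exp (-(f' y / c'))) := by
    intro y
    rw [← Real.exp_add, ← Real.exp_add, ← Real.exp_add]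
    have := convexOn_exp.2 (Set.mem_univ (L + -(f y / c))) (Set.mem_univ (L' + -(f' y / c')))
      hp0 hq0 hpq
    refine le_trans (le_of_eq ?_) this
    congr 1
    simp only [smul_eq_mul, hpdef, hqdef]
    field_simp
    ring
  have hint : Real.exp (p * L + q * L') * J ≤ 1 := by
    calc Real.exp (p * L + q * L') * J
        = ∫ y, Real.exp (p * L + q * L') * Real.exp (-((f y + f' y) / (c + c'))) ∂F :=
          (integral_const_mul _ _).symm
      _ ≤ ∫ y, p * (Real.exp L * Real.exp (-(f y / c))) +
            q * (Real.exp L' * Real.exp (-(f' y / c'))) ∂F :=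
          integral_mono (hj.const_mul _) (((hi.const_mul _).const_mul _).add
            ((hi'.const_mul _).const_mul _)) hpt
      _ = 1 := by
          rw [integral_add ((hi.const_mul _).const_mul _) ((hi'.const_mul _).const_mul _),
            integral_const_mul, integral_const_mul, integral_const_mul, integral_const_mul,
            hL, hL', mul_one, mul_one, hpq]
  have hlog : p * L + q * L' ≤ -Real.log J := by
    have : J ≤ Real.exp (-(p * L + q * L')) := by
      rw [Real.exp_neg, ← one_div, le_div_iff₀ (Real.exp_pos _)]
      linarith
    have := Real.log_le_log hjp this
    rw [Real.log_exp] at this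
    linarith
  calc c * L + c' * L' = (c + c') * (p * L + q * L') := by
        rw [hpdef, hqdef]; field_simp
    _ ≤ _ := mul_le_mul_of_nonneg_left hlog hs.le

end Perspective

section Potential

variable (B : Set (ℕ → ℝ)) (F : Measure ℝ)

/-- Minus the logarithm of the probability that a spherically symmetric tree with `s i` vertices on
level `i`, `i ≤ d`, has no path into `B`, with the branching numbers `s (i + 1) / s i` replaced by
exponents, and a path into `B` being kept with probability `1 - exp (-1)`. The labels are inserted
into `x` from the position `j` on. -/
noncomputable def pot : ℕ → ℕ → (ℕ → ℝ) → (ℕ → ℝ) → ℝ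
  | 0, _, s, x => s 0 * B.indicator 1 x
  | d + 1, j, s, x => persp F (s 1) fun y => pot d (j + 1) (fun i => s (i + 1)) (update x j y)

variable {B F}

theorem measurable_pot [SFinite F] (hB : MeasurableSet B) : ∀ d j s, Measurable (pot B F d j s)
  | 0, _, s => (measurable_one.indicator hB).const_mul (s 0)
  | d + 1, j, s => by
    change Measurable fun x => persp F (s 1) fun y =>
      pot B F d (j + 1) (fun i => s (i + 1)) (update x j y)
    unfold persp
    by_cases h : s 1 = 0
    · simp [h]
    · simp only [h, if_false]
      have h1 : Measurable fun p : (ℕ → ℝ) × ℝ => Real.exp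
          (-(pot B F d (j + 1) (fun i => s (i + 1)) (update p.1 j p.2) / s 1)) :=
        Real.measurable_exp.comp (((measurable_pot hB d (j + 1) _).comp
          (measurable_update_pair j)).div_const _).neg
      have h2 := (h1.stronglyMeasurable.integral_prod_right' (ν := F)).measurable
      exact (Real.measurable_log.comp h2).neg.const_mul _

variable [IsProbabilityMeasure F]

theorem pot_nonneg (hB : MeasurableSet B) : ∀ d j s x, (∀ i, 0 ≤ s i) → 0 ≤ pot B F d j s x
  | 0, _, _, x, hs => mul_nonneg (hs 0) (Set.indicator_nonneg (fun _ _ => zero_le_one) x)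
  | d + 1, j, _, x, hs => persp_nonneg (hs 1)
      ((measurable_pot hB d (j + 1) _).comp (measurable_update x))
      fun _ => pot_nonneg hB d (j + 1) _ _ fun i => hs (i + 1)

theorem pot_add_le (hB : MeasurableSet B) : ∀ d j s s' x, (∀ i, 0 ≤ s i) → (∀ i, 0 ≤ s' i) →
    pot B F d j s x + pot B F d j s' x ≤ pot B F d j (s + s') x
  | 0, _, s, s', x, _, _ => by simp [pot, add_mul]
  | d + 1, j, s, s', x, hs, hs' => by
    have hm : ∀ t, Measurable fun y => pot B F d (j + 1) t (update x j y) := fun t =>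
      (measurable_pot hB d (j + 1) t).comp (measurable_update x)
    have hn : ∀ t, (∀ i, 0 ≤ t i) → ∀ y, 0 ≤ pot B F d (j + 1) t (update x j y) := fun t ht y =>
      pot_nonneg hB d (j + 1) t _ ht
    refine (persp_add_le (hs 1) (hs' 1) (hm _) (hm _) (hn _ fun i => hs (i + 1))
      (hn _ fun i => hs' (i + 1))).trans ?_
    refine persp_mono (add_nonneg (hs 1) (hs' 1)) ((hm _).add (hm _)) (hm _)
      (fun y => add_nonneg (hn _ (fun i => hs (i + 1)) y) (hn _ (fun i => hs' (i + 1)) y))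
      fun y => ?_
    exact pot_add_le hB d (j + 1) _ _ _ (fun i => hs (i + 1)) fun i => hs' (i + 1)

theorem sum_pot_le (hB : MeasurableSet B) {κ : Type*} (A : Finset κ) (d j : ℕ) (s : κ → ℕ → ℝ)
    (x : ℕ → ℝ) (hs : ∀ a i, 0 ≤ s a i) :
    ∑ a ∈ A, pot B F d j (s a) x ≤ pot B F d j (∑ a ∈ A, s a) x := by
  classical
  induction A using Finset.induction_on with
  | empty => simpa using pot_nonneg hB d j 0 x fun _ => le_rfl
  | insert a A ha ih =>
    rw [Finset.sum_insert ha, Finset.sum_insert ha]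
    refine (add_le_add_right ih _).trans (pot_add_le hB d j _ _ x (hs a) fun i => ?_)
    rw [Finset.sum_apply]
    exact Finset.sum_nonneg fun b _ => hs b i

theorem pot_mono (hB : MeasurableSet B) (d j : ℕ) {s s' : ℕ → ℝ} (x : ℕ → ℝ) (hs : ∀ i, 0 ≤ s i)
    (hss : ∀ i, s i ≤ s' i) : pot B F d j s x ≤ pot B F d j s' x := by
  have h := pot_add_le (F := F) hB d j s (s' - s) x hs fun i => sub_nonneg.2 (hss i)
  rw [add_sub_cancel] at h
  exact le_trans (le_add_of_nonneg_right
    (pot_nonneg hB d j _ x fun i => sub_nonneg.2 (hss i))) h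

end Potential

/-! ### The upper bound for the hitting probability -/

theorem Set.indicator_one_congr {α : Type*} {β : Type*} [Zero β] [One β] {A A' : Set α} {a b : α}
    (h : a ∈ A ↔ b ∈ A') : A.indicator (1 : α → β) a = A'.indicator 1 b := by
  by_cases ha : a ∈ A
  · simp [ha, h.1 ha]
  · simp [ha, mt h.2 ha]

/-- Given the events of probabilities `t a`, a thinning with retention probability `δ` that is
independent for each `a` leaves more occurrences than a simultaneous one. -/
theorem prod_one_sub_mul_le {κ : Type*} (A : Finset κ) {δ : ℝ} (hδ0 : 0 ≤ δ) (hδ1 : δ ≤ 1)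
    {t : κ → ℝ} (h0 : ∀ a ∈ A, 0 ≤ t a) (h1 : ∀ a ∈ A, t a ≤ 1) :
    ∏ a ∈ A, (1 - δ * t a) ≤ 1 - δ + δ * ∏ a ∈ A, (1 - t a) := by
  classical
  induction A using Finset.induction_on with
  | empty => simp
  | insert a A ha ih =>
    rw [Finset.prod_insert ha, Finset.prod_insert ha]
    have ih' := ih (fun b hb => h0 b (Finset.mem_insert_of_mem hb))
      fun b hb => h1 b (Finset.mem_insert_of_mem hb)
    have ha0 := h0 a (Finset.mem_insert_self a A)
    have ha1 := h1 a (Finset.mem_insert_self a A)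
    have hP0 : 0 ≤ ∏ b ∈ A, (1 - t b) := Finset.prod_nonneg fun b hb =>
      sub_nonneg.2 (h1 b (Finset.mem_insert_of_mem hb))
    have hP1 : ∏ b ∈ A, (1 - t b) ≤ 1 := Finset.prod_le_one
      (fun b hb => sub_nonneg.2 (h1 b (Finset.mem_insert_of_mem hb)))
      fun b hb => by linarith [h0 b (Finset.mem_insert_of_mem hb)]
    set P := ∏ b ∈ A, (1 - t b)
    have hpos : 0 ≤ 1 - δ * t a := by nlinarith
    calc _ ≤ (1 - δ * t a) * (1 - δ + δ * P) := mul_le_mul_of_nonneg_left ih' hpos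
      _ ≤ _ := by
        nlinarith [mul_nonneg (mul_nonneg hδ0 ha0)
          (mul_nonneg (sub_nonneg.2 hδ1) (sub_nonneg.2 hP1))]

namespace LayeredTree

variable {V : Type*} (T : LayeredTree V) {B : Set (ℕ → ℝ)} (F : Measure ℝ)

theorem measurableSet_Hit (hB : MeasurableSet B) : ∀ d u,
    MeasurableSet {p : (ℕ → ℝ) × (V → ℝ) | p.2 ∈ T.Hit B d u p.1}
  | 0, _ => measurable_fst hB
  | d + 1, u => by
    have : {p : (ℕ → ℝ) × (V → ℝ) | p.2 ∈ T.Hit B (d + 1) u p.1} =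
        ⋃ a ∈ T.ch u, (fun p : (ℕ → ℝ) × (V → ℝ) => (update p.1 (T.lvl u) (p.2 a), p.2)) ⁻¹'
          {p | p.2 ∈ T.Hit B d a p.1} := by
      ext p
      simp [Hit]
    rw [this]
    exact Finset.measurableSet_biUnion _ fun a _ =>
      measurable_update_eval (T.lvl u) a (measurableSet_Hit hB d a)

variable (B) in
theorem dependsOn_Hit : ∀ d u x, DependsOn (fun X => X ∈ T.Hit B d u x) (T.sbelow u)
  | 0, _, _ => fun _ _ _ => rfl
  | d + 1, u, x => fun X Y h => by
      refine propext (exists_congr fun a => and_congr_right fun ha => ?_)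
      have hsub := below_subset_sbelow ha
      rw [h a (hsub (T.self_mem_below a))]
      exact (dependsOn_Hit d a _ fun v hv => h v (hsub (T.sbelow_subset_below a hv))).to_iff

variable [IsProbabilityMeasure F]

local notation "ℙF" => Measure.infinitePi (fun _ : V => F)

variable (B) in
/-- The event that some descending path of length `d + 1` from `u` through its child `a` hits. -/
def HitVia (d : ℕ) (u a : V) (x : ℕ → ℝ) : Set (V → ℝ) :=
  {X | X ∈ T.Hit B d a (update x (T.lvl u) (X a))}

theorem measurableSet_HitVia (hB : MeasurableSet B) (d : ℕ) (u a : V) (x : ℕ → ℝ) :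
    MeasurableSet (T.HitVia B d u a x) :=
  ((measurable_update_eval (T.lvl u) a).comp measurable_prodMk_left) (T.measurableSet_Hit hB d a)

theorem measure_HitVia (hB : MeasurableSet B) (d : ℕ) (u a : V) (x : ℕ → ℝ) :
    ℙF (T.HitVia B d u a x) = ∫⁻ y, ℙF (T.Hit B d a (update x (T.lvl u) y)) ∂F := by
  have hm : Measurable fun p : ℝ × (V → ℝ) => (update x (T.lvl u) p.1, p.2) :=
    ((measurable_update x).comp measurable_fst).prodMk measurable_snd
  have hS : MeasurableSet {p : ℝ × (V → ℝ) | p.2 ∈ T.Hit B d a (update x (T.lvl u) p.1)} :=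
    hm (T.measurableSet_Hit hB d a)
  have := lintegral_eval_of_dependsOn (fun _ : V => F) (T.self_notMem_sbelow a)
    (f := {p : ℝ × (V → ℝ) | p.2 ∈ T.Hit B d a (update x (T.lvl u) p.1)}.indicator 1)
    (measurable_one.indicator hS) (fun y X Y h =>
      Set.indicator_one_congr (T.dependsOn_Hit B d a (update x (T.lvl u) y) h).to_iff)
  rw [← lintegral_indicator_one (T.measurableSet_HitVia hB d u a x)]
  refine Eq.trans ?_ (this.trans ?_)
  · rfl
  · refine lintegral_congr fun y => ?_
    rw [← lintegral_indicator_one]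
    · rfl
    · exact measurable_prodMk_left hS

theorem measurable_measure_Hit (hB : MeasurableSet B) (d : ℕ) (u a : V) (x : ℕ → ℝ) :
    Measurable fun y => ℙF (T.Hit B d a (update x (T.lvl u) y)) := by
  have hm : Measurable fun p : ℝ × (V → ℝ) => (update x (T.lvl u) p.1, p.2) :=
    ((measurable_update x).comp measurable_fst).prodMk measurable_snd
  exact measurable_measure_prodMk_left (hm (T.measurableSet_Hit hB d a))

theorem real_HitVia (hB : MeasurableSet B) (d : ℕ) (u a : V) (x : ℕ → ℝ) :
    (ℙF).real (T.HitVia B d u a x) = ∫ y, (ℙF).real (T.Hit B d a (update x (T.lvl u) y)) ∂F := by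
  rw [measureReal_def, T.measure_HitVia F hB]
  exact (integral_toReal (T.measurable_measure_Hit F hB d u a x).aemeasurable
    (Filter.Eventually.of_forall fun y => measure_lt_top _ _)).symm

theorem one_sub_real_Hit_succ (hB : MeasurableSet B) (d : ℕ) (u : V) (x : ℕ → ℝ) :
    1 - (ℙF).real (T.Hit B (d + 1) u x) =
      ∏ a ∈ T.ch u, (1 - ∫ y, (ℙF).real (T.Hit B d a (update x (T.lvl u) y)) ∂F) := by
  have hU : T.Hit B (d + 1) u x = ⋃ a ∈ T.ch u, T.HitVia B d u a x := by
    ext X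
    simp [Hit, HitVia]
  have hUm : MeasurableSet (T.Hit B (d + 1) u x) := by
    rw [hU]
    exact Finset.measurableSet_biUnion _ fun a _ => T.measurableSet_HitVia hB d u a x
  rw [← probReal_compl_eq_one_sub hUm, ← integral_indicator_one hUm.compl]
  have hI : ∀ X, (T.Hit B (d + 1) u x)ᶜ.indicator (1 : (V → ℝ) → ℝ) X =
      ∏ a ∈ T.ch u, (T.HitVia B d u a x)ᶜ.indicator (1 : (V → ℝ) → ℝ) X := by
    intro X
    classical
    simp only [Set.indicator_apply, Pi.one_apply, hU, Set.mem_compl_iff, Set.mem_iUnion,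
      Finset.prod_ite_zero, Finset.prod_const_one]
    simp
  simp only [hI]
  rw [integral_finset_prod_of_dependsOn (fun _ : V => F) (T.ch u)
    (f := fun a => (T.HitVia B d u a x)ᶜ.indicator (1 : (V → ℝ) → ℝ)) (S := fun a => T.below a)]
  · refine Finset.prod_congr rfl fun a _ => ?_
    rw [integral_indicator_one (T.measurableSet_HitVia hB d u a x).compl,
      probReal_compl_eq_one_sub (T.measurableSet_HitVia hB d u a x), T.real_HitVia F hB]
  · exact fun a _ => measurable_one.indicator (T.measurableSet_HitVia hB d u a x).compl
  · intro a _ X Y h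
    have h1 : (X ∈ T.HitVia B d u a x) = (Y ∈ T.HitVia B d u a x) := by
      simp only [HitVia, Set.mem_ofPred_eq]
      rw [h a (T.self_mem_below a)]
      exact T.dependsOn_Hit B d a _ fun v hv => h v (T.sbelow_subset_below a hv)
    exact Set.indicator_one_congr (not_congr h1.to_iff)
  · exact fun a ha b hb hab => disjoint_below ha hb hab

/-- Among the trees with given level sizes, the spherically symmetric one is the most likely to hit
the target. -/
theorem exp_neg_pot_le (hB : MeasurableSet B) : ∀ d u x,
    Real.exp (-pot B F d (T.lvl u) (fun i => (T.cnt i u : ℝ)) x) ≤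
      1 - (1 - Real.exp (-1)) * (ℙF).real (T.Hit B d u x)
  | 0, u, x => by
    by_cases hx : x ∈ B <;> simp [pot, Hit, cnt, hx]
  | d + 1, u, x => by
    have hδ0 : 0 ≤ 1 - Real.exp (-1) := by
      have := Real.exp_le_one_iff.2 (show (-1 : ℝ) ≤ 0 by norm_num)
      linarith
    have hδ1 : 1 - Real.exp (-1) ≤ 1 := by linarith [Real.exp_pos (-1)]
    set δ := 1 - Real.exp (-1)
    have hhm : ∀ a, Measurable fun y => (ℙF).real (T.Hit B d a (update x (T.lvl u) y)) := fun a =>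
      (T.measurable_measure_Hit F hB d u a x).ennreal_toReal
    have hhi : ∀ a, Integrable (fun y => (ℙF).real (T.Hit B d a (update x (T.lvl u) y))) F :=
      fun a => Integrable.of_bound (C := 1) (hhm a).aestronglyMeasurable
        (Filter.Eventually.of_forall fun y => by
          rw [Real.norm_eq_abs, abs_of_nonneg measureReal_nonneg]
          exact measureReal_le_one)
    have h1 : 1 - δ * (ℙF).real (T.Hit B (d + 1) u x) =
        1 - δ + δ * ∏ a ∈ T.ch u, (1 - ∫ y, (ℙF).real (T.Hit B d a (update x (T.lvl u) y)) ∂F) := by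
      rw [← T.one_sub_real_Hit_succ F hB]; ring
    rw [h1]
    refine le_trans ?_ (prod_one_sub_mul_le (T.ch u) hδ0 hδ1
      (fun a _ => integral_nonneg fun y => measureReal_nonneg) fun a _ => ?_)
    swap
    · calc _ ≤ ∫ _, (1 : ℝ) ∂F := integral_mono (hhi a) (integrable_const _)
            fun y => measureReal_le_one
        _ = 1 := by simp
    -- The level sizes of `u` are, above the root, the sums of those of its children
    set s : V → ℕ → ℝ := fun a i => T.cnt (i - 1) a with hs
    have hsum : pot B F (d + 1) (T.lvl u) (fun i => (T.cnt i u : ℝ)) x =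
        pot B F (d + 1) (T.lvl u) (∑ a ∈ T.ch u, s a) x := by
      have hc0 : ∀ v, T.cnt 0 v = 1 := fun _ => rfl
      simp only [pot, hs, Finset.sum_apply, cnt]
      simp [hc0]
    rw [hsum]
    refine (Real.exp_le_exp.2 (neg_le_neg (sum_pot_le hB (T.ch u) (d + 1) (T.lvl u) s x
      fun a i => Nat.cast_nonneg _))).trans ?_
    rw [← Finset.sum_neg_distrib, Real.exp_sum]
    refine Finset.prod_le_prod (fun a _ => (Real.exp_pos _).le) fun a ha => ?_
    have hpm : Measurable fun y => pot B F d (T.lvl u + 1) (fun i => (T.cnt i a : ℝ))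
        (update x (T.lvl u) y) := (measurable_pot hB d _ _).comp (measurable_update x)
    have hp0 : ∀ y, 0 ≤ pot B F d (T.lvl u + 1) (fun i => (T.cnt i a : ℝ))
        (update x (T.lvl u) y) := fun y => pot_nonneg hB d _ _ _ fun i => Nat.cast_nonneg _
    have h2 : Real.exp (-pot B F (d + 1) (T.lvl u) (s a) x) =
        ∫ y, Real.exp (-pot B F d (T.lvl u + 1) (fun i => (T.cnt i a : ℝ))
          (update x (T.lvl u) y)) ∂F := by
      have hc0 : T.cnt (1 - 1) a = 1 := rfl
      simp only [pot, hs, persp, hc0, Nat.cast_one, one_ne_zero, if_false, one_mul, neg_neg,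
        div_one, Nat.add_sub_cancel]
      exact Real.exp_log (integral_exp_neg_pos hpm hp0)
    have h3 : 1 - δ * ∫ y, (ℙF).real (T.Hit B d a (update x (T.lvl u) y)) ∂F =
        ∫ y, (1 - δ * (ℙF).real (T.Hit B d a (update x (T.lvl u) y))) ∂F := by
      rw [integral_sub (integrable_const _) ((hhi a).const_mul δ), integral_const_mul]
      simp
    rw [h2, h3]
    refine integral_mono (integrable_exp_neg hpm hp0)
      ((integrable_const _).sub ((hhi a).const_mul δ)) fun y => ?_
    have := exp_neg_pot_le hB d a (update x (T.lvl u) y)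
    rwa [T.lvl_of_mem ha] at this

end LayeredTree

/-- The comparison of one generation of branching with one step in the network. The left side is
the probability that one of `r` independent branches succeeds, each with probability `a`, for a
possibly fractional `r`; the right side is `C` times the conductance `r b / (1 + r b)` of `r`
parallel branches of conductance `b = a / C` that are in series with a unit conductance. -/
theorem one_sub_rpow_le {r C a : ℝ} (hr : 1 < r) (hC : 0 < C) (hrC : 2 * r ≤ C * (r - 1))
    (ha0 : 0 ≤ a) (ha1 : a < 1) : 1 - (1 - a) ^ r ≤ r * a / (1 + r * a / C) := by
  have hmono : MonotoneOn (fun a : ℝ => r * a / (1 + r * a / C) + (1 - a) ^ r) (Set.Ico 0 1) := by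
    have hden : ∀ t : ℝ, 0 ≤ t → 0 < 1 + r * t / C := fun t ht => by positivity
    have hder : ∀ t ∈ Set.Ico (0 : ℝ) 1, HasDerivAt
        (fun a : ℝ => r * a / (1 + r * a / C) + (1 - a) ^ r)
        ((r * 1 * (1 + r * t / C) - r * t * (r * 1 / C)) / (1 + r * t / C) ^ 2 +
          (-1) * r * (1 - t) ^ (r - 1)) t := by
      intro t ht
      have h1 : HasDerivAt (fun a : ℝ => r * a) (r * 1) t := (hasDerivAt_id t).const_mul r
      have h2 : HasDerivAt (fun a : ℝ => 1 + r * a / C) (r * 1 / C) t :=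
        (h1.div_const C).const_add 1
      have h3 : HasDerivAt (fun a : ℝ => 1 - a) (-1) t := (hasDerivAt_id t).const_sub 1
      have h4 : (1 - t) ≠ 0 := by linarith [ht.2]
      exact (h1.div h2 (hden t ht.1).ne').add (h3.rpow_const (Or.inl h4))
    refine monotoneOn_of_deriv_nonneg (convex_Ico 0 1)
      (fun t ht => (hder t ht).continuousAt.continuousWithinAt)
      (fun t ht => (hder t (interior_subset ht)).differentiableAt.differentiableWithinAt)
      fun t ht => ?_
    have ht' := interior_subset ht
    rw [(hder t ht').deriv]
    have hd := hden t ht'.1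
    have h1 : (1 - t) ^ (r - 1) ≤ Real.exp (-(t * (r - 1))) := by
      calc (1 - t) ^ (r - 1) ≤ Real.exp (-t) ^ (r - 1) :=
            Real.rpow_le_rpow (by linarith [ht'.2]) (by linarith [Real.add_one_le_exp (-t)])
              (by linarith)
        _ = _ := by rw [← Real.exp_mul]; ring_nf
    have h2 : (1 + r * t / C) ^ 2 ≤ Real.exp (t * (r - 1)) := by
      calc (1 + r * t / C) ^ 2 ≤ Real.exp (r * t / C) ^ 2 :=
            pow_le_pow_left₀ hd.le (by linarith [Real.add_one_le_exp (r * t / C)]) 2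
        _ = Real.exp (t * (2 * r / C)) := by rw [← Real.exp_nat_mul]; ring_nf
        _ ≤ _ := Real.exp_le_exp.2 (mul_le_mul_of_nonneg_left
            (by rw [div_le_iff₀ hC]; linarith) ht'.1)
    have h3 : (1 - t) ^ (r - 1) * (1 + r * t / C) ^ 2 ≤ 1 := by
      calc _ ≤ Real.exp (-(t * (r - 1))) * Real.exp (t * (r - 1)) :=
            mul_le_mul h1 h2 (by positivity) (Real.exp_pos _).le
        _ = 1 := by rw [← Real.exp_add]; simp
    have h4 : (1 - t) ^ (r - 1) ≤ 1 / (1 + r * t / C) ^ 2 := by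
      rw [le_div_iff₀ (by positivity)]; exact h3
    have h5 : (r * 1 * (1 + r * t / C) - r * t * (r * 1 / C)) / (1 + r * t / C) ^ 2 +
        (-1) * r * (1 - t) ^ (r - 1) =
        r * (1 / (1 + r * t / C) ^ 2 - (1 - t) ^ (r - 1)) := by
      field_simp
      ring
    rw [h5]
    exact mul_nonneg (by linarith) (sub_nonneg.2 h4)
  have := hmono ⟨le_rfl, one_pos⟩ ⟨ha0, ha1⟩ ha0
  simp at this
  linarith

section Comparison

variable {B : Set (ℕ → ℝ)} {F : Measure ℝ}

theorem conductance_const_mul (M : ℕ → ℝ≥0∞) {c : ℝ≥0∞} (h0 : c ≠ 0) (hc : c ≠ ∞) :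
    ∀ d j x, conductance B (fun i => c * M i) F d j x = conductance B M F d j x
  | 0, _, _ => rfl
  | d + 1, j, x => by
    simp only [conductance, conductance_const_mul M h0 hc d, ENNReal.mul_div_mul_left _ _ h0 hc]

variable [IsProbabilityMeasure F]

/-- The hitting probability of the spherically symmetric tree is at most a constant times its
conductance, when its branching numbers are bounded away from `1`. -/
theorem one_sub_exp_neg_pot_le (hB : MeasurableSet B) {s : ℕ → ℝ} (hs : ∀ i, 0 < s i)
    {ε : ℝ} (hε : 0 < ε) (hs' : ∀ i, (1 + ε) * s i ≤ s (i + 1)) : ∀ d j x,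
    ENNReal.ofReal (1 - Real.exp (-(pot B F d j (fun i => s (j + i)) x / s j))) ≤
      ENNReal.ofReal (2 * (1 + ε) / ε) * conductance B (fun i => ENNReal.ofReal (s i)) F d j x
  | 0, j, x => by
    have hC : (1 : ℝ) ≤ 2 * (1 + ε) / ε := by
      rw [le_div_iff₀ hε]; linarith
    by_cases hx : x ∈ B
    · simp only [pot, conductance, Set.indicator_of_mem hx, Pi.one_apply, mul_one, add_zero,
        div_self (hs j).ne']
      refine ENNReal.ofReal_le_ofReal ?_
      linarith [Real.exp_pos (-1)]
    · simp [pot, Set.indicator_of_notMem hx]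
  | d + 1, j, x => by
    set C := 2 * (1 + ε) / ε with hCdef
    have hC : 0 < C := by positivity
    set r := s (j + 1) / s j with hr
    have hr1 : 1 + ε ≤ r := by rw [hr, le_div_iff₀ (hs j)]; exact hs' j
    have hrC : 2 * r ≤ C * (r - 1) := by
      rw [hCdef, div_mul_eq_mul_div, le_div_iff₀ hε]
      nlinarith
    set g : ℝ → ℝ := fun y => pot B F d (j + 1) (fun i => s (j + 1 + i)) (update x j y) / s (j + 1)
      with hg
    have hgm : Measurable g :=
      ((measurable_pot hB d _ _).comp (measurable_update x)).div_const _
    have hg0 : ∀ y, 0 ≤ g y := fun y =>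
      div_nonneg (pot_nonneg hB d _ _ _ fun i => (hs _).le) (hs _).le
    have hI0 := integral_exp_neg_pos (μ := F) hgm hg0
    have hI1 := integral_exp_neg_le_one (μ := F) hgm hg0
    set I := ∫ y, Real.exp (-g y) ∂F with hI
    have hpot : pot B F (d + 1) j (fun i => s (j + i)) x / s j = r * -Real.log I := by
      have h1 : pot B F (d + 1) j (fun i => s (j + i)) x = s (j + 1) * -Real.log I := by
        simp only [pot, persp, (hs (j + 1)).ne', if_false, hI, hg]
        simp only [add_assoc, add_comm 1]
      rw [h1, hr]; ring
    have hexp : Real.exp (-(r * -Real.log I)) = I ^ r := by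
      rw [Real.rpow_def_of_pos hI0]; ring_nf
    rw [hpot, hexp]
    have hm := measurable_conductance (fun i => ENNReal.ofReal (s i)) F hB d (j + 1)
    have hb1 := lintegral_conductance_le_one B (fun i => ENNReal.ofReal (s i)) F d j x
    set b := ∫⁻ y, conductance B (fun i => ENNReal.ofReal (s i)) F d (j + 1) (update x j y) ∂F
      with hb
    have hbt : b ≠ ∞ := ne_top_of_le_ne_top ENNReal.one_ne_top hb1
    -- The one-step hitting probabilities are compared by induction
    have hab : ENNReal.ofReal (1 - I) ≤ ENNReal.ofReal C * b := by
      have hie := integrable_exp_neg (μ := F) hgm hg0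
      have h1 : 1 - I = ∫ y, (1 - Real.exp (-g y)) ∂F := by
        rw [integral_sub (integrable_const _) hie]; simp [hI]
      rw [h1, ofReal_integral_eq_lintegral_ofReal (by exact (integrable_const _).sub hie)
        (Filter.Eventually.of_forall fun y => sub_nonneg.2
          (Real.exp_le_one_iff.2 (neg_nonpos.2 (hg0 y)))), hb,
        ← lintegral_const_mul _ (by exact hm.comp (measurable_update x))]
      exact lintegral_mono fun y => one_sub_exp_neg_pot_le hB hs hε hs' d (j + 1) _
    have hab' : 1 - I ≤ C * b.toReal := by
      have := ENNReal.toReal_mono (ENNReal.mul_ne_top ENNReal.ofReal_ne_top hbt) hab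
      rwa [ENNReal.toReal_mul, ENNReal.toReal_ofReal (by linarith),
        ENNReal.toReal_ofReal hC.le] at this
    have hκ : conductance B (fun i => ENNReal.ofReal (s i)) F (d + 1) j x =
        ENNReal.ofReal (r * b.toReal / (1 + r * b.toReal)) := by
      have h1 : ENNReal.ofReal (s (j + 1)) / ENNReal.ofReal (s j) * b =
          ENNReal.ofReal (r * b.toReal) := by
        rw [← ENNReal.ofReal_div_of_pos (hs j), ENNReal.ofReal_mul (by linarith),
          ENNReal.ofReal_toReal hbt]
      have hrb : 0 ≤ r * b.toReal := mul_nonneg (by linarith) ENNReal.toReal_nonneg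
      rw [ENNReal.ofReal_div_of_pos (by linarith), ENNReal.ofReal_add zero_le_one hrb,
        ENNReal.ofReal_one, ← h1]
      rfl
    rw [hκ, ← ENNReal.ofReal_mul hC.le]
    refine ENNReal.ofReal_le_ofReal ?_
    have hineq := one_sub_rpow_le (by linarith : 1 < r) hC hrC (a := 1 - I) (by linarith)
      (by linarith)
    rw [sub_sub_cancel] at hineq
    refine hineq.trans ?_
    have hbn : 0 ≤ b.toReal := ENNReal.toReal_nonneg
    have hrp : 0 < r := by linarith
    have h1I : 0 ≤ 1 - I := by linarith
    rw [← mul_div_assoc, div_le_div_iff₀ (by positivity) (by positivity)]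
    have : r * (1 - I) * (1 + r * b.toReal) - C * (r * b.toReal) * (1 + r * (1 - I) / C) =
        r * (1 - I - C * b.toReal) := by
      field_simp
      ring
    nlinarith [mul_nonneg hrp.le (sub_nonneg.2 hab')]

end Comparison

namespace LayeredTree

variable {V : Type*} (T : LayeredTree V) {B : Set (ℕ → ℝ)} (F : Measure ℝ)
  [IsProbabilityMeasure F]

/-- A tree whose level sizes are at most `A * s i` hits the target with probability at most a
constant times the conductance. -/
theorem measure_Hit_le_conductance (hB : MeasurableSet B) {s : ℕ → ℝ} (hs : ∀ i, 0 < s i)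
    {ε : ℝ} (hε : 0 < ε) (hs' : ∀ i, (1 + ε) * s i ≤ s (i + 1)) {A : ℝ} (hA : 1 ≤ A) {u : V}
    (hu : T.lvl u = 0) (hcnt : ∀ i, (T.cnt i u : ℝ) ≤ A * s i) (hs0 : s 0 = 1)
    (n : ℕ) (x : ℕ → ℝ) :
    ENNReal.ofReal (1 - Real.exp (-1)) * Measure.infinitePi (fun _ : V => F) (T.Hit B n u x) ≤
      ENNReal.ofReal (A * (2 * (1 + ε) / ε)) *
        conductance B (fun i => ENNReal.ofReal (s i)) F n 0 x := by
  have hA0 : 0 < A := by linarith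
  have hδ : 0 ≤ 1 - Real.exp (-1) := by
    have := Real.exp_le_one_iff.2 (show (-1 : ℝ) ≤ 0 by norm_num)
    linarith
  have h1 := T.exp_neg_pot_le F hB n u x
  rw [hu] at h1
  have hmono := pot_mono (F := F) hB n 0 x (s := fun i => (T.cnt i u : ℝ)) (s' := fun i => A * s i)
    (fun i => Nat.cast_nonneg _) hcnt
  have h2 := one_sub_exp_neg_pot_le (F := F) hB (s := fun i => A * s i)
    (fun i => mul_pos hA0 (hs i)) hε (fun i => by nlinarith [hs' i]) n 0 x
  simp only [zero_add, hs0, mul_one, ENNReal.ofReal_mul hA0.le] at h2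
  rw [conductance_const_mul _ (by simpa using hA0) ENNReal.ofReal_ne_top] at h2
  set p := pot B F n 0 (fun i => A * s i) x
  rw [← ENNReal.ofReal_toReal (measure_ne_top (Measure.infinitePi fun _ : V => F) _),
    ← ENNReal.ofReal_mul hδ, ENNReal.ofReal_mul hA0.le, mul_assoc]
  refine le_trans ?_ (mul_le_mul_right h2 _)
  rw [← ENNReal.ofReal_mul hA0.le]
  refine ENNReal.ofReal_le_ofReal ?_
  -- Bernoulli's inequality for `exp (-(p / A)) ^ A` compares the tree with level sizes `A * s i` to
  -- a single branch of it, to which the conductance bound applies.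
  have h3 := one_add_mul_self_le_rpow_one_add (s := Real.exp (-(p / A)) - 1)
    (by linarith [Real.exp_pos (-(p / A))]) hA
  rw [add_sub_cancel, ← Real.exp_mul, neg_mul, div_mul_cancel₀ p hA0.ne'] at h3
  have h4 := Real.exp_le_exp.2 (neg_le_neg hmono)
  rw [measureReal_def] at h1
  linarith

end LayeredTree

/-! ### Moments of the truncated branching process -/

/-- The words that extend `u`, i.e. the potential descendants of `u`, including `u`. -/
def wordsBelow (u : List ℕ) : Set (List ℕ) := {v | u <:+ v}

theorem wordsBelow_cons_subset (i : ℕ) (u : List ℕ) : wordsBelow (i :: u) ⊆ wordsBelow u :=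
  fun _ h => (List.suffix_cons i u).trans h

theorem disjoint_wordsBelow_cons {i j : ℕ} (hij : i ≠ j) (u : List ℕ) :
    Disjoint (wordsBelow (i :: u)) (wordsBelow (j :: u)) := by
  rw [Set.disjoint_left]
  intro v hi hj
  have := (List.suffix_of_suffix_length_le hi hj (by simp)).eq_of_length (by simp)
  exact hij (List.cons.inj this).1

theorem notMem_wordsBelow_cons (i : ℕ) (u : List ℕ) : u ∉ wordsBelow (i :: u) := fun h => by
  have := List.IsSuffix.length_le h
  simp at this

/-- A bounded measurable function of the offspring numbers of the words in `S`. -/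
structure BddDep (S : Set (List ℕ)) (f : (List ℕ → ℕ) → ℝ) : Prop where
  meas : Measurable f
  bdd : ∃ b, ∀ N, |f N| ≤ b
  dep : DependsOn f S

namespace BddDep

variable {S T : Set (List ℕ)} {f g : (List ℕ → ℕ) → ℝ}

theorem mono (h : BddDep S f) (hST : S ⊆ T) : BddDep T f := ⟨h.meas, h.bdd, h.dep.mono hST⟩

theorem const (c : ℝ) (S : Set (List ℕ)) : BddDep S fun _ => c :=
  ⟨measurable_const, ⟨|c|, fun _ => le_rfl⟩, fun _ _ _ => rfl⟩

theorem mul (hf : BddDep S f) (hg : BddDep S g) : BddDep S fun N => f N * g N := by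
  obtain ⟨b, hb⟩ := hf.bdd
  obtain ⟨c, hc⟩ := hg.bdd
  refine ⟨hf.meas.mul hg.meas, ⟨b * c, fun N => ?_⟩, fun X Y h => ?_⟩
  · rw [abs_mul]
    exact mul_le_mul (hb N) (hc N) (abs_nonneg _) ((abs_nonneg _).trans (hb N))
  · rw [hf.dep h, hg.dep h]

theorem pow_two (h : BddDep S f) : BddDep S fun N => f N ^ 2 := by
  simpa only [sq] using h.mul h

theorem sub (hf : BddDep S f) (hg : BddDep S g) : BddDep S fun N => f N - g N := by
  obtain ⟨b, hb⟩ := hf.bdd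
  obtain ⟨c, hc⟩ := hg.bdd
  refine ⟨hf.meas.sub hg.meas, ⟨b + c, fun N => ?_⟩, fun X Y h => ?_⟩
  · exact (abs_sub _ _).trans (add_le_add (hb N) (hc N))
  · rw [hf.dep h, hg.dep h]

theorem sum {κ : Type*} (A : Finset κ) {F : κ → (List ℕ → ℕ) → ℝ} (h : ∀ a ∈ A, BddDep S (F a)) :
    BddDep S fun N => ∑ a ∈ A, F a N := by
  classical
  refine ⟨Finset.measurable_fun_sum A fun a ha => (h a ha).meas, ?_, fun X Y hXY =>
    Finset.sum_congr rfl fun a ha => (h a ha).dep hXY⟩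
  have : ∀ a : κ, ∃ b, a ∈ A → ∀ N, |F a N| ≤ b := fun a => by
    by_cases ha : a ∈ A
    · obtain ⟨b, hb⟩ := (h a ha).bdd
      exact ⟨b, fun _ => hb⟩
    · exact ⟨0, fun h => absurd h ha⟩
  choose b hb using this
  exact ⟨∑ a ∈ A, b a, fun N => (Finset.abs_sum_le_sum_abs _ _).trans
    (Finset.sum_le_sum fun a ha => hb a ha N)⟩

theorem indicator {A : Set (List ℕ → ℕ)} (hA : MeasurableSet A) (hd : DependsOn (· ∈ A) S) :
    BddDep S (A.indicator 1) := by
  refine ⟨measurable_one.indicator hA, ⟨1, fun N => ?_⟩, fun X Y h => ?_⟩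
  · by_cases h : N ∈ A <;> simp [h]
  · exact Set.indicator_one_congr (hd h).to_iff

theorem integrable (h : BddDep S f) (μ : Measure (List ℕ → ℕ)) [IsFiniteMeasure μ] :
    Integrable f μ := by
  obtain ⟨b, hb⟩ := h.bdd
  exact Integrable.of_bound h.meas.aestronglyMeasurable b (Filter.Eventually.of_forall hb)

end BddDep

section Moments

/-- The indicator of the event that the word `u` has a child with number `i`. -/
noncomputable def hasChild (u : List ℕ) (i : ℕ) (N : List ℕ → ℕ) : ℝ := if i < N u then 1 else 0

theorem measurableSet_lt_apply (u : List ℕ) (i : ℕ) :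
    MeasurableSet {N : List ℕ → ℕ | i < N u} :=
  (measurable_pi_apply u) (MeasurableSet.of_discrete (s := Set.Ioi i))

theorem hasChild_nonneg (u : List ℕ) (i : ℕ) (N : List ℕ → ℕ) : 0 ≤ hasChild u i N := by
  unfold hasChild; split_ifs <;> norm_num

theorem hasChild_le_one (u : List ℕ) (i : ℕ) (N : List ℕ → ℕ) : hasChild u i N ≤ 1 := by
  unfold hasChild; split_ifs <;> norm_num

theorem hasChild_mul (u : List ℕ) (i j : ℕ) (N : List ℕ → ℕ) :
    hasChild u i N * hasChild u j N = hasChild u (max i j) N := by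
  unfold hasChild
  by_cases h1 : i < N u <;> by_cases h2 : j < N u <;> simp [h1, h2]

theorem bddDep_hasChild (u : List ℕ) (i : ℕ) : BddDep {u} (hasChild u i) := by
  refine ⟨Measurable.ite (measurableSet_lt_apply u i) measurable_const measurable_const,
    ⟨1, fun N => ?_⟩, fun X Y h => ?_⟩
  · rw [abs_of_nonneg (hasChild_nonneg u i N)]
    exact hasChild_le_one u i N
  · unfold hasChild
    rw [h u rfl]

variable (L : ℕ → ℕ)

/-- The sum of `ξ v` over the descendants `v` of `u` in the `k`-th generation after `u`, in the tree
where an individual of generation `n` keeps its first `L n` children only. -/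
noncomputable def levelSum (ξ : List ℕ → (List ℕ → ℕ) → ℝ) :
    ℕ → List ℕ → (List ℕ → ℕ) → ℝ
  | 0, u, N => ξ u N
  | k + 1, u, N => ∑ i ∈ Finset.range (L u.length), hasChild u i N * levelSum ξ k (i :: u) N

/-- The number of descendants of `u` in the `d`-th generation after `u`, in the truncated tree. -/
noncomputable abbrev descCount (d : ℕ) (u : List ℕ) (N : List ℕ → ℕ) : ℝ :=
  levelSum L (fun _ _ => 1) d u N

/-- The number of ordered pairs of descendants of distinct children of `u`, in the `d`-th
generation after the children, in the truncated tree. -/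
noncomputable def pairCount (d : ℕ) (u : List ℕ) (N : List ℕ → ℕ) : ℝ :=
  ∑ i ∈ Finset.range (L u.length), ∑ j ∈ (Finset.range (L u.length)).erase i,
    (hasChild u i N * descCount L d (i :: u) N) * (hasChild u j N * descCount L d (j :: u) N)

theorem levelSum_nonneg {ξ : List ℕ → (List ℕ → ℕ) → ℝ} (h : ∀ u N, 0 ≤ ξ u N) :
    ∀ k u N, 0 ≤ levelSum L ξ k u N
  | 0, u, N => h u N
  | k + 1, u, N => Finset.sum_nonneg fun i _ =>
      mul_nonneg (hasChild_nonneg u i N) (levelSum_nonneg h k (i :: u) N)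

theorem descCount_nonneg (d : ℕ) (u : List ℕ) (N : List ℕ → ℕ) : 0 ≤ descCount L d u N :=
  levelSum_nonneg L (fun _ _ => zero_le_one) d u N

theorem levelSum_sub (ξ η : List ℕ → (List ℕ → ℕ) → ℝ) (c : ℝ) : ∀ k u N,
    levelSum L (fun v N => ξ v N - c * η v N) k u N = levelSum L ξ k u N - c * levelSum L η k u N
  | 0, _, _ => rfl
  | k + 1, u, N => by
    simp only [levelSum, levelSum_sub ξ η c k, Finset.mul_sum, ← Finset.sum_sub_distrib]
    exact Finset.sum_congr rfl fun i _ => by ring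

theorem levelSum_descCount (d : ℕ) : ∀ k u N,
    levelSum L (descCount L d) k u N = descCount L (k + d) u N
  | 0, u, N => by rw [Nat.zero_add]; rfl
  | k + 1, u, N => by
    rw [Nat.add_right_comm]
    exact Finset.sum_congr rfl fun i _ => by rw [levelSum_descCount d k]

theorem BddDep.sum_children {f : ℕ → (List ℕ → ℕ) → ℝ} {u : List ℕ}
    (hf : ∀ i, BddDep (wordsBelow (i :: u)) (f i)) (n : ℕ) :
    BddDep (wordsBelow u) fun N => ∑ i ∈ Finset.range n, hasChild u i N * f i N :=
  BddDep.sum _ fun i _ =>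
    ((bddDep_hasChild u i).mono (Set.singleton_subset_iff.2 (List.suffix_refl u))).mul
      ((hf i).mono (wordsBelow_cons_subset i u))

theorem bddDep_levelSum {ξ : List ℕ → (List ℕ → ℕ) → ℝ} (h : ∀ u, BddDep (wordsBelow u) (ξ u)) :
    ∀ k u, BddDep (wordsBelow u) (levelSum L ξ k u)
  | 0, u => h u
  | k + 1, u => BddDep.sum_children (fun i => bddDep_levelSum h k (i :: u)) _

theorem bddDep_descCount (d : ℕ) (u : List ℕ) : BddDep (wordsBelow u) (descCount L d u) :=
  bddDep_levelSum L (fun _ => BddDep.const 1 _) d u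

theorem bddDep_pairCount (d : ℕ) (u : List ℕ) : BddDep (wordsBelow u) (pairCount L d u) := by
  have h : ∀ i, BddDep (wordsBelow u) fun N => hasChild u i N * descCount L d (i :: u) N := fun i =>
    ((bddDep_hasChild u i).mono (Set.singleton_subset_iff.2 (List.suffix_refl u))).mul
      ((bddDep_descCount L d (i :: u)).mono (wordsBelow_cons_subset i u))
  exact BddDep.sum _ fun i _ => BddDep.sum _ fun j _ => (h i).mul (h j)

variable (ν : ℕ → Measure ℕ)

/-- The law of independent offspring numbers with distribution `ν k` in generation `k`. -/
noncomputable abbrev offspringLaw : Measure (List ℕ → ℕ) :=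
  Measure.infinitePi fun v : List ℕ => ν v.length

/-- The probability that an individual of generation `k` has a child number `i`. -/
noncomputable def childProb (k i : ℕ) : ℝ := (ν k).real (Set.Ioi i)

/-- The mean of the truncated offspring number in generation `k`. -/
noncomputable def truncMean (k : ℕ) : ℝ := ∑ i ∈ Finset.range (L k), childProb ν k i

/-- The second factorial moment of the truncated offspring number in generation `k`. -/
noncomputable def truncSecond (k : ℕ) : ℝ :=
  ∑ i ∈ Finset.range (L k), ∑ j ∈ (Finset.range (L k)).erase i, childProb ν k (max i j)

/-- The mean size of the `d`-th generation after an individual of generation `k`. -/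
noncomputable def truncSize (k d : ℕ) : ℝ := ∏ i ∈ Finset.range d, truncMean L ν (k + i)

theorem truncSize_succ (k d : ℕ) :
    truncSize L ν k (d + 1) = truncMean L ν k * truncSize L ν (k + 1) d := by
  rw [truncSize, Finset.prod_range_succ', mul_comm, truncSize]
  simp only [add_zero, add_assoc, add_comm 1]

theorem truncSize_add (k d e : ℕ) :
    truncSize L ν k (d + e) = truncSize L ν k d * truncSize L ν (k + d) e := by
  simp only [truncSize, Finset.prod_range_add, add_assoc]

theorem childProb_nonneg (k i : ℕ) : 0 ≤ childProb ν k i := measureReal_nonneg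

theorem truncMean_nonneg (k : ℕ) : 0 ≤ truncMean L ν k :=
  Finset.sum_nonneg fun i _ => childProb_nonneg ν k i

theorem truncSize_nonneg (k d : ℕ) : 0 ≤ truncSize L ν k d :=
  Finset.prod_nonneg fun _ _ => truncMean_nonneg L ν _

variable [∀ k, IsProbabilityMeasure (ν k)]

theorem childProb_le_one (k i : ℕ) : childProb ν k i ≤ 1 := measureReal_le_one

theorem integral_hasChild (u : List ℕ) (i : ℕ) :
    ∫ N, hasChild u i N ∂offspringLaw ν = childProb ν u.length i := by
  have h1 : hasChild u i = {N : List ℕ → ℕ | i < N u}.indicator 1 := by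
    funext N
    by_cases h : i < N u <;> simp [hasChild, h]
  rw [h1, integral_indicator_one (measurableSet_lt_apply u i), childProb, measureReal_def,
    measureReal_def, ← Measure.infinitePi_map_eval (fun v : List ℕ => ν v.length) u,
    Measure.map_apply (measurable_pi_apply u) MeasurableSet.of_discrete]
  rfl

theorem integral_hasChild_mul {u : List ℕ} {i : ℕ} {S : Set (List ℕ)} (hu : u ∉ S)
    {f : (List ℕ → ℕ) → ℝ} (hf : BddDep S f) :
    ∫ N, hasChild u i N * f N ∂offspringLaw ν =
      childProb ν u.length i * ∫ N, f N ∂offspringLaw ν := by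
  rw [integral_mul_of_dependsOn _ (bddDep_hasChild u i).meas hf.meas (bddDep_hasChild u i).dep
    hf.dep (Set.disjoint_singleton_left.2 hu), integral_hasChild]

theorem integral_sum_children {f : ℕ → (List ℕ → ℕ) → ℝ} {u : List ℕ}
    (hf : ∀ i, BddDep (wordsBelow (i :: u)) (f i)) (n : ℕ) :
    ∫ N, ∑ i ∈ Finset.range n, hasChild u i N * f i N ∂offspringLaw ν =
      ∑ i ∈ Finset.range n, childProb ν u.length i * ∫ N, f i N ∂offspringLaw ν := by
  rw [integral_finsetSum]
  · exact Finset.sum_congr rfl fun i _ =>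
      integral_hasChild_mul ν (notMem_wordsBelow_cons i u) (hf i)
  · exact fun i _ => (((bddDep_hasChild u i).mono (Set.subset_univ _)).mul
      ((hf i).mono (Set.subset_univ _))).integrable _

theorem integral_children_mul {f : ℕ → (List ℕ → ℕ) → ℝ} {u : List ℕ}
    (hf : ∀ i, BddDep (wordsBelow (i :: u)) (f i)) {i j : ℕ} (hij : i ≠ j) :
    ∫ N, (hasChild u i N * f i N) * (hasChild u j N * f j N) ∂offspringLaw ν =
      childProb ν u.length (max i j) *
          ((∫ N, f i N ∂offspringLaw ν) * ∫ N, f j N ∂offspringLaw ν) := by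
  have h1 : ∀ N, (hasChild u i N * f i N) * (hasChild u j N * f j N) =
      hasChild u (max i j) N * (f i N * f j N) := fun N => by rw [← hasChild_mul]; ring
  simp only [h1]
  have hS : u ∉ wordsBelow (i :: u) ∪ wordsBelow (j :: u) := fun h =>
    h.elim (notMem_wordsBelow_cons i u) (notMem_wordsBelow_cons j u)
  rw [integral_hasChild_mul ν hS (((hf i).mono Set.subset_union_left).mul
    ((hf j).mono Set.subset_union_right)), integral_mul_of_dependsOn _ (hf i).meas (hf j).meas
      (hf i).dep (hf j).dep (disjoint_wordsBelow_cons hij u)]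

theorem integral_pairs {f : ℕ → (List ℕ → ℕ) → ℝ} {u : List ℕ}
    (hf : ∀ i, BddDep (wordsBelow (i :: u)) (f i)) (n : ℕ) :
    ∫ N, ∑ i ∈ Finset.range n, ∑ j ∈ (Finset.range n).erase i,
        (hasChild u i N * f i N) * (hasChild u j N * f j N) ∂offspringLaw ν =
      ∑ i ∈ Finset.range n, ∑ j ∈ (Finset.range n).erase i,
        childProb ν u.length (max i j) *
          ((∫ N, f i N ∂offspringLaw ν) * ∫ N, f j N ∂offspringLaw ν) := by
  have h : ∀ i, BddDep Set.univ fun N => hasChild u i N * f i N := fun i =>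
    ((bddDep_hasChild u i).mono (Set.subset_univ _)).mul ((hf i).mono (Set.subset_univ _))
  rw [integral_finsetSum _ fun i _ => (BddDep.sum _ fun j _ => (h i).mul (h j)).integrable _]
  refine Finset.sum_congr rfl fun i _ => ?_
  rw [integral_finsetSum _ fun j _ => ((h i).mul (h j)).integrable _]
  exact Finset.sum_congr rfl fun j hj =>
    integral_children_mul ν hf (Finset.ne_of_mem_erase hj).symm

theorem integral_sum_children_sq {f : ℕ → (List ℕ → ℕ) → ℝ} {u : List ℕ}
    (hf : ∀ i, BddDep (wordsBelow (i :: u)) (f i)) (n : ℕ) :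
    ∫ N, (∑ i ∈ Finset.range n, hasChild u i N * f i N) ^ 2 ∂offspringLaw ν =
      (∑ i ∈ Finset.range n, childProb ν u.length i * ∫ N, f i N ^ 2 ∂offspringLaw ν) +
      ∑ i ∈ Finset.range n, ∑ j ∈ (Finset.range n).erase i,
        childProb ν u.length (max i j) *
          ((∫ N, f i N ∂offspringLaw ν) * ∫ N, f j N ∂offspringLaw ν) := by
  have h : ∀ i, BddDep Set.univ fun N => hasChild u i N * f i N := fun i =>
    ((bddDep_hasChild u i).mono (Set.subset_univ _)).mul ((hf i).mono (Set.subset_univ _))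
  have hf2 : ∀ i, BddDep (wordsBelow (i :: u)) fun N => f i N ^ 2 := fun i => (hf i).pow_two
  have h1 : ∀ N, (∑ i ∈ Finset.range n, hasChild u i N * f i N) ^ 2 =
      (∑ i ∈ Finset.range n, hasChild u i N * f i N ^ 2) +
      ∑ i ∈ Finset.range n, ∑ j ∈ (Finset.range n).erase i,
        (hasChild u i N * f i N) * (hasChild u j N * f j N) := by
    intro N
    rw [sq, Finset.sum_mul_sum, ← Finset.sum_add_distrib]
    refine Finset.sum_congr rfl fun i hi => ?_
    rw [← Finset.add_sum_erase _ _ hi]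
    congr 1
    have := hasChild_mul u i i N
    rw [max_self] at this
    calc _ = (hasChild u i N * hasChild u i N) * f i N ^ 2 := by ring
      _ = _ := by rw [this]
  simp only [h1]
  rw [integral_add, integral_sum_children ν hf2, integral_pairs ν hf]
  · exact (BddDep.sum_children hf2 n).integrable _
  · exact (BddDep.sum _ fun i _ => BddDep.sum _ fun j _ => (h i).mul (h j)).integrable _

theorem integral_descCount : ∀ (d : ℕ) (u : List ℕ),
    ∫ N, descCount L d u N ∂offspringLaw ν = truncSize L ν u.length d
  | 0, u => by simp [descCount, levelSum, truncSize]
  | d + 1, u => by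
    rw [truncSize_succ, truncMean, Finset.sum_mul]
    refine (integral_sum_children ν (fun i => bddDep_descCount L d (i :: u)) _).trans ?_
    exact Finset.sum_congr rfl fun i _ => by rw [integral_descCount d (i :: u)]; rfl

/-- Sums over a generation of centred contributions of independent subtrees have orthogonal
terms. -/
theorem integral_levelSum_sq_le {ξ : List ℕ → (List ℕ → ℕ) → ℝ}
    (hξ : ∀ u, BddDep (wordsBelow u) (ξ u)) {W : ℝ} : ∀ (k : ℕ) (u : List ℕ),
    (∀ v : List ℕ, v.length = u.length + k → ∫ N, ξ v N ∂offspringLaw ν = 0) →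
    (∀ v : List ℕ, v.length = u.length + k → ∫ N, ξ v N ^ 2 ∂offspringLaw ν ≤ W) →
    ∫ N, levelSum L ξ k u N ∂offspringLaw ν = 0 ∧
      ∫ N, levelSum L ξ k u N ^ 2 ∂offspringLaw ν ≤ truncSize L ν u.length k * W
  | 0, u, h0, hW => ⟨h0 u rfl, by simpa [levelSum, truncSize] using hW u rfl⟩
  | k + 1, u, h0, hW => by
    have ih := fun i => integral_levelSum_sq_le hξ k (i :: u)
      (fun v hv => h0 v (by simp only [List.length_cons] at hv; omega))
      (fun v hv => hW v (by simp only [List.length_cons] at hv; omega))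
    have hb := fun i => bddDep_levelSum L hξ k (i :: u)
    constructor
    · refine (integral_sum_children ν hb _).trans (Finset.sum_eq_zero fun i _ => ?_)
      rw [(ih i).1, mul_zero]
    · refine (integral_sum_children_sq ν hb _).trans_le ?_
      simp only [(ih _).1, mul_zero, Finset.sum_const_zero, add_zero]
      rw [truncSize_succ, truncMean, Finset.sum_mul, Finset.sum_mul]
      refine Finset.sum_le_sum fun i _ => ?_
      rw [mul_assoc]
      exact mul_le_mul_of_nonneg_left (ih i).2 (childProb_nonneg ν _ i)

variable {L ν}

theorem integral_descCount_sq_le {ε V : ℝ} (hε : 0 < ε) (hV : 0 ≤ V)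
    (hm : ∀ k, 1 + ε ≤ truncMean L ν k) (hσ : ∀ k, truncSecond L ν k ≤ V) : ∀ (d : ℕ) (u : List ℕ),
    ∫ N, descCount L d u N ^ 2 ∂offspringLaw ν ≤ (1 + V / ε) * truncSize L ν u.length d ^ 2
  | 0, u => by
    simp only [descCount, levelSum, truncSize, Finset.range_zero, Finset.prod_empty, one_pow,
      integral_const, probReal_univ, smul_eq_mul, mul_one]
    have : 0 ≤ V / ε := by positivity
    linarith
  | d + 1, u => by
    refine (integral_sum_children_sq ν (fun i => bddDep_descCount L d (i :: u)) _).trans_le ?_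
    set M := truncSize L ν (u.length + 1) d with hM
    have hm1 := hm u.length
    have h1 : ∑ i ∈ Finset.range (L u.length), childProb ν u.length i *
        ∫ N, descCount L d (i :: u) N ^ 2 ∂offspringLaw ν ≤
        truncMean L ν u.length * ((1 + V / ε) * M ^ 2) := by
      rw [truncMean, Finset.sum_mul]
      exact Finset.sum_le_sum fun i _ => mul_le_mul_of_nonneg_left
        (integral_descCount_sq_le hε hV hm hσ d (i :: u)) (childProb_nonneg ν _ i)
    have h2 : ∑ i ∈ Finset.range (L u.length), ∑ j ∈ (Finset.range (L u.length)).erase i,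
        childProb ν u.length (max i j) * ((∫ N, descCount L d (i :: u) N ∂offspringLaw ν) *
          ∫ N, descCount L d (j :: u) N ∂offspringLaw ν) = truncSecond L ν u.length * M ^ 2 := by
      simp only [integral_descCount L ν d, List.length_cons, truncSecond, Finset.sum_mul, sq, hM]
    rw [h2, truncSize_succ, mul_pow, ← hM]
    refine (add_le_add_left h1 _).trans ?_
    have h3 : truncSecond L ν u.length * M ^ 2 ≤ V * M ^ 2 :=
      mul_le_mul_of_nonneg_right (hσ _) (sq_nonneg M)
    set m := truncMean L ν u.length
    set K := 1 + V / ε with hK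
    have hKε : V ≤ K * ε := by rw [hK, add_mul, div_mul_cancel₀ V hε.ne']; linarith
    have hK0 : 0 ≤ K := by positivity
    -- The recursion `m * K + V ≤ K * m ^ 2` propagates the bound
    have h4 : m * K + V ≤ K * m ^ 2 := by
      nlinarith [mul_le_mul_of_nonneg_left hm1 hK0,
        mul_nonneg hK0 (mul_nonneg (by linarith : 0 ≤ m - 1 - ε) (by linarith : 0 ≤ m)),
        mul_nonneg hK0 (mul_nonneg hε.le (by linarith : 0 ≤ m - 1))]
    nlinarith [mul_le_mul_of_nonneg_right h4 (sq_nonneg M)]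

end Moments

/-! ### Deviations from the mean -/

section Fluctuations

theorem integral_abs_le_sqrt {Ω : Type*} [MeasurableSpace Ω] {μ : Measure Ω}
    [IsProbabilityMeasure μ] {f : Ω → ℝ} (hf : Integrable f μ)
    (hf2 : Integrable (fun ω => f ω ^ 2) μ) :
    ∫ ω, |f ω| ∂μ ≤ √(∫ ω, f ω ^ 2 ∂μ) := by
  set c := ∫ ω, |f ω| ∂μ
  refine Real.le_sqrt_of_sq_le ?_
  have h : 0 ≤ ∫ ω, (|f ω| - c) ^ 2 ∂μ := integral_nonneg fun ω => sq_nonneg _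
  have h1 : ∀ ω, (|f ω| - c) ^ 2 = f ω ^ 2 - (2 * c * |f ω| - c ^ 2) := fun ω => by
    rw [sub_sq, sq_abs]; ring
  simp only [h1] at h
  rw [integral_sub hf2 (by exact (hf.abs.const_mul _).sub (integrable_const _)),
    integral_sub (hf.abs.const_mul _) (integrable_const _), integral_const_mul] at h
  simp only [integral_const, probReal_univ, one_smul] at h
  nlinarith

variable {L : ℕ → ℕ} {ν : ℕ → Measure ℕ}

variable (L ν) in
/-- The deviation of the size of generation `k + 1` from its mean given generation `k`. -/
noncomputable def sizeFluct (k : ℕ) (N : List ℕ → ℕ) : ℝ :=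
  descCount L (k + 1) [] N - truncMean L ν k * descCount L k [] N

variable (L ν) in
/-- The deviation of the number of pairs of individuals of generation `j + 1 + d`, with last common
ancestor in generation `j`, from its mean given generation `j`. -/
noncomputable def pairFluct (j d : ℕ) (N : List ℕ → ℕ) : ℝ :=
  levelSum L (pairCount L d) j [] N -
    truncSecond L ν j * truncSize L ν (j + 1) d ^ 2 * descCount L j [] N

theorem bddDep_sizeFluct (k : ℕ) : BddDep (wordsBelow []) (sizeFluct L ν k) :=
  (bddDep_descCount L (k + 1) []).sub ((BddDep.const _ _).mul (bddDep_descCount L k []))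

theorem bddDep_pairFluct (j d : ℕ) : BddDep (wordsBelow []) (pairFluct L ν j d) :=
  (bddDep_levelSum L (bddDep_pairCount L d) j []).sub
    ((BddDep.const _ _).mul (bddDep_descCount L j []))

theorem truncSize_pos {ε : ℝ} (hε : 0 < ε) (hm : ∀ k, 1 + ε ≤ truncMean L ν k) (k d : ℕ) :
    0 < truncSize L ν k d := Finset.prod_pos fun i _ => by linarith [hm (k + i)]

variable (L ν) in
/-- A weighted sum of the deviations from the means in the first `n` generations. The weights are
those with which a deviation enters the bounds for the size of a generation and for the number of
pairs of individuals of generation `n`, relative to the means. -/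
noncomputable def totalFluct (n : ℕ) (N : List ℕ → ℕ) : ℝ :=
  ∑ k ∈ Finset.range n, |sizeFluct L ν k N| / truncSize L ν 0 (k + 1) +
    ∑ j ∈ Finset.range n,
      |pairFluct L ν j (n - 1 - j) N| * (truncSize L ν 0 j / truncSize L ν 0 n ^ 2)

/-- The ratio of the size of a generation to its mean changes from one generation to the next by the
normalized `sizeFluct`, so it telescopes. -/
theorem descCount_le_of_totalFluct_le {ε A : ℝ} (hε : 0 < ε)
    (hm : ∀ k, 1 + ε ≤ truncMean L ν k) {n : ℕ} {N : List ℕ → ℕ} (hA : totalFluct L ν n N ≤ A)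
    {k : ℕ} (hk : k ≤ n) : descCount L k [] N ≤ (1 + A) * truncSize L ν 0 k := by
  have hM : ∀ k d, 0 < truncSize L ν k d := truncSize_pos hε hm
  have key : ∀ k, descCount L k [] N / truncSize L ν 0 k ≤
      1 + ∑ i ∈ Finset.range k, |sizeFluct L ν i N| / truncSize L ν 0 (i + 1) := by
    intro k
    induction k with
    | zero => simp [descCount, levelSum, truncSize]
    | succ k ih =>
      rw [Finset.sum_range_succ, ← add_assoc]
      refine le_trans ?_ (add_le_add_left ih _)
      have h1 : descCount L (k + 1) [] N =
          truncMean L ν k * descCount L k [] N + sizeFluct L ν k N := by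
        rw [sizeFluct]; ring
      have h2 : truncSize L ν 0 (k + 1) = truncSize L ν 0 k * truncMean L ν k := by
        rw [truncSize_add]; simp [truncSize]
      have hm0 : truncMean L ν k ≠ 0 := by linarith [hm k]
      rw [h1, add_div]
      refine add_le_add (le_of_eq ?_) (div_le_div_of_nonneg_right (le_abs_self _) (hM _ _).le)
      rw [h2]
      field_simp
  rw [← div_le_iff₀ (hM 0 k)]
  refine (key k).trans ((add_le_add_right ?_ 1))
  refine (Finset.sum_le_sum_of_subset_of_nonneg (Finset.range_mono hk)
    fun i _ _ => div_nonneg (abs_nonneg _) (hM _ _).le).trans (le_trans ?_ hA)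
  exact le_add_of_nonneg_right (Finset.sum_nonneg fun j _ =>
    mul_nonneg (abs_nonneg _) (div_nonneg (hM _ _).le (sq_nonneg _)))

/-- The number of pairs of individuals of generation `j + 1 + d` that split in generation `j` is at
most the square of the mean size of generation `j + 1 + d` over that of generation `j`, up to a
constant: given generation `j`, its mean is that large, and its deviation from it is bounded by
`totalFluct`. -/
theorem pairs_le_of_totalFluct_le {ε V A : ℝ} (hε : 0 < ε) (hV : 0 ≤ V)
    (hm : ∀ k, 1 + ε ≤ truncMean L ν k) (hσ : ∀ k, truncSecond L ν k ≤ V) {j d : ℕ}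
    {N : List ℕ → ℕ} (hA0 : 0 ≤ A) (hA : totalFluct L ν (j + 1 + d) N ≤ A) :
    levelSum L (pairCount L d) j [] N * truncSize L ν 0 j ≤
      (A + V * (1 + A)) * truncSize L ν 0 (j + 1 + d) ^ 2 := by
  have hM : ∀ k d, 0 < truncSize L ν k d := truncSize_pos hε hm
  set n := j + 1 + d with hn
  have h1 : |pairFluct L ν j d N| * (truncSize L ν 0 j / truncSize L ν 0 n ^ 2) ≤ A := by
    have h := Finset.single_le_sum (s := Finset.range n) (f := fun j =>
      |pairFluct L ν j (n - 1 - j) N| * (truncSize L ν 0 j / truncSize L ν 0 n ^ 2))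
      (fun j _ => mul_nonneg (abs_nonneg _) (div_nonneg (hM _ _).le (sq_nonneg _)))
      (Finset.mem_range.2 (by omega : j < n))
    have hd : n - 1 - j = d := by omega
    simp only [hd] at h
    refine h.trans (le_trans ?_ hA)
    exact le_add_of_nonneg_left (Finset.sum_nonneg fun k _ =>
      div_nonneg (abs_nonneg _) (hM _ _).le)
  rw [← mul_div_assoc, div_le_iff₀ (pow_pos (hM 0 n) 2)] at h1
  have h2 := descCount_le_of_totalFluct_le hε hm hA (by omega : j ≤ n)
  have hn' : truncSize L ν 0 n = truncSize L ν 0 j * truncMean L ν j * truncSize L ν (j + 1) d := by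
    rw [hn, truncSize_add L ν 0 (j + 1) d, truncSize_add L ν 0 j 1]
    simp [truncSize]
  have h3 : truncSecond L ν j * truncSize L ν (j + 1) d ^ 2 * descCount L j [] N *
      truncSize L ν 0 j ≤ V * (1 + A) * truncSize L ν 0 n ^ 2 := by
    have hmj := hm j
    have ha := hM 0 j
    have he := hM (j + 1) d
    rw [hn']
    set a := truncSize L ν 0 j
    set e := truncSize L ν (j + 1) d
    set m := truncMean L ν j
    calc _ ≤ V * e ^ 2 * ((1 + A) * a) * a := by
          gcongr
          · exact descCount_nonneg L j [] N
          · exact hσ j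
      _ = V * (1 + A) * (a ^ 2 * e ^ 2) * 1 := by ring
      _ ≤ V * (1 + A) * (a ^ 2 * e ^ 2) * m ^ 2 := by
          gcongr
          nlinarith
      _ = _ := by ring
  have h4 : levelSum L (pairCount L d) j [] N ≤ |pairFluct L ν j d N| +
      truncSecond L ν j * truncSize L ν (j + 1) d ^ 2 * descCount L j [] N := by
    have := le_abs_self (pairFluct L ν j d N)
    rw [pairFluct] at this ⊢
    linarith
  calc _ ≤ (|pairFluct L ν j d N| +
      truncSecond L ν j * truncSize L ν (j + 1) d ^ 2 * descCount L j [] N) *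
        truncSize L ν 0 j := mul_le_mul_of_nonneg_right h4 (hM 0 j).le
    _ ≤ _ := by rw [add_mul, add_mul]; exact add_le_add h1 h3

variable [∀ k, IsProbabilityMeasure (ν k)]

theorem BddDep.integral_centered_sq_le {S : Set (List ℕ)} {f : (List ℕ → ℕ) → ℝ} (h : BddDep S f)
    {c : ℝ} (hc : ∫ N, f N ∂offspringLaw ν = c) :
    ∫ N, (f N - c * 1) ∂offspringLaw ν = 0 ∧
      ∫ N, (f N - c * 1) ^ 2 ∂offspringLaw ν ≤ ∫ N, f N ^ 2 ∂offspringLaw ν := by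
  have hi := h.integrable (offspringLaw ν)
  constructor
  · rw [integral_sub hi (integrable_const _), hc]; simp
  · have h1 : ∀ N, (f N - c * 1) ^ 2 = f N ^ 2 - (2 * c * f N - c ^ 2) := fun N => by ring
    simp only [h1]
    rw [integral_sub (h.pow_two.integrable _)
        (by exact (hi.const_mul _).sub (integrable_const _)),
      integral_sub (hi.const_mul _) (integrable_const _), integral_const_mul, hc]
    simp only [integral_const, probReal_univ, one_smul]
    nlinarith [sq_nonneg c]

theorem integral_pairCount (d : ℕ) (u : List ℕ) :
    ∫ N, pairCount L d u N ∂offspringLaw ν =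
      truncSecond L ν u.length * truncSize L ν (u.length + 1) d ^ 2 := by
  unfold pairCount
  rw [integral_pairs ν (fun i => bddDep_descCount L d (i :: u))]
  simp only [integral_descCount L ν d, List.length_cons, truncSecond, Finset.sum_mul, sq]

/-- A crude bound, in which the truncation `L` replaces the missing higher moments of the offspring
numbers. -/
theorem pairCount_sq_le (d : ℕ) (u : List ℕ) (N : List ℕ → ℕ) :
    pairCount L d u N ^ 2 ≤ (L u.length : ℝ) ^ 2 * ∑ i ∈ Finset.range (L u.length),
      ∑ j ∈ (Finset.range (L u.length)).erase i,
        descCount L d (i :: u) N ^ 2 * descCount L d (j :: u) N ^ 2 := by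
  set l := L u.length with hl
  have hY : ∀ i j, ((hasChild u i N * descCount L d (i :: u) N) *
      (hasChild u j N * descCount L d (j :: u) N)) ^ 2 ≤
      descCount L d (i :: u) N ^ 2 * descCount L d (j :: u) N ^ 2 := by
    intro i j
    have h : ∀ i, (hasChild u i N * descCount L d (i :: u) N) ^ 2 ≤ descCount L d (i :: u) N ^ 2 :=
      fun i => by
        rw [mul_pow]
        exact mul_le_of_le_one_left (sq_nonneg _)
          (pow_le_one₀ (hasChild_nonneg u i N) (hasChild_le_one u i N))
    rw [mul_pow]
    exact mul_le_mul (h i) (h j) (sq_nonneg _) (sq_nonneg _)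
  calc pairCount L d u N ^ 2
      ≤ l * ∑ i ∈ Finset.range l, (∑ j ∈ (Finset.range l).erase i,
          (hasChild u i N * descCount L d (i :: u) N) *
            (hasChild u j N * descCount L d (j :: u) N)) ^ 2 := by
        have := sq_sum_le_card_mul_sum_sq (s := Finset.range l) (f := fun i =>
          ∑ j ∈ (Finset.range l).erase i, (hasChild u i N * descCount L d (i :: u) N) *
            (hasChild u j N * descCount L d (j :: u) N))
        rwa [Finset.card_range] at this
    _ ≤ l * ∑ i ∈ Finset.range l, l * ∑ j ∈ (Finset.range l).erase i,
          descCount L d (i :: u) N ^ 2 * descCount L d (j :: u) N ^ 2 := by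
        gcongr with i hi
        refine (sq_sum_le_card_mul_sum_sq (s := (Finset.range l).erase i)).trans ?_
        refine mul_le_mul ?_ (Finset.sum_le_sum fun j _ => hY i j)
          (Finset.sum_nonneg fun j _ => sq_nonneg _) (Nat.cast_nonneg _)
        have := Finset.card_le_card (Finset.erase_subset i (Finset.range l))
        rw [Finset.card_range] at this
        exact_mod_cast this
    _ = _ := by rw [← Finset.mul_sum]; ring

theorem integral_pairCount_sq_le {ε V : ℝ} (hε : 0 < ε) (hV : 0 ≤ V)
    (hm : ∀ k, 1 + ε ≤ truncMean L ν k) (hσ : ∀ k, truncSecond L ν k ≤ V) (d : ℕ) (u : List ℕ) :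
    ∫ N, pairCount L d u N ^ 2 ∂offspringLaw ν ≤
      (L u.length : ℝ) ^ 4 * ((1 + V / ε) ^ 2 * truncSize L ν (u.length + 1) d ^ 4) := by
  set l := L u.length with hl
  have hd : ∀ i, BddDep (wordsBelow (i :: u)) fun N => descCount L d (i :: u) N ^ 2 := fun i =>
    (bddDep_descCount L d (i :: u)).pow_two
  have hd' : ∀ i, BddDep Set.univ fun N => descCount L d (i :: u) N ^ 2 := fun i =>
    (hd i).mono (Set.subset_univ _)
  have hE : ∀ i, ∫ N, descCount L d (i :: u) N ^ 2 ∂offspringLaw ν ≤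
      (1 + V / ε) * truncSize L ν (u.length + 1) d ^ 2 := fun i =>
    integral_descCount_sq_le hε hV hm hσ d (i :: u)
  set K := 1 + V / ε
  set M := truncSize L ν (u.length + 1) d
  have hK : 0 ≤ K := by positivity
  calc _ ≤ ∫ N, (l : ℝ) ^ 2 * ∑ i ∈ Finset.range l, ∑ j ∈ (Finset.range l).erase i,
        descCount L d (i :: u) N ^ 2 * descCount L d (j :: u) N ^ 2 ∂offspringLaw ν :=
        integral_mono ((bddDep_pairCount L d u).pow_two.integrable _)
          (((BddDep.sum _ fun i _ => BddDep.sum _ fun j _ => (hd' i).mul (hd' j)).integrable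
            _).const_mul _) fun N => pairCount_sq_le d u N
    _ = (l : ℝ) ^ 2 * ∑ i ∈ Finset.range l, ∑ j ∈ (Finset.range l).erase i,
        ∫ N, descCount L d (i :: u) N ^ 2 * descCount L d (j :: u) N ^ 2 ∂offspringLaw ν := by
        rw [integral_const_mul, integral_finsetSum _ fun i _ =>
          (BddDep.sum _ fun j _ => (hd' i).mul (hd' j)).integrable _]
        congr 1
        refine Finset.sum_congr rfl fun i _ => ?_
        rw [integral_finsetSum _ fun j _ => ((hd' i).mul (hd' j)).integrable _]
    _ ≤ (l : ℝ) ^ 2 * ∑ i ∈ Finset.range l, ∑ j ∈ Finset.range l, (K * M ^ 2) * (K * M ^ 2) := by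
        gcongr with i hi
        refine (Finset.sum_le_sum fun j hj => ?_).trans (Finset.sum_le_sum_of_subset_of_nonneg
          (Finset.erase_subset i (Finset.range l)) fun j _ _ => by positivity)
        rw [integral_mul_of_dependsOn _ (hd i).meas (hd j).meas (hd i).dep (hd j).dep
          (disjoint_wordsBelow_cons (Finset.ne_of_mem_erase hj).symm u)]
        exact mul_le_mul (hE i) (hE j) (integral_nonneg fun N => sq_nonneg _) (by positivity)
    _ = _ := by
        simp only [Finset.sum_const, Finset.card_range, nsmul_eq_mul]
        ring

/-- The deviation of a sum over generation `k` from its mean given the generation is of the order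
of the square root of the size of the generation. -/
theorem integral_abs_levelSum_le {ξ : List ℕ → (List ℕ → ℕ) → ℝ}
    (hξ : ∀ u, BddDep (wordsBelow u) (ξ u)) {c W : ℝ} (k : ℕ)
    (hc : ∀ v : List ℕ, v.length = k → ∫ N, ξ v N ∂offspringLaw ν = c)
    (hW : ∀ v : List ℕ, v.length = k → ∫ N, ξ v N ^ 2 ∂offspringLaw ν ≤ W) :
    ∫ N, |levelSum L ξ k [] N - c * descCount L k [] N| ∂offspringLaw ν ≤
      √(truncSize L ν 0 k * W) := by
  have hη : ∀ u, BddDep (wordsBelow u) fun N => ξ u N - c * 1 := fun u =>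
    (hξ u).sub (BddDep.const _ _)
  have h := (integral_levelSum_sq_le L ν hη (W := W) k [] ?_ ?_).2
  · have hb := bddDep_levelSum L hη k []
    have := integral_abs_le_sqrt (hb.integrable (offspringLaw ν)) (hb.pow_two.integrable _)
    have h2 := this.trans (Real.sqrt_le_sqrt h)
    simpa only [levelSum_sub L ξ (fun _ _ => 1) c k [], List.length_nil] using h2
  · intro v hv
    exact ((hξ v).integral_centered_sq_le (hc v (by simpa using hv))).1
  · intro v hv
    exact ((hξ v).integral_centered_sq_le (hc v (by simpa using hv))).2.trans
      (hW v (by simpa using hv))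

theorem integral_abs_sizeFluct_le (k : ℕ) :
    ∫ N, |sizeFluct L ν k N| ∂offspringLaw ν ≤ √(truncSize L ν 0 k * (L k : ℝ) ^ 2) := by
  have h := integral_abs_levelSum_le (L := L) (ν := ν) (ξ := descCount L 1)
    (bddDep_descCount L 1) (c := truncMean L ν k) (W := (L k : ℝ) ^ 2) k ?_ ?_
  · simpa only [levelSum_descCount L 1 k [], sizeFluct] using h
  · intro v hv
    rw [integral_descCount L ν 1 v, hv]
    simp [truncSize]
  · intro v hv
    have hle : ∀ N, descCount L 1 v N ^ 2 ≤ (L k : ℝ) ^ 2 := fun N => by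
      refine pow_le_pow_left₀ (descCount_nonneg L 1 v N) ?_ 2
      calc descCount L 1 v N = ∑ i ∈ Finset.range (L v.length), hasChild v i N * 1 := rfl
        _ ≤ ∑ i ∈ Finset.range (L v.length), (1 : ℝ) := Finset.sum_le_sum fun i _ => by
            rw [mul_one]; exact hasChild_le_one v i N
        _ = L k := by simp [hv]
    calc _ ≤ ∫ _, (L k : ℝ) ^ 2 ∂offspringLaw ν :=
          integral_mono ((bddDep_descCount L 1 v).pow_two.integrable _) (integrable_const _) hle
      _ = _ := by simp

theorem integral_abs_pairFluct_le {ε V : ℝ} (hε : 0 < ε) (hV : 0 ≤ V)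
    (hm : ∀ k, 1 + ε ≤ truncMean L ν k) (hσ : ∀ k, truncSecond L ν k ≤ V) (j d : ℕ) :
    ∫ N, |pairFluct L ν j d N| ∂offspringLaw ν ≤
      √(truncSize L ν 0 j) * ((L j : ℝ) ^ 2 * ((1 + V / ε) * truncSize L ν (j + 1) d ^ 2)) := by
  have h := integral_abs_levelSum_le (L := L) (ν := ν) (ξ := pairCount L d)
    (bddDep_pairCount L d) (c := truncSecond L ν j * truncSize L ν (j + 1) d ^ 2)
    (W := (L j : ℝ) ^ 4 * ((1 + V / ε) ^ 2 * truncSize L ν (j + 1) d ^ 4)) j ?_ ?_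
  · refine h.trans (le_of_eq ?_)
    rw [Real.sqrt_mul (truncSize_nonneg L ν 0 j)]
    have he := truncSize_nonneg L ν (j + 1) d
    rw [show (L j : ℝ) ^ 4 * ((1 + V / ε) ^ 2 * truncSize L ν (j + 1) d ^ 4) =
      ((L j : ℝ) ^ 2 * ((1 + V / ε) * truncSize L ν (j + 1) d ^ 2)) ^ 2 by ring,
      Real.sqrt_sq (by positivity)]
  · intro v hv
    rw [integral_pairCount, hv]
  · intro v hv
    have := integral_pairCount_sq_le hε hV hm hσ d v
    rwa [hv] at this

theorem integrable_totalFluct (n : ℕ) : Integrable (totalFluct L ν n) (offspringLaw ν) :=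
  (integrable_finsetSum _ fun k _ => ((bddDep_sizeFluct k).integrable _).abs.div_const _).add
    (integrable_finsetSum _ fun j _ => ((bddDep_pairFluct j _).integrable _).abs.mul_const _)

/-- The deviations in generation `k` contribute at most the order of
`L k ^ 2 / √(truncSize L ν 0 k)`, which is summable when the truncation grows slower than the
generations. -/
theorem integral_totalFluct_le {ε V : ℝ} (hε : 0 < ε) (hV : 0 ≤ V)
    (hm : ∀ k, 1 + ε ≤ truncMean L ν k) (hσ : ∀ k, truncSecond L ν k ≤ V)
    (hL : ∀ k, 1 ≤ L k)
    (hsum : Summable fun k => (L k : ℝ) ^ 2 / √(truncSize L ν 0 k)) (n : ℕ) :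
    ∫ N, totalFluct L ν n N ∂offspringLaw ν ≤
      (2 + V / ε) * ∑' k, (L k : ℝ) ^ 2 / √(truncSize L ν 0 k) := by
  have hM : ∀ k d, 0 < truncSize L ν k d := truncSize_pos hε hm
  have hK : 0 ≤ 1 + V / ε := by positivity
  have h1 : ∀ k, ∫ N, |sizeFluct L ν k N| / truncSize L ν 0 (k + 1) ∂offspringLaw ν ≤
      (L k : ℝ) ^ 2 / √(truncSize L ν 0 k) := by
    intro k
    rw [integral_div, div_le_div_iff₀ (hM _ _) (Real.sqrt_pos.2 (hM _ _))]
    have h := integral_abs_sizeFluct_le (L := L) (ν := ν) k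
    rw [Real.sqrt_mul (hM 0 k).le, Real.sqrt_sq (Nat.cast_nonneg _)] at h
    have hL1 : (1 : ℝ) ≤ L k := by exact_mod_cast hL k
    have hmm : truncSize L ν 0 k ≤ truncSize L ν 0 (k + 1) := by
      rw [truncSize_add]
      refine le_mul_of_one_le_right (hM 0 k).le ?_
      simp only [truncSize, Finset.range_one, Finset.prod_singleton]
      linarith [hm (0 + k + 0)]
    calc _ ≤ √(truncSize L ν 0 k) * L k * √(truncSize L ν 0 k) :=
          mul_le_mul_of_nonneg_right h (Real.sqrt_nonneg _)
      _ = L k * truncSize L ν 0 k := by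
          rw [mul_right_comm, Real.mul_self_sqrt (hM 0 k).le, mul_comm]
      _ ≤ (L k : ℝ) ^ 2 * truncSize L ν 0 (k + 1) :=
          mul_le_mul (by nlinarith) hmm (hM 0 k).le (by positivity)
  have h2 : ∀ j ∈ Finset.range n, ∫ N, |pairFluct L ν j (n - 1 - j) N| *
      (truncSize L ν 0 j / truncSize L ν 0 n ^ 2) ∂offspringLaw ν ≤
      (1 + V / ε) * ((L j : ℝ) ^ 2 / √(truncSize L ν 0 j)) := by
    intro j hj
    have hjn : n = j + 1 + (n - 1 - j) := by have := Finset.mem_range.1 hj; omega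
    set d := n - 1 - j
    rw [integral_mul_const]
    refine (mul_le_mul_of_nonneg_right (integral_abs_pairFluct_le hε hV hm hσ j d)
      (div_nonneg (hM _ _).le (sq_nonneg _))).trans ?_
    rw [hjn, truncSize_add L ν 0 (j + 1) d, truncSize_add L ν 0 j 1]
    simp only [zero_add]
    have hm1 : 1 ≤ truncSize L ν j 1 := by
      simp only [truncSize, Finset.range_one, Finset.prod_singleton]
      linarith [hm (j + 0)]
    have hMd := hM (j + 1) d
    have hMj := hM 0 j
    set a := truncSize L ν 0 j
    set b := truncSize L ν j 1
    set e := truncSize L ν (j + 1) d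
    have hsa : 0 < √a := Real.sqrt_pos.2 hMj
    have hsa2 : √a * √a = a := Real.mul_self_sqrt hMj.le
    have : √a * ((L j : ℝ) ^ 2 * ((1 + V / ε) * e ^ 2)) * (a / (a * b * e) ^ 2) =
        (1 + V / ε) * ((L j : ℝ) ^ 2 / √a) / b ^ 2 := by
      have hb : b ≠ 0 := by linarith
      have h (t : ℝ) (ht : 0 < t) : t * ((L j : ℝ) ^ 2 * ((1 + V / ε) * e ^ 2)) *
          (t * t / (t * t * b * e) ^ 2) = (1 + V / ε) * ((L j : ℝ) ^ 2 / t) / b ^ 2 := by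
        field_simp
      have := h (√a) hsa
      rwa [hsa2] at this
    rw [this]
    exact div_le_self (by positivity) (by nlinarith)
  have hint1 : ∀ k, Integrable (fun N => |sizeFluct L ν k N| / truncSize L ν 0 (k + 1))
      (offspringLaw ν) := fun k => ((bddDep_sizeFluct k).integrable _).abs.div_const _
  have hint2 : ∀ j, Integrable (fun N => |pairFluct L ν j (n - 1 - j) N| *
      (truncSize L ν 0 j / truncSize L ν 0 n ^ 2)) (offspringLaw ν) := fun j =>
    ((bddDep_pairFluct j _).integrable _).abs.mul_const _
  have hpos : ∀ k, 0 ≤ (L k : ℝ) ^ 2 / √(truncSize L ν 0 k) := fun k => by positivity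
  unfold totalFluct
  rw [integral_add (integrable_finsetSum _ fun k _ => hint1 k)
    (integrable_finsetSum _ fun j _ => hint2 j), integral_finsetSum _ fun k _ => hint1 k,
    integral_finsetSum _ fun j _ => hint2 j]
  calc _ ≤ ∑ k ∈ Finset.range n, (L k : ℝ) ^ 2 / √(truncSize L ν 0 k) +
        ∑ j ∈ Finset.range n, (1 + V / ε) * ((L j : ℝ) ^ 2 / √(truncSize L ν 0 j)) :=
        add_le_add (Finset.sum_le_sum fun k _ => h1 k) (Finset.sum_le_sum h2)
    _ = (2 + V / ε) * ∑ k ∈ Finset.range n, (L k : ℝ) ^ 2 / √(truncSize L ν 0 k) := by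
        rw [← Finset.mul_sum]; ring
    _ ≤ _ := mul_le_mul_of_nonneg_left (hsum.sum_le_tsum _ fun k _ => hpos k) (by positivity)

end Fluctuations

/-! ### Growth at the rate of the mean -/

section Survival

variable {L : ℕ → ℕ} {ν : ℕ → Measure ℕ} [∀ k, IsProbabilityMeasure (ν k)]

theorem measurableSet_le_descCount (d : ℕ) (u : List ℕ) (t : ℝ) :
    MeasurableSet {N | t ≤ descCount L d u N} :=
  measurableSet_le measurable_const (bddDep_descCount L d u).meas

/-- The Paley-Zygmund inequality for the size of a generation. -/
theorem le_measureReal_le_descCount {ε V : ℝ} (hε : 0 < ε) (hV : 0 ≤ V)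
    (hm : ∀ k, 1 + ε ≤ truncMean L ν k) (hσ : ∀ k, truncSecond L ν k ≤ V) (d : ℕ) (u : List ℕ) :
    (4 * (1 + V / ε))⁻¹ ≤
      (offspringLaw ν).real {N | truncSize L ν u.length d / 2 ≤ descCount L d u N} := by
  set M := truncSize L ν u.length d with hMdef
  have hM : 0 < M := truncSize_pos hε hm _ _
  set K := 1 + V / ε with hKdef
  have hK : 0 < K := by positivity
  set A := {N | M / 2 ≤ descCount L d u N} with hA
  have hAm : MeasurableSet A := measurableSet_le_descCount d u _
  set p := (offspringLaw ν).real A with hp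
  have hZ := bddDep_descCount L d u
  have hE := integral_descCount L ν d u
  have hE2 := integral_descCount_sq_le hε hV hm hσ d u
  have hI : BddDep Set.univ (A.indicator (1 : (List ℕ → ℕ) → ℝ)) :=
    BddDep.indicator hAm fun X Y h => by rw [funext fun v => h v (Set.mem_univ v)]
  have hZu := hZ.mono (Set.subset_univ _)
  -- Pointwise, for every `t > 0`: `Z ≤ M / 2 + t * Z ^ 2 + 1_A / (4 * t)`, taken
  -- at `t = 1 / (4 * K * M)`
  set t := (4 * K * M)⁻¹ with ht
  have htp : 0 < t := by positivity
  have hpt : ∀ N, descCount L d u N ≤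
      M / 2 + t * descCount L d u N ^ 2 + (4 * t)⁻¹ * A.indicator 1 N := by
    intro N
    by_cases hN : N ∈ A
    · simp only [Set.indicator_of_mem hN, Pi.one_apply, mul_one]
      have h0 : 0 ≤ (2 * t * descCount L d u N - 1) ^ 2 / (4 * t) := by positivity
      have h1 : (2 * t * descCount L d u N - 1) ^ 2 / (4 * t) =
          t * descCount L d u N ^ 2 - descCount L d u N + (4 * t)⁻¹ := by
        field_simp
        ring
      linarith
    · simp only [Set.indicator_of_notMem hN, mul_zero, add_zero]
      have h1 : descCount L d u N < M / 2 := not_le.1 hN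
      have h2 : 0 ≤ t * descCount L d u N ^ 2 := by positivity
      linarith
  have hint := integral_mono (hZ.integrable (offspringLaw ν))
    (((integrable_const (M / 2)).add ((hZ.pow_two.integrable _).const_mul t)).add
      ((hI.integrable _).const_mul (4 * t)⁻¹)) hpt
  simp only [Pi.add_apply] at hint
  rw [hE, integral_add (by exact (integrable_const _).add ((hZ.pow_two.integrable _).const_mul t))
    ((hI.integrable _).const_mul _), integral_add (integrable_const _)
      ((hZ.pow_two.integrable _).const_mul t), integral_const_mul, integral_const_mul,
    integral_indicator_one hAm] at hint
  simp only [integral_const, probReal_univ, one_smul] at hint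
  have h3 : t * ∫ N, descCount L d u N ^ 2 ∂offspringLaw ν ≤ M / 4 := by
    calc _ ≤ t * (K * M ^ 2) := mul_le_mul_of_nonneg_left hE2 htp.le
      _ = M / 4 := by rw [ht]; field_simp
  have h4 : (4 * t)⁻¹ = K * M := by rw [ht]; field_simp
  rw [h4, ← hp, ← hMdef] at hint
  have h5 : M * (1 / 4) ≤ M * (K * p) := by linarith
  have h6 := le_of_mul_le_mul_left h5 hM
  rw [inv_le_iff_one_le_mul₀ (by positivity)]
  linarith

theorem descCount_child_le {i d : ℕ} {u : List ℕ} {N : List ℕ → ℕ} (hi : i < L u.length)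
    (hN : i < N u) : descCount L d (i :: u) N ≤ descCount L (d + 1) u N := by
  have h := Finset.single_le_sum (s := Finset.range (L u.length))
    (f := fun i => hasChild u i N * descCount L d (i :: u) N)
    (fun i _ => mul_nonneg (hasChild_nonneg u i N) (descCount_nonneg L d _ N))
    (Finset.mem_range.2 hi)
  have h1 : hasChild u i N = 1 := if_pos hN
  simp only [h1, one_mul] at h
  exact h

/-- A line of descent through first children meets, at each step and independently of the past, a
second child with a large progeny, with a probability bounded away from `0`. -/
theorem measureReal_descCount_lt_le {ε V p : ℝ} (hε : 0 < ε) (hV : 0 ≤ V)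
    (hm : ∀ k, 1 + ε ≤ truncMean L ν k) (hσ : ∀ k, truncSecond L ν k ≤ V)
    (h0 : ∀ k, ν k {0} = 0) (hp : 0 ≤ p) (h1 : ∀ k, p ≤ childProb ν k 1) (hL : ∀ k, 2 ≤ L k)
    (d : ℕ) :
    ∀ (r : ℕ) (u : List ℕ), (offspringLaw ν).real
      {N | descCount L (d + r) u N < truncSize L ν (u.length + r) d / 2} ≤
        (1 - p * (4 * (1 + V / ε))⁻¹) ^ r
  | 0, u => by rw [pow_zero]; exact measureReal_le_one
  | r + 1, u => by
    have hK : 0 < 1 + V / ε := by positivity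
    set κ := (4 * (1 + V / ε))⁻¹ with hκ
    have hκ0 : 0 ≤ κ := by positivity
    set t := truncSize L ν (u.length + (r + 1)) d / 2 with ht
    set A0 := {N | descCount L (d + r) (0 :: u) N < t} with hA0
    set A1 := {N | t ≤ descCount L (d + r) (1 :: u) N} with hA1
    have hA0m : MeasurableSet A0 :=
      measurableSet_lt (bddDep_descCount L (d + r) (0 :: u)).meas measurable_const
    have hA1m : MeasurableSet A1 := measurableSet_le_descCount _ _ _
    have hA0d : DependsOn (· ∈ A0) (wordsBelow (0 :: u)) := fun X Y h => by
      change (descCount L (d + r) (0 :: u) X < t) = (descCount L (d + r) (0 :: u) Y < t)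
      rw [(bddDep_descCount L (d + r) (0 :: u)).dep h]
    have hA1d : DependsOn (· ∈ A1) (wordsBelow (1 :: u)) := fun X Y h => by
      change (t ≤ descCount L (d + r) (1 :: u) X) = (t ≤ descCount L (d + r) (1 :: u) Y)
      rw [(bddDep_descCount L (d + r) (1 :: u)).dep h]
    have hI0 := BddDep.indicator hA0m hA0d
    have hI1 := BddDep.indicator hA1m hA1d
    have hE0 : (offspringLaw ν).real A0 ≤ (1 - p * κ) ^ r := by
      have := measureReal_descCount_lt_le hε hV hm hσ h0 hp h1 hL d r (0 :: u)
      rwa [List.length_cons, show u.length + 1 + r = u.length + (r + 1) by omega] at this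
    have hE1 : κ ≤ (offspringLaw ν).real A1 := by
      refine (le_measureReal_le_descCount hε hV hm hσ (d + r) (1 :: u)).trans
        (measureReal_mono fun N hN => ?_)
      have hN' : truncSize L ν (1 :: u).length (d + r) / 2 ≤ descCount L (d + r) (1 :: u) N := hN
      refine le_trans ?_ hN'
      rw [ht, List.length_cons, add_comm d r, truncSize_add,
        show u.length + (r + 1) = u.length + 1 + r by omega]
      have h2 : 1 ≤ truncSize L ν (u.length + 1) r :=
        Finset.one_le_prod fun i _ => by linarith [hm (u.length + 1 + i)]
      have h3 := truncSize_nonneg L ν (u.length + 1 + r) d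
      nlinarith
    have hN0 : (offspringLaw ν).real {N | N u = 0} = 0 := by
      have h2 : (offspringLaw ν) ((fun N : List ℕ → ℕ => N u) ⁻¹' {0}) = 0 := by
        rw [← Measure.map_apply (measurable_pi_apply u) (measurableSet_singleton 0),
          Measure.infinitePi_map_eval (fun v : List ℕ => ν v.length) u, h0]
      rw [measureReal_def]
      exact (congrArg ENNReal.toReal h2).trans ENNReal.toReal_zero
    have hsub : {N | descCount L (d + (r + 1)) u N < t} ⊆
        {N | N u = 0} ∪ (A0 \ ({N | 1 < N u} ∩ A1)) := by
      intro N hN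
      have hN' : descCount L (d + r + 1) u N < t := hN
      by_cases hz : N u = 0
      · exact Or.inl hz
      · refine Or.inr ⟨?_, fun h => ?_⟩
        · exact (descCount_child_le (by linarith [hL u.length])
            (Nat.pos_of_ne_zero hz)).trans_lt hN'
        · have h2 : t ≤ descCount L (d + r) (1 :: u) N := h.2
          have h3 := descCount_child_le (L := L) (d := d + r) (i := 1) (u := u) (N := N)
            (by linarith [hL u.length]) h.1
          linarith
    -- Independence of the offspring number of `u` and the progenies of its first two children
    have hinter : (offspringLaw ν).real (A0 ∩ ({N | 1 < N u} ∩ A1)) =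
        (offspringLaw ν).real A0 * (childProb ν u.length 1 * (offspringLaw ν).real A1) := by
      have hm3 := hA0m.inter ((measurableSet_lt_apply u 1).inter hA1m)
      rw [← integral_indicator_one hm3]
      have h2 : ∀ N, (A0 ∩ ({N | 1 < N u} ∩ A1)).indicator (1 : (List ℕ → ℕ) → ℝ) N =
          hasChild u 1 N * (A0.indicator 1 N * A1.indicator 1 N) := by
        intro N
        by_cases ha : N ∈ A0 <;> by_cases hb : 1 < N u <;> by_cases hc : N ∈ A1 <;>
          simp [ha, hb, hc, hasChild, Set.indicator]
      simp only [h2]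
      have hS : u ∉ wordsBelow (0 :: u) ∪ wordsBelow (1 :: u) := fun h =>
        h.elim (notMem_wordsBelow_cons 0 u) (notMem_wordsBelow_cons 1 u)
      rw [integral_hasChild_mul ν hS ((hI0.mono Set.subset_union_left).mul
        (hI1.mono Set.subset_union_right)), integral_mul_of_dependsOn _ hI0.meas hI1.meas
          hI0.dep hI1.dep (disjoint_wordsBelow_cons zero_ne_one u),
        integral_indicator_one hA0m, integral_indicator_one hA1m]
      ring
    have hdiff := measureReal_inter_add_sdiff₀ (μ := offspringLaw ν) (s := A0)
      ((measurableSet_lt_apply u 1).inter hA1m).nullMeasurableSet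
    rw [hinter] at hdiff
    have hc1 : p * κ ≤ childProb ν u.length 1 * (offspringLaw ν).real A1 :=
      mul_le_mul (h1 _) hE1 hκ0 (childProb_nonneg _ _ _)
    have hc2 : childProb ν u.length 1 * (offspringLaw ν).real A1 ≤ 1 :=
      mul_le_one₀ (childProb_le_one ν _ _) measureReal_nonneg measureReal_le_one
    calc _ ≤ (offspringLaw ν).real ({N | N u = 0} ∪ (A0 \ ({N | 1 < N u} ∩ A1))) :=
          measureReal_mono hsub
      _ ≤ (offspringLaw ν).real {N | N u = 0} +
            (offspringLaw ν).real (A0 \ ({N | 1 < N u} ∩ A1)) := measureReal_union_le _ _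
      _ = (offspringLaw ν).real A0 *
            (1 - childProb ν u.length 1 * (offspringLaw ν).real A1) := by
          rw [hN0]; linarith
      _ ≤ (1 - p * κ) ^ r * (1 - p * κ) :=
          mul_le_mul hE0 (by linarith) (by linarith) (measureReal_nonneg.trans hE0)
      _ = _ := (pow_succ _ _).symm

/-- Almost surely, for infinitely many `n`, generation `n` is as large as its mean, up to a
constant, and the deviations from the means are bounded. -/
theorem ae_exists_frequently {ε V p : ℝ} (hε : 0 < ε) (hV : 0 ≤ V)
    (hm : ∀ k, 1 + ε ≤ truncMean L ν k) (hσ : ∀ k, truncSecond L ν k ≤ V)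
    (h0 : ∀ k, ν k {0} = 0) (hp : 0 < p) (h1 : ∀ k, p ≤ childProb ν k 1) (hL : ∀ k, 2 ≤ L k)
    (hsum : Summable fun k => (L k : ℝ) ^ 2 / √(truncSize L ν 0 k)) :
    ∀ᵐ N ∂offspringLaw ν, ∃ C : ℝ, 0 ≤ C ∧ ∃ᶠ n in Filter.atTop,
      truncSize L ν 0 n ≤ C * descCount L n [] N ∧ totalFluct L ν n N ≤ C := by
  have hM : ∀ k d, 0 < truncSize L ν k d := truncSize_pos hε hm
  set G : ℝ → ℕ → Set (List ℕ → ℕ) := fun C n =>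
    {N | truncSize L ν 0 n ≤ C * descCount L n [] N ∧ totalFluct L ν n N ≤ C} with hG
  set S := (2 + V / ε) * ∑' k, (L k : ℝ) ^ 2 / √(truncSize L ν 0 k) with hS
  set c := p * (4 * (1 + V / ε))⁻¹ with hc
  have hc0 : 0 < c := by positivity
  have hc1 : c ≤ 1 := by
    have h2 : p ≤ 1 := (h1 0).trans (childProb_le_one ν 0 1)
    have h3 : (4 * (1 + V / ε))⁻¹ ≤ 1 := inv_le_one_of_one_le₀ (by
      have : 0 ≤ V / ε := by positivity
      linarith)
    exact mul_le_one₀ h2 (by positivity) h3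
  have hfl : ∀ n N, 0 ≤ totalFluct L ν n N := fun n N =>
    add_nonneg (Finset.sum_nonneg fun k _ => div_nonneg (abs_nonneg _) (hM _ _).le)
      (Finset.sum_nonneg fun j _ =>
        mul_nonneg (abs_nonneg _) (div_nonneg (hM _ _).le (sq_nonneg _)))
  have hkey : ∀ δ > 0, ∃ C ≥ 0, ∃ r, ∀ n ≥ r, (offspringLaw ν).real (G C n)ᶜ ≤ δ := by
    intro δ hδ
    obtain ⟨r, hr⟩ := exists_pow_lt_of_lt_one (half_pos hδ) (by linarith : 1 - c < 1)
    set C := max (2 * truncSize L ν 0 r) (2 * (|S| + 1) / δ) with hC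
    have hCp : 0 < C := lt_max_of_lt_left (by linarith [hM 0 r])
    refine ⟨C, hCp.le, r, fun n hn => ?_⟩
    obtain ⟨d, rfl⟩ : ∃ d, n = d + r := ⟨n - r, by omega⟩
    have hsub : (G C (d + r))ᶜ ⊆
        {N | descCount L (d + r) [] N < truncSize L ν (0 + r) d / 2} ∪
          {N | C ≤ totalFluct L ν (d + r) N} := by
      intro N hN
      by_contra hN'
      rw [Set.mem_union, not_or] at hN'
      obtain ⟨ha, hb⟩ := hN'
      have ha' : truncSize L ν (0 + r) d / 2 ≤ descCount L (d + r) [] N := not_lt.1 ha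
      have hb' : totalFluct L ν (d + r) N < C := not_le.1 hb
      refine hN ⟨?_, hb'.le⟩
      rw [add_comm d r, truncSize_add, add_comm r d]
      calc truncSize L ν 0 r * truncSize L ν (0 + r) d
          = 2 * truncSize L ν 0 r * (truncSize L ν (0 + r) d / 2) := by ring
        _ ≤ C * descCount L (d + r) [] N :=
            mul_le_mul (le_max_left _ _) ha' (by linarith [hM (0 + r) d]) hCp.le
    have hA := measureReal_descCount_lt_le hε hV hm hσ h0 hp.le h1 hL d r []
    have hMk := mul_meas_ge_le_integral_of_nonneg (μ := offspringLaw ν)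
      (Filter.Eventually.of_forall (hfl (d + r))) (integrable_totalFluct (d + r)) C
    have hI := integral_totalFluct_le hε hV hm hσ (fun k => by linarith [hL k]) hsum (d + r)
    have hB : (offspringLaw ν).real {N | C ≤ totalFluct L ν (d + r) N} ≤ δ / 2 := by
      have h2 : 2 * (|S| + 1) / δ ≤ C := le_max_right _ _
      rw [div_le_iff₀ hδ] at h2
      have h3 : C * (offspringLaw ν).real {N | C ≤ totalFluct L ν (d + r) N} ≤ C * (δ / 2) := by
        have := le_abs_self S
        linarith
      exact le_of_mul_le_mul_left h3 hCp
    refine (measureReal_mono hsub).trans ((measureReal_union_le _ _).trans ?_)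
    have hA' := hA.trans hr.le
    rw [List.length_nil] at hA'
    linarith
  rw [ae_iff]
  -- The good event has probability at least `1 - δ` in each late generation, hence so has the event
  -- that it occurs infinitely often.
  set bad := {N | ¬ ∃ C : ℝ, 0 ≤ C ∧ ∃ᶠ n in Filter.atTop,
      truncSize L ν 0 n ≤ C * descCount L n [] N ∧ totalFluct L ν n N ≤ C} with hbad
  refine le_antisymm (ENNReal.le_of_forall_pos_le_add fun δ hδ _ => ?_) (zero_le)
  obtain ⟨C, hC0, r, hr⟩ := hkey δ hδ
  rw [zero_add]
  have hsub : bad ⊆ ⋃ k, ⋂ n ≥ k, (G C n)ᶜ := by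
    intro N hN
    have h2 : ¬ ∃ᶠ n in Filter.atTop, N ∈ G C n := fun h => hN ⟨C, hC0, h⟩
    rw [Filter.not_frequently, Filter.eventually_atTop] at h2
    obtain ⟨k, hk⟩ := h2
    exact Set.mem_iUnion.2 ⟨k, Set.mem_iInter₂.2 hk⟩
  refine (measure_mono hsub).trans ?_
  have hmono : Monotone fun k => ⋂ n ≥ k, (G C n)ᶜ := fun k l hkl =>
    Set.biInter_mono (fun n (hn : n ≥ l) => le_trans hkl hn) fun _ _ => le_rfl
  rw [hmono.measure_iUnion]
  refine iSup_le fun k => ?_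
  have h3 : (⋂ n ≥ k, (G C n)ᶜ) ⊆ (G C (max k r))ᶜ := Set.biInter_subset_of_mem (le_max_left k r)
  refine (measure_mono h3).trans ?_
  have h4 := hr (max k r) (le_max_right k r)
  rw [measureReal_def] at h4
  rw [← ENNReal.ofReal_toReal (measure_ne_top (offspringLaw ν) (G C (max k r))ᶜ)]
  exact (ENNReal.ofReal_le_ofReal h4).trans (le_of_eq (ENNReal.ofReal_coe_nnreal))

end Survival

/-! ### Infinite paths and closed targets -/

/-- The sequences whose first `n` terms are limits of the first `n` terms of elements of `B`. Unlike
the set of the sequences that share their first `n` terms with an element of `B`, this is a closed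
set. -/
def initialHull (B : Set (ℕ → ℝ)) (n : ℕ) : Set (ℕ → ℝ) :=
  (fun x (i : Fin n) => x i) ⁻¹' closure ((fun x (i : Fin n) => x i) '' B)

section InitialHull

variable {B : Set (ℕ → ℝ)}

theorem isClosed_initialHull (B : Set (ℕ → ℝ)) (n : ℕ) : IsClosed (initialHull B n) :=
  isClosed_closure.preimage (by fun_prop)

theorem mem_initialHull_of_eq {n : ℕ} {b x : ℕ → ℝ} (hb : b ∈ B) (h : ∀ i < n, x i = b i) :
    x ∈ initialHull B n :=
  subset_closure ⟨b, hb, funext fun i => (h i i.2).symm⟩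

theorem initialHull_congr {n : ℕ} {x y : ℕ → ℝ} (h : ∀ i < n, x i = y i)
    (hx : x ∈ initialHull B n) : y ∈ initialHull B n := by
  have : (fun i : Fin n => x i) = fun i : Fin n => y i := funext fun i => h i i.2
  unfold initialHull at hx ⊢
  rw [Set.mem_preimage] at hx ⊢
  rwa [← this]

theorem initialHull_succ_subset (B : Set (ℕ → ℝ)) (n : ℕ) :
    initialHull B (n + 1) ⊆ initialHull B n := by
  intro x hx
  have hc : Continuous fun (y : Fin (n + 1) → ℝ) (i : Fin n) => y i.castSucc := by fun_prop
  have := image_closure_subset_closure_image hc (Set.mem_image_of_mem _ hx)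
  rwa [Set.image_image] at this

theorem mem_of_forall_mem_initialHull (hB : IsClosed B) {x : ℕ → ℝ}
    (hx : ∀ n, x ∈ initialHull B n) : x ∈ B := by
  have h : ∀ n, ∃ b ∈ B, ∀ i < n, dist (b i) (x i) ≤ 1 / ((n : ℝ) + 1) := fun n => by
    obtain ⟨_, ⟨b, hb, rfl⟩, hd⟩ := Metric.mem_closure_iff.1 (hx n) (1 / ((n : ℝ) + 1))
      Nat.one_div_pos_of_nat
    refine ⟨b, hb, fun i hi => ?_⟩
    rw [dist_comm]
    exact (dist_le_pi_dist (fun i : Fin n => x i) (fun i : Fin n => b i) ⟨i, hi⟩).trans hd.le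
  choose b hb hbd using h
  refine hB.mem_of_tendsto (b := Filter.atTop) (tendsto_pi_nhds.2 fun i => ?_)
    (Filter.Eventually.of_forall hb)
  rw [tendsto_iff_dist_tendsto_zero]
  refine squeeze_zero' (Filter.Eventually.of_forall fun _ => dist_nonneg)
    ((Filter.eventually_gt_atTop i).mono fun n hn => hbd n i hn)
    tendsto_one_div_add_atTop_nhds_zero_nat

end InitialHull

namespace LayeredTree

variable {V : Type*} (T : LayeredTree V) {B : Set (ℕ → ℝ)} {X : V → ℝ}

/-- A branch whose labels form an element of `B` meets the closed initial hulls of `B` at every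
finite depth. -/
theorem mem_Hit_of_branch {x : ℕ → V} (hx : ∀ n, x (n + 1) ∈ T.ch (x n))
    (hlvl : ∀ n, T.lvl (x n) = n) (hB : (fun n => X (x (n + 1))) ∈ B) : ∀ d k (y : ℕ → ℝ),
    (∀ i < k, y i = X (x (i + 1))) → X ∈ T.Hit (initialHull B (k + d)) d (x k) y
  | 0, _, _, hy => mem_initialHull_of_eq hB hy
  | d + 1, k, y, hy => by
    refine ⟨x (k + 1), hx k, ?_⟩
    rw [hlvl, show k + (d + 1) = k + 1 + d by omega]
    refine mem_Hit_of_branch hx hlvl hB d (k + 1) _ fun i hi => ?_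
    rcases Nat.lt_succ_iff_lt_or_eq.1 hi with h | rfl
    · rw [update_of_ne h.ne, hy i h]
    · rw [update_self]

theorem Hit_initialHull_succ_subset (B : Set (ℕ → ℝ)) : ∀ d (v : V) (y : ℕ → ℝ),
    T.Hit (initialHull B (T.lvl v + (d + 1))) (d + 1) v y ⊆
      T.Hit (initialHull B (T.lvl v + d)) d v y
  | 0, v, y => by
    rintro X ⟨a, -, h⟩
    exact initialHull_congr (fun i hi => update_of_ne (ne_of_lt hi) _ _)
      (initialHull_succ_subset B _ h)
  | d + 1, v, y => by
    rintro X ⟨a, ha, h⟩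
    refine ⟨a, ha, ?_⟩
    have := T.lvl_of_mem ha
    rw [show T.lvl v + (d + 1 + 1) = T.lvl a + (d + 1) by omega] at h
    rw [show T.lvl v + (d + 1) = T.lvl a + d by omega]
    exact Hit_initialHull_succ_subset B d a _ h

theorem antitone_Hit_initialHull (B : Set (ℕ → ℝ)) (v : V) (y : ℕ → ℝ) :
    Antitone fun d => T.Hit (initialHull B (T.lvl v + d)) d v y :=
  antitone_nat_of_succ_le fun d => T.Hit_initialHull_succ_subset B d v y

/-- A vertex below which hits exist at all depths has a child with this property, since it has
finitely many children. -/
theorem exists_child_forall_mem_Hit {v : V} {y : ℕ → ℝ}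
    (h : ∀ d, X ∈ T.Hit (initialHull B (T.lvl v + d)) d v y) :
    ∃ a ∈ T.ch v, ∀ d, X ∈ T.Hit (initialHull B (T.lvl a + d)) d a (update y (T.lvl v) (X a)) := by
  have h' : ∀ d, ∃ a ∈ T.ch v,
      X ∈ T.Hit (initialHull B (T.lvl a + d)) d a (update y (T.lvl v) (X a)) := fun d => by
    obtain ⟨a, ha, h⟩ := h (d + 1)
    refine ⟨a, ha, ?_⟩
    rwa [T.lvl_of_mem ha, Nat.add_right_comm]
  by_contra! hc
  choose! D hD using hc
  obtain ⟨a, ha, hX⟩ := h' ((T.ch v).sup D)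
  exact hD a ha (T.antitone_Hit_initialHull B a _ (Finset.le_sup ha) hX)

/-- König's lemma: a labelling that meets the initial hulls of a closed set `B` at every finite
depth has a branch whose labels form an element of `B`. -/
theorem exists_branch_of_forall_mem_Hit (hB : IsClosed B) {u : V} (hu : T.lvl u = 0) {y : ℕ → ℝ}
    (h : ∀ d, X ∈ T.Hit (initialHull B d) d u y) :
    ∃ x : ℕ → V, x 0 = u ∧ (∀ n, x (n + 1) ∈ T.ch (x n)) ∧ (fun n => X (x (n + 1))) ∈ B := by
  let S := {p : V × (ℕ → ℝ) // ∀ d, X ∈ T.Hit (initialHull B (T.lvl p.1 + d)) d p.1 p.2}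
  choose c hc hcX using fun p : S => T.exists_child_forall_mem_Hit p.2
  let next : S → S := fun p => ⟨(c p, update p.1.2 (T.lvl p.1.1) (X (c p))), hcX p⟩
  let s : ℕ → S := fun n => next^[n] ⟨(u, y), fun d => by rw [hu, Nat.zero_add]; exact h d⟩
  have hs : ∀ n, s (n + 1) = next (s n) := fun n => iterate_succ_apply' _ _ _
  have hch : ∀ n, (s (n + 1)).1.1 ∈ T.ch (s n).1.1 := fun n => by rw [hs]; exact hc _
  have hlvl : ∀ n, T.lvl (s n).1.1 = n := fun n => by
    induction n with
    | zero => exact hu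
    | succ n ih => rw [T.lvl_of_mem (hch n), ih]
  have hval : ∀ n, ∀ i < n, (s n).1.2 i = X (s (i + 1)).1.1 := fun n => by
    induction n with
    | zero => exact fun i hi => absurd hi (Nat.not_lt_zero i)
    | succ n ih =>
      intro i hi
      have : (s (n + 1)).1.2 = update (s n).1.2 (T.lvl (s n).1.1) (X (s (n + 1)).1.1) := by
        rw [hs]
      rw [this, hlvl]
      rcases Nat.lt_succ_iff_lt_or_eq.1 hi with h | rfl
      · rw [update_of_ne h.ne, ih i h]
      · rw [update_self]
  refine ⟨fun n => (s n).1.1, rfl, hch, mem_of_forall_mem_initialHull hB fun n => ?_⟩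
  have h0 := (s n).2 0
  rw [hlvl] at h0
  exact initialHull_congr (hval n) h0

open Classical in
/-- The descendants of `u` in the `d`-th generation after `u`. -/
noncomputable def gen : ℕ → V → Finset V
  | 0, u => {u}
  | d + 1, u => (T.ch u).biUnion (gen d)

theorem gen_subset_below : ∀ d u, (T.gen d u : Set V) ⊆ T.below u
  | 0, u => by
    intro v hv
    obtain rfl : v = u := by simpa [gen] using hv
    exact T.self_mem_below v
  | d + 1, u => by
    intro v hv
    simp only [gen, Finset.coe_biUnion, Set.mem_iUnion] at hv
    obtain ⟨a, ha, hv⟩ := hv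
    exact T.sbelow_subset_below u (below_subset_sbelow ha (gen_subset_below d a hv))

theorem lvl_of_mem_gen : ∀ d u v, v ∈ T.gen d u → T.lvl v = T.lvl u + d
  | 0, u, v, hv => by
    obtain rfl : v = u := by simpa [gen] using hv
    rfl
  | d + 1, u, v, hv => by
    simp only [gen, Finset.mem_biUnion] at hv
    obtain ⟨a, ha, hv⟩ := hv
    rw [lvl_of_mem_gen d a v hv, T.lvl_of_mem ha]
    omega

open Classical in
theorem card_gen : ∀ d u, (T.gen d u).card = T.cnt d u
  | 0, _ => rfl
  | d + 1, u => by
    rw [gen, Finset.card_biUnion, cnt]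
    · exact Finset.sum_congr rfl fun a _ => card_gen d a
    · intro a ha b hb hab
      refine Finset.disjoint_coe.1 ?_
      exact (disjoint_below ha hb hab).mono (T.gen_subset_below d a) (T.gen_subset_below d b)

end LayeredTree

/-! ### Rooted trees and family trees as layered trees -/

namespace RootedGraphTree

variable {V : Type*} (T : RootedGraphTree V)

/-- In a tree, a vertex has only one neighbour that is closer to the root. -/
theorem eq_of_adj_of_dist_add_one {u u' w : V} (hu : T.graph.Adj u w) (hu' : T.graph.Adj u' w)
    (h : T.graph.dist T.root w = T.graph.dist T.root u + 1)
    (h' : T.graph.dist T.root w = T.graph.dist T.root u' + 1) : u = u' := by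
  obtain ⟨p, hp⟩ := T.isTree.connected.exists_walk_length_eq_dist T.root u
  obtain ⟨p', hp'⟩ := T.isTree.connected.exists_walk_length_eq_dist T.root u'
  have h1 : (p.concat hu).IsPath :=
    SimpleGraph.Walk.isPath_of_length_eq_dist _ (by rw [SimpleGraph.Walk.length_concat, hp, h])
  have h2 : (p'.concat hu').IsPath :=
    SimpleGraph.Walk.isPath_of_length_eq_dist _ (by rw [SimpleGraph.Walk.length_concat, hp', h'])
  have h3 := (T.isTree.isAcyclic.subsingleton_path _ _).elim ⟨_, h1⟩ ⟨_, h2⟩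
  have h4 : p.concat hu = p'.concat hu' := congrArg Subtype.val h3
  have h5 := congrArg SimpleGraph.Walk.penultimate h4
  simpa using h5

open Classical in
/-- A tree with finite levels, as a layered tree. The parent of the root is a junk value. -/
noncomputable def toLayeredTree (hfin : ∀ n, (T.level n).Finite) : LayeredTree V where
  par w := if h : ∃ u, T.graph.Adj u w ∧ T.graph.dist T.root w = T.graph.dist T.root u + 1
    then h.choose else w
  lvl v := T.graph.dist T.root v
  ch u := (hfin (T.graph.dist T.root u + 1)).toFinset.filter (T.graph.Adj u)
  par_of_mem := by
    intro u a ha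
    rw [Finset.mem_filter, Set.Finite.mem_toFinset] at ha
    have h : ∃ u, T.graph.Adj u a ∧ T.graph.dist T.root a = T.graph.dist T.root u + 1 :=
      ⟨u, ha.2, ha.1⟩
    rw [dif_pos h]
    exact T.eq_of_adj_of_dist_add_one h.choose_spec.1 ha.2 h.choose_spec.2 ha.1
  lvl_of_mem := by
    intro u a ha
    rw [Finset.mem_filter, Set.Finite.mem_toFinset] at ha
    exact ha.1

theorem toLayeredTree_lvl_root (hfin : ∀ n, (T.level n).Finite) :
    (T.toLayeredTree hfin).lvl T.root = 0 := SimpleGraph.dist_self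

theorem cnt_toLayeredTree_le (hfin : ∀ n, (T.level n).Finite) (n : ℕ) :
    ((T.toLayeredTree hfin).cnt n T.root : ℕ∞) ≤ (T.level n).encard := by
  rw [← LayeredTree.card_gen, ← Set.encard_coe_eq_coe_finsetCard]
  refine Set.encard_le_encard fun v hv => ?_
  have := (T.toLayeredTree hfin).lvl_of_mem_gen n T.root v hv
  rwa [toLayeredTree_lvl_root, Nat.zero_add] at this

theorem IsRay.dist_root {x : ℕ → V} (hx : T.IsRay x) (n : ℕ) :
    T.graph.dist T.root (x n) = n := by
  obtain ⟨h0, hadj, hinj⟩ := hx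
  have key : ∀ n, ∃ p : T.graph.Walk (x 0) (x n), p.IsPath ∧ p.length = n ∧
      ∀ v ∈ p.support, ∃ i ≤ n, v = x i := fun n => by
    induction n with
    | zero => exact ⟨SimpleGraph.Walk.nil, by simp, rfl, fun v hv => ⟨0, le_rfl, by simpa using hv⟩⟩
    | succ n ih =>
      obtain ⟨p, hp, hl, hs⟩ := ih
      refine ⟨p.concat (hadj n), hp.concat (fun hm => ?_) _, by
        rw [SimpleGraph.Walk.length_concat, hl], fun v hv => ?_⟩
      · obtain ⟨i, hi, he⟩ := hs _ hm
        have := hinj he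
        omega
      · rw [SimpleGraph.Walk.support_concat, List.mem_append] at hv
        rcases hv with hv | hv
        · obtain ⟨i, hi, he⟩ := hs v hv
          exact ⟨i, hi.trans n.le_succ, he⟩
        · exact ⟨n + 1, le_rfl, by simpa using hv⟩
  obtain ⟨p, hp, hl, -⟩ := key n
  rw [← h0]
  obtain ⟨p', hp', hl'⟩ := T.isTree.connected.exists_path_of_dist (x 0) (x n)
  have h : p = p' := congrArg Subtype.val
    ((T.isTree.isAcyclic.subsingleton_path _ _).elim ⟨p, hp⟩ ⟨p', hp'⟩)
  rw [← hl', ← h, hl]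

open Classical in
theorem hitEvent_subset_Hit (hfin : ∀ n, (T.level n).Finite) (B : Set (ℕ → ℝ)) (n : ℕ)
    (y : ℕ → ℝ) :
    T.hitEvent B ⊆ (T.toLayeredTree hfin).Hit (initialHull B n) n T.root y := by
  rintro X ⟨x, hx, hB⟩
  have hlvl := IsRay.dist_root T hx
  have hch : ∀ n, x (n + 1) ∈ (T.toLayeredTree hfin).ch (x n) := fun n => by
    refine Finset.mem_filter.2 ⟨?_, hx.2.1 n⟩
    rw [Set.Finite.mem_toFinset, hlvl n]
    exact hlvl (n + 1)
  have := (T.toLayeredTree hfin).mem_Hit_of_branch hch hlvl hB n 0 y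
    fun i hi => absurd hi (Nat.not_lt_zero i)
  rwa [Nat.zero_add, hx.1] at this

end RootedGraphTree

section FamilyTree

variable (N : List ℕ → ℕ) (L : ℕ → ℕ)

/-- The family tree in which an individual of generation `n` keeps its first `L n` children only.
All individuals of the family tree are kept as elements, since only the descending paths matter. The
parent of the root is a junk value. -/
def truncTree : LayeredTree {v // IsBorn N v} where
  par v := ⟨v.1.tail, by
    obtain ⟨_ | ⟨i, v⟩, hv⟩ := v
    · exact hv
    · exact hv.2⟩
  lvl v := v.1.length
  ch u := (Finset.range (min (L u.1.length) (N u.1))).attach.map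
    ⟨fun i => ⟨i.1 :: u.1, (lt_min_iff.1 (Finset.mem_range.1 i.2)).2, u.2⟩, fun i j h => by
      have := congrArg Subtype.val h
      exact Subtype.ext (List.cons.inj this).1⟩
  par_of_mem := by
    intro u a ha
    obtain ⟨i, -, rfl⟩ := Finset.mem_map.1 ha
    rfl
  lvl_of_mem := by
    intro u a ha
    obtain ⟨i, -, rfl⟩ := Finset.mem_map.1 ha
    rfl

variable {N L}

theorem exists_cons_of_mem_ch {u a : {v // IsBorn N v}} (ha : a ∈ (truncTree N L).ch u) :
    ∃ i, a.1 = i :: u.1 := by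
  obtain ⟨i, -, rfl⟩ := Finset.mem_map.1 ha
  exact ⟨i.1, rfl⟩

theorem sum_ch_truncTree (u : {v // IsBorn N v}) (g : List ℕ → ℝ) :
    ∑ a ∈ (truncTree N L).ch u, g a.1 =
      ∑ i ∈ Finset.range (L u.1.length), hasChild u.1 i N * g (i :: u.1) := by
  rw [truncTree, Finset.sum_map]
  refine (Finset.sum_attach (Finset.range (min (L u.1.length) (N u.1)))
    fun i => g (i :: u.1)).trans ?_
  have : Finset.range (min (L u.1.length) (N u.1)) =
      (Finset.range (L u.1.length)).filter (· < N u.1) := by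
    ext i
    simp
  rw [this, Finset.sum_filter]
  refine Finset.sum_congr rfl fun i _ => ?_
  unfold hasChild
  split_ifs <;> simp

theorem cnt_truncTree : ∀ d (u : {v // IsBorn N v}),
    ((truncTree N L).cnt d u : ℝ) = descCount L d u.1 N
  | 0, _ => Nat.cast_one
  | d + 1, u => by
    rw [LayeredTree.cnt, Nat.cast_sum]
    exact (Finset.sum_congr rfl fun a _ => cnt_truncTree d a).trans
      (sum_ch_truncTree u fun v => descCount L d v N)

theorem pairs_zero_truncTree (d : ℕ) (u : {v // IsBorn N v}) :
    ((truncTree N L).pairs (d + 1) 0 u : ℝ) = pairCount L d u.1 N := by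
  rw [LayeredTree.pairs, Nat.cast_sum]
  refine (Finset.sum_congr rfl fun a _ => ?_).trans ((sum_ch_truncTree u fun v =>
    ∑ j ∈ Finset.range (L u.1.length), hasChild u.1 j N *
      if j :: u.1 ≠ v then descCount L d v N * descCount L d (j :: u.1) N else 0).trans ?_)
  · refine Eq.trans ?_ (sum_ch_truncTree u fun w =>
      if w ≠ a.1 then descCount L d a.1 N * descCount L d w N else 0)
    rw [Nat.cast_sum, Finset.sum_filter]
    refine Finset.sum_congr rfl fun b _ => ?_
    by_cases hab : b = a
    · simp [hab]
    · rw [if_pos hab, if_pos fun h => hab (Subtype.ext h), Nat.cast_mul, cnt_truncTree,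
        cnt_truncTree]
  refine Finset.sum_congr rfl fun i _ => ?_
  rw [Finset.mul_sum, ← Finset.filter_ne', Finset.sum_filter]
  refine Finset.sum_congr rfl fun j _ => ?_
  by_cases hij : j = i
  · simp [hij]
  · simp only [ne_eq, List.cons.injEq, and_true, hij, not_false_eq_true, if_true]
    ring

theorem pairs_truncTree (d : ℕ) : ∀ j (u : {v // IsBorn N v}),
    ((truncTree N L).pairs (j + 1 + d) j u : ℝ) = levelSum L (pairCount L d) j u.1 N
  | 0, u => by
    rw [Nat.zero_add, Nat.add_comm]
    exact pairs_zero_truncTree d u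
  | j + 1, u => by
    rw [show j + 1 + 1 + d = j + 1 + d + 1 by omega, LayeredTree.pairs, Nat.cast_sum]
    exact (Finset.sum_congr rfl fun a _ => pairs_truncTree d j a).trans
      (sum_ch_truncTree u fun v => levelSum L (pairCount L d) j v N)

theorem iInter_Hit_subset_hitEvent {B : Set (ℕ → ℝ)} (hB : IsClosed B) (y : ℕ → ℝ) :
    ⋂ n, (truncTree N L).Hit (initialHull B n) n (familyTree N).root y ⊆
      (familyTree N).hitEvent B := by
  intro X hX
  obtain ⟨x, h0, hx, hxB⟩ := (truncTree N L).exists_branch_of_forall_mem_Hit hB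
    (u := (familyTree N).root) rfl (Set.mem_iInter.1 hX)
  refine ⟨x, ⟨h0, fun n => familyGraph_adj.2 (Or.inl (exists_cons_of_mem_ch (hx n))), ?_⟩, hxB⟩
  have hl : ∀ n, (truncTree N L).lvl (x n) = n := fun n => by
    induction n with
    | zero => rw [h0]; rfl
    | succ n ih => rw [(truncTree N L).lvl_of_mem (hx n), ih]
  intro m n hmn
  rw [← hl m, ← hl n, hmn]

/-- The hitting events of the finite depths decrease, so it is enough to bound their probabilities
from below for infinitely many depths. -/
theorem le_hitProb_familyTree {B : Set (ℕ → ℝ)} (hB : IsClosed B) (y : ℕ → ℝ) (F : Measure ℝ)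
    [IsProbabilityMeasure F] {c : ℝ≥0∞}
    (h : ∃ᶠ n in Filter.atTop, c ≤ Measure.infinitePi (fun _ => F)
      ((truncTree N L).Hit (initialHull B n) n (familyTree N).root y)) :
    c ≤ (familyTree N).hitProb B F := by
  have hanti : Antitone fun n =>
      (truncTree N L).Hit (initialHull B n) n (familyTree N).root y := by
    have := (truncTree N L).antitone_Hit_initialHull B (familyTree N).root y
    rw [show (truncTree N L).lvl (familyTree N).root = 0 from rfl] at this
    simpa only [Nat.zero_add] using this
  refine le_trans ?_ (measure_mono (iInter_Hit_subset_hitEvent (L := L) hB y))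
  rw [hanti.measure_iInter (fun n => ((measurable_const (a := y)).prodMk measurable_id
    ((truncTree N L).measurableSet_Hit (isClosed_initialHull B n).measurableSet n
      (familyTree N).root)).nullMeasurableSet) ⟨0, measure_ne_top _ _⟩]
  refine le_iInf fun n => ?_
  obtain ⟨m, hm, hc⟩ := (Filter.frequently_atTop.1 h) n
  exact hc.trans (measure_mono (hanti hm))

end FamilyTree

/-! ### Truncation of the environment -/

section OffspringMoments

theorem genFun_zero (p : PMF ℕ) : genFun p 0 = p 0 := by
  rw [genFun, tsum_eq_single 0 fun k hk => by rw [zero_pow hk, mul_zero], pow_zero, mul_one]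

theorem genFunDeriv_one_one (p : PMF ℕ) : genFunDeriv p 1 1 = ∑' k : ℕ, p k * k := by
  exact tsum_congr fun k => by rw [Nat.descFactorial_one, one_pow, mul_one, mul_comm]

theorem genFunDeriv_two_one (p : PMF ℕ) :
    genFunDeriv p 2 1 = ∑' k : ℕ, p k * (k * (k - 1) : ℕ) := by
  have : ∀ k : ℕ, k.descFactorial 2 = k * (k - 1) := fun k => by
    simp [Nat.descFactorial_succ, mul_comm]
  exact tsum_congr fun k => by rw [this, one_pow, mul_one, mul_comm]

theorem toMeasure_Ioi (p : PMF ℕ) (i : ℕ) :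
    p.toMeasure (Set.Ioi i) = ∑' k : ℕ, p k * (if i < k then 1 else 0 : ℕ) := by
  rw [PMF.toMeasure_apply _ MeasurableSet.of_discrete]
  refine tsum_congr fun k => ?_
  by_cases h : i < k <;> simp [h]

theorem tsum_mul_le_of_le (p : PMF ℕ) {a b : ℕ → ℕ} (h : ∀ k, a k ≤ b k) :
    ∑' k : ℕ, p k * a k ≤ ∑' k : ℕ, p k * b k :=
  ENNReal.tsum_le_tsum fun k => by
    gcongr
    exact_mod_cast h k

theorem tsum_mul_add (p : PMF ℕ) (a b : ℕ → ℕ) :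
    ∑' k : ℕ, p k * (a k + b k : ℕ) = ∑' k : ℕ, p k * a k + ∑' k : ℕ, p k * b k := by
  rw [← ENNReal.tsum_add]
  exact tsum_congr fun k => by rw [Nat.cast_add, mul_add]

theorem tsum_mul_const_mul (p : PMF ℕ) (c : ℕ) (a : ℕ → ℕ) :
    ∑' k : ℕ, p k * (c * a k : ℕ) = c * ∑' k : ℕ, p k * a k := by
  rw [← ENNReal.tsum_mul_left]
  exact tsum_congr fun k => by rw [Nat.cast_mul]; ring

theorem tsum_mul_const (p : PMF ℕ) (c : ℕ) : ∑' k : ℕ, p k * (c : ℕ) = c := by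
  rw [ENNReal.tsum_mul_right, p.tsum_coe, one_mul]

theorem tsum_mul_finsetSum (p : PMF ℕ) {κ : Type*} (s : Finset κ) (a : κ → ℕ → ℕ) :
    ∑' k : ℕ, p k * (∑ i ∈ s, a i k : ℕ) = ∑ i ∈ s, ∑' k : ℕ, p k * a i k := by
  rw [← Summable.tsum_finsetSum fun _ _ => ENNReal.summable]
  exact tsum_congr fun k => by rw [Nat.cast_sum, Finset.mul_sum]

theorem genFunDeriv_one_one_ne_top {p : PMF ℕ} (h : genFunDeriv p 2 1 ≠ ∞) :
    genFunDeriv p 1 1 ≠ ∞ := by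
  rw [genFunDeriv_one_one]
  rw [genFunDeriv_two_one] at h
  refine ne_top_of_le_ne_top (b := (1 : ℕ) + ∑' k : ℕ, p k * (k * (k - 1) : ℕ))
    (ENNReal.add_ne_top.2 ⟨ENNReal.natCast_ne_top 1, h⟩) ?_
  rw [← tsum_mul_const p 1, ← tsum_mul_add]
  refine tsum_mul_le_of_le p fun k => ?_
  rcases k with _ | k
  · simp
  · simp only [Nat.add_sub_cancel]
    nlinarith

variable {L : ℕ → ℕ} {p : ℕ → PMF ℕ}

theorem ofReal_childProb (k i : ℕ) : ENNReal.ofReal (childProb (fun k => (p k).toMeasure) k i) =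
    ∑' l : ℕ, p k l * (if i < l then 1 else 0 : ℕ) := by
  rw [childProb, ofReal_measureReal, toMeasure_Ioi]

/-- Keeping the first `L` children only costs at most `V / L` in the mean, for
`L (l - min l L) ≤ l (l - 1)`. -/
theorem mul_genFunDeriv_le_truncMean (k : ℕ) : L k * genFunDeriv (p k) 1 1 ≤
    L k * ENNReal.ofReal (truncMean L (fun k => (p k).toMeasure) k) + genFunDeriv (p k) 2 1 := by
  rw [truncMean, ENNReal.ofReal_sum_of_nonneg fun _ _ => childProb_nonneg _ _ _]
  simp only [ofReal_childProb]
  rw [← tsum_mul_finsetSum, genFunDeriv_one_one, genFunDeriv_two_one, ← tsum_mul_const_mul,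
    ← tsum_mul_const_mul, ← tsum_mul_add]
  refine tsum_mul_le_of_le _ fun l => ?_
  rw [← Finset.sum_filter, Finset.sum_const, smul_eq_mul, mul_one]
  have : (Finset.range (L k)).filter (· < l) = Finset.range (min (L k) l) := by
    ext i
    simp
  rw [this, Finset.card_range]
  rcases le_total l (L k) with h | h
  · rw [min_eq_right h]
    exact Nat.le_add_right _ _
  · rw [min_eq_left h]
    obtain ⟨d, rfl⟩ := Nat.exists_eq_add_of_le h
    rcases d with _ | d
    · simp
    · rw [← Nat.add_assoc, Nat.add_sub_cancel]
      nlinarith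

theorem truncSecond_le (k : ℕ) :
    ENNReal.ofReal (truncSecond L (fun k => (p k).toMeasure) k) ≤ genFunDeriv (p k) 2 1 := by
  rw [truncSecond, ENNReal.ofReal_sum_of_nonneg fun _ _ =>
    Finset.sum_nonneg fun _ _ => childProb_nonneg _ _ _]
  simp only [fun i => ENNReal.ofReal_sum_of_nonneg (s := (Finset.range (L k)).erase i)
    fun j _ => childProb_nonneg (fun k => (p k).toMeasure) k (max i j), ofReal_childProb]
  simp only [← tsum_mul_finsetSum]
  rw [genFunDeriv_two_one]
  refine tsum_mul_le_of_le _ fun l => ?_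
  have h1 : ∀ i ∈ Finset.range (L k), (∑ j ∈ (Finset.range (L k)).erase i,
      if max i j < l then 1 else 0) ≤ if i < l then l - 1 else 0 := fun i _ => by
    split_ifs with hi
    · rw [← Finset.sum_filter, Finset.sum_const, smul_eq_mul, mul_one]
      refine (Finset.card_le_card (t := (Finset.range l).erase i) fun j hj => ?_).trans
        (by rw [Finset.card_erase_of_mem (Finset.mem_range.2 hi), Finset.card_range])
      simp only [Finset.mem_filter, Finset.mem_erase, max_lt_iff, Finset.mem_range] at hj ⊢
      exact ⟨hj.1.1, hj.2.2⟩
    · refine (Finset.sum_eq_zero fun j _ => if_neg fun h => hi ?_).le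
      exact (max_lt_iff.1 h).1
  refine (Finset.sum_le_sum h1).trans ?_
  rw [← Finset.sum_filter, Finset.sum_const, smul_eq_mul]
  gcongr
  refine (Finset.card_le_card (t := Finset.range l) fun j hj => ?_).trans (Finset.card_range l).le
  exact Finset.mem_range.2 (Finset.mem_filter.1 hj).2

/-- A distribution with mean larger than one and bounded second moment gives a definite mass to the
numbers larger than one, for `K l ≤ K + K² 1_{l > 1} + l (l - 1)`. -/
theorem mul_genFunDeriv_le_childProb (K k : ℕ) : K * genFunDeriv (p k) 1 1 ≤
    K + K ^ 2 * ENNReal.ofReal (childProb (fun k => (p k).toMeasure) k 1) +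
      genFunDeriv (p k) 2 1 := by
  have h : ((K : ℝ≥0∞)) ^ 2 = (K ^ 2 : ℕ) := by push_cast; rfl
  rw [ofReal_childProb, genFunDeriv_one_one, genFunDeriv_two_one, h, ← tsum_mul_const_mul,
    ← tsum_mul_const_mul]
  rw [← tsum_mul_const (p k) K, ← tsum_mul_add, ← tsum_mul_add]
  refine tsum_mul_le_of_le _ fun l => ?_
  rcases l with _ | _ | l
  · simp
  · simp
  · rw [if_pos (by omega), mul_one, Nat.add_sub_cancel]
    rcases le_total K (l + 1) with h | h <;> nlinarith

end OffspringMoments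

section Truncation

theorem meanSize_eq_prod_range (q : ℕ → PMF ℕ) (n : ℕ) :
    meanSize q n = ∏ k ∈ Finset.range n, genFunDeriv (q (k + 1)) 1 1 := by
  induction n with
  | zero => rfl
  | succ n ih =>
    rw [Finset.prod_range_succ, ← ih, meanSize, meanSize, Finset.prod_Icc_succ_top (by omega)]

end Truncation

section Truncation

/-- If each factor shrinks by a proportion of at most `1 / (k + 2) ^ 2` only, then the product
shrinks by a proportion of at most one half, for
`∏ k ∈ range n, (1 - 1 / (k + 2) ^ 2) = (n + 2) / (2 * (n + 1))`. -/
theorem prod_mul_le_prod {m t : ℕ → ℝ} (hm : ∀ k, 0 ≤ m k)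
    (h : ∀ k : ℕ, m k * (1 - 1 / ((k : ℝ) + 2) ^ 2) ≤ t k) (n : ℕ) :
    (∏ k ∈ Finset.range n, m k) * (((n : ℝ) + 2) / (2 * (n + 1))) ≤
      ∏ k ∈ Finset.range n, t k := by
  have h0 : ∀ k : ℕ, 0 ≤ m k * (1 - 1 / ((k : ℝ) + 2) ^ 2) := fun k => by
    refine mul_nonneg (hm k) ?_
    rw [sub_nonneg, div_le_one (by positivity)]
    nlinarith [(k.cast_nonneg : (0 : ℝ) ≤ k)]
  induction n with
  | zero => simp
  | succ n ih =>
    rw [Finset.prod_range_succ, Finset.prod_range_succ]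
    have h2 : (((n + 1 : ℕ) : ℝ) + 2) / (2 * ((n + 1 : ℕ) + 1)) =
        ((n : ℝ) + 2) / (2 * (n + 1)) * (1 - 1 / ((n : ℝ) + 2) ^ 2) := by
      have h3 : (n : ℝ) + 1 ≠ 0 := by positivity
      have h4 : (n : ℝ) + 2 ≠ 0 := by positivity
      have h5 : (n : ℝ) + 1 + 1 ≠ 0 := by positivity
      push_cast
      rw [show (n : ℝ) + 1 + 1 = n + 2 by ring]
      field_simp
      ring
    rw [h2]
    have := mul_le_mul ih (h n) (h0 n) (Finset.prod_nonneg fun k _ => (h0 k).trans (h k))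
    linarith

theorem summable_poly_div_sqrt {a : ℝ} (ha : 1 < a) {s : ℕ → ℝ} (hs : ∀ n, a ^ n ≤ s n) (c : ℝ) :
    Summable fun k : ℕ => (c * ((k : ℝ) + 2) ^ 2) ^ 2 / √(s k) := by
  have ha0 : 0 < a := by linarith
  set ρ : ℝ := (√a)⁻¹ with hρ
  have hsq : 1 < √a := by
    rw [Real.lt_sqrt zero_le_one]
    linarith
  have hρ0 : 0 < ρ := by positivity
  have hρ1 : ‖ρ‖ < 1 := by
    rw [Real.norm_of_nonneg hρ0.le]
    exact inv_lt_one_of_one_lt₀ hsq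
  have h0 : Summable fun n : ℕ => (n : ℝ) ^ 4 * ρ ^ n :=
    summable_pow_mul_geometric_of_norm_lt_one 4 hρ1
  have h := ((summable_nat_add_iff 2).2 h0).mul_left (c ^ 2 * (ρ ^ 2)⁻¹)
  refine Summable.of_nonneg_of_le (fun k => by positivity) (fun k => ?_) h
  have h1 : √(a ^ k) ≤ √(s k) := Real.sqrt_le_sqrt (hs k)
  have h2 : √(a ^ k) = (ρ ^ k)⁻¹ := by
    rw [hρ, inv_pow, inv_inv]
    exact (Real.sqrt_eq_iff_mul_self_eq (pow_nonneg ha0.le k) (by positivity)).2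
      (by rw [← mul_pow, Real.mul_self_sqrt ha0.le])
  rw [h2] at h1
  have h3 : (ρ ^ 2)⁻¹ * ρ ^ 2 = 1 := inv_mul_cancel₀ (by positivity)
  have h4 : (((k + 2 : ℕ) : ℝ)) = k + 2 := by push_cast; rfl
  calc (c * ((k : ℝ) + 2) ^ 2) ^ 2 / √(s k) ≤ (c * ((k : ℝ) + 2) ^ 2) ^ 2 / (ρ ^ k)⁻¹ :=
        div_le_div_of_nonneg_left (by positivity) (by positivity) h1
    _ = c ^ 2 * (ρ ^ 2)⁻¹ * (((k + 2 : ℕ) : ℝ) ^ 4 * ρ ^ (k + 2)) := by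
      rw [div_inv_eq_mul, pow_add ρ, h4]
      linear_combination -(c ^ 2 * ((k : ℝ) + 2) ^ 4 * ρ ^ k) * h3

/-- The environment can be truncated, to at most polynomially many children, in such a way that the
means stay above one, the second moments stay bounded, and the mean sizes of the generations are at
least halved. -/
theorem exists_truncation {q : ℕ → PMF ℕ} (hmean : 1 < ⨅ n ≥ 1, genFunDeriv (q n) 1 1)
    (hvar : (⨆ n ≥ 1, genFunDeriv (q n) 2 1) < ∞) {ν : ℕ → Measure ℕ}
    (hν : ν = fun k => (q (k + 1)).toMeasure) :
    ∃ (L : ℕ → ℕ) (ε V p : ℝ), 0 < ε ∧ 0 ≤ V ∧ 0 < p ∧ (∀ k, 2 ≤ L k) ∧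
      (∀ k, 1 + ε ≤ truncMean L ν k) ∧ (∀ k, truncSecond L ν k ≤ V) ∧
      (∀ k, p ≤ childProb ν k 1) ∧
      (Summable fun k => (L k : ℝ) ^ 2 / √(truncSize L ν 0 k)) ∧
      ∀ n, meanSize q n ≤ ENNReal.ofReal (2 * truncSize L ν 0 n) := by
  obtain ⟨r, hr1, hr⟩ := ENNReal.lt_iff_exists_nnreal_btwn.1 hmean
  have hr1 : (1 : ℝ) < r := by exact_mod_cast hr1
  set V := (⨆ n ≥ 1, genFunDeriv (q n) 2 1).toReal with hVdef
  have hV : 0 ≤ V := ENNReal.toReal_nonneg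
  have hW : ∀ k, genFunDeriv (q (k + 1)) 2 1 ≤ ENNReal.ofReal V := fun k => by
    rw [ENNReal.ofReal_toReal hvar.ne]
    exact le_iSup₂ (f := fun n (_ : n ≥ 1) => genFunDeriv (q n) 2 1) (k + 1) (by omega)
  have hfin : ∀ k, genFunDeriv (q (k + 1)) 1 1 ≠ ∞ := fun k =>
    genFunDeriv_one_one_ne_top ((hW k).trans_lt ENNReal.ofReal_lt_top).ne
  set m : ℕ → ℝ := fun k => (genFunDeriv (q (k + 1)) 1 1).toReal with hm
  have hmm : ∀ k, genFunDeriv (q (k + 1)) 1 1 = ENNReal.ofReal (m k) := fun k =>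
    (ENNReal.ofReal_toReal (hfin k)).symm
  have hmr : ∀ k, (r : ℝ) ≤ m k := fun k => by
    have h : (r : ℝ≥0∞) ≤ genFunDeriv (q (k + 1)) 1 1 := hr.le.trans
      (iInf₂_le (f := fun n (_ : n ≥ 1) => genFunDeriv (q n) 1 1) (k + 1) (by omega))
    exact (ENNReal.toReal_mono (hfin k) h)
  set δ : ℝ := r - 1 with hδ
  have hδ0 : 0 < δ := by linarith
  -- `c ≥ V` keeps the proportion lost in generation `k` below `1 / (k + 2) ^ 2`, and `c ≥ V / δ`
  -- keeps the truncated means above `1 + δ / 2`.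
  obtain ⟨c, hc⟩ := exists_nat_ge (V + V / δ + 1)
  have hVδ : 0 ≤ V / δ := by positivity
  have hc1 : 1 ≤ c := by
    have : (1 : ℝ) ≤ c := by linarith
    exact_mod_cast this
  have hc0 : (0 : ℝ) < c := by exact_mod_cast hc1
  have hVc : V ≤ c * δ := by
    have : V / δ ≤ c := by linarith
    rwa [div_le_iff₀ hδ0] at this
  set L : ℕ → ℕ := fun k => c * (k + 2) ^ 2 with hL
  have hL2 : ∀ k, 2 ≤ L k := fun k => by
    have : 2 ^ 2 ≤ (k + 2) ^ 2 := Nat.pow_le_pow_left (by omega) 2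
    have := Nat.mul_le_mul hc1 this
    simp only [hL]
    omega
  have htrunc : ∀ k, m k - V / (c * ((k : ℝ) + 2) ^ 2) ≤ truncMean L ν k := fun k => by
    have h := mul_genFunDeriv_le_truncMean (L := L) (p := fun k => q (k + 1)) k
    have h := h.trans (add_le_add le_rfl (hW k))
    rw [← hν, hmm, ← ENNReal.ofReal_natCast, ← ENNReal.ofReal_mul (by positivity),
      ← ENNReal.ofReal_mul (by positivity),
      ← ENNReal.ofReal_add (mul_nonneg (by positivity) (truncMean_nonneg L ν k)) hV,
      ENNReal.ofReal_le_ofReal_iff (add_nonneg (mul_nonneg (by positivity)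
        (truncMean_nonneg L ν k)) hV)] at h
    have hLk : ((L k : ℕ) : ℝ) = c * ((k : ℝ) + 2) ^ 2 := by simp [hL]
    rw [hLk] at h
    have hpos : 0 < c * ((k : ℝ) + 2) ^ 2 := by positivity
    rw [sub_le_iff_le_add, ← sub_le_iff_le_add', le_div_iff₀ hpos]
    linarith
  have hε : ∀ k, 1 + δ / 2 ≤ truncMean L ν k := fun k => by
    refine le_trans ?_ (htrunc k)
    have : V / (c * ((k : ℝ) + 2) ^ 2) ≤ δ / 2 := by
      have hk : (0 : ℝ) ≤ k := k.cast_nonneg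
      rw [div_le_iff₀ (by positivity)]
      nlinarith [mul_pos hc0 hδ0, mul_nonneg (mul_pos hc0 hδ0).le hk,
        mul_nonneg (mul_pos hc0 hδ0).le (sq_nonneg (k : ℝ))]
    linarith [hmr k]
  have hratio : ∀ k : ℕ, m k * (1 - 1 / ((k : ℝ) + 2) ^ 2) ≤ truncMean L ν k := fun k => by
    refine le_trans ?_ (htrunc k)
    have h1 : V / (c * ((k : ℝ) + 2) ^ 2) ≤ 1 / ((k : ℝ) + 2) ^ 2 := by
      rw [div_le_div_iff₀ (by positivity) (by positivity)]
      have : V ≤ c := by linarith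
      nlinarith [sq_nonneg ((k : ℝ) + 2)]
    have h2 : 1 / ((k : ℝ) + 2) ^ 2 ≤ m k * (1 / ((k : ℝ) + 2) ^ 2) :=
      le_mul_of_one_le_left (by positivity) (by linarith [hmr k])
    linarith
  have hsize : ∀ n : ℕ, (∏ k ∈ Finset.range n, m k) * (((n : ℝ) + 2) / (2 * (n + 1))) ≤
      truncSize L ν 0 n := fun n => by
    simp only [truncSize, Nat.zero_add]
    exact prod_mul_le_prod (fun k => by linarith [hmr k]) hratio n
  have hgeom : ∀ n, (1 + δ / 2) ^ n ≤ truncSize L ν 0 n := fun n => by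
    rw [truncSize]
    refine le_trans (by simp) (Finset.prod_le_prod (s := Finset.range n)
      (f := fun _ => 1 + δ / 2) (fun _ _ => by positivity) fun i _ => hε (0 + i))
  obtain ⟨K, hK⟩ := exists_nat_ge ((V + 1) / δ)
  have hK0 : (0 : ℝ) < K := lt_of_lt_of_le (by positivity) hK
  refine ⟨L, δ / 2, V, 1 / (K : ℝ) ^ 2, by positivity, hV, by positivity, hL2, hε, fun k => ?_,
    fun k => ?_, ?_, fun n => ?_⟩
  · have h := (truncSecond_le (L := L) (p := fun k => q (k + 1)) k).trans (hW k)
    rwa [← hν, ENNReal.ofReal_le_ofReal_iff hV] at h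
  · have h := (mul_genFunDeriv_le_childProb (p := fun k => q (k + 1)) K k).trans
      (add_le_add le_rfl (hW k))
    have hcn := childProb_nonneg ν k 1
    have hcn' : 0 ≤ (K : ℝ) ^ 2 * childProb ν k 1 := by positivity
    rw [← hν, hmm, ← ENNReal.ofReal_natCast, ← ENNReal.ofReal_mul (by positivity),
      ← ENNReal.ofReal_pow (by positivity), ← ENNReal.ofReal_mul (by positivity),
      ← ENNReal.ofReal_add (by positivity) hcn', ← ENNReal.ofReal_add (by positivity) hV,
      ENNReal.ofReal_le_ofReal_iff (by positivity)] at h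
    rw [div_le_iff₀ hδ0] at hK
    rw [div_le_iff₀ (by positivity)]
    nlinarith [hmr k]
  · have hs := summable_poly_div_sqrt (a := 1 + δ / 2) (by linarith) hgeom c
    refine hs.congr fun k => ?_
    rw [hL]
    push_cast
    rfl
  · rw [meanSize_eq_prod_range, Finset.prod_congr rfl fun k _ => hmm k,
      ← ENNReal.ofReal_prod_of_nonneg fun k _ => by linarith [hmr k]]
    refine ENNReal.ofReal_le_ofReal ?_
    have h1 : (1 : ℝ) / 2 ≤ ((n : ℝ) + 2) / (2 * (n + 1)) := by
      rw [div_le_div_iff₀ (by positivity) (by positivity)]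
      linarith
    have h2 : 0 ≤ ∏ k ∈ Finset.range n, m k :=
      Finset.prod_nonneg fun k _ => by linarith [hmr k]
    have := mul_le_mul_of_nonneg_left h1 h2
    linarith [hsize n]

end Truncation

/-! ### Comparison of the two trees -/

section Comparison

theorem LayeredTree.pairs_self {V : Type*} (T : LayeredTree V) : ∀ n u, T.pairs n n u = T.cnt n u
  | 0, _ => rfl
  | n + 1, u => by
    rw [pairs, cnt]
    exact Finset.sum_congr rfl fun a _ => pairs_self T n a

variable {L : ℕ → ℕ} {ν : ℕ → Measure ℕ}

/-- Both trees are compared with the conductance of the same network on the target set: a small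
tree hits the target with at most a multiple, and a tree with small fluctuations in infinitely many
generations with at least a multiple of this conductance. -/
theorem mul_hitProb_le_hitProb_familyTree {ε V A C : ℝ} (hε : 0 < ε) (hV : 0 ≤ V)
    (hm : ∀ k, 1 + ε ≤ truncMean L ν k) (hσ : ∀ k, truncSecond L ν k ≤ V) (hA : 1 ≤ A)
    (hC : 0 ≤ C) {N : List ℕ → ℕ}
    (hN : ∃ᶠ n in Filter.atTop,
      truncSize L ν 0 n ≤ C * descCount L n [] N ∧ totalFluct L ν n N ≤ C)
    {W : Type*} (Δ : RootedGraphTree W)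
    (hΔ : ∀ n, ((Δ.level n).encard : ℝ≥0∞) ≤ ENNReal.ofReal (A * truncSize L ν 0 n))
    (F : Measure ℝ) [IsProbabilityMeasure F] {B : Set (ℕ → ℝ)} (hB : IsClosed B) :
    ENNReal.ofReal ((1 - Real.exp (-1)) /
      (A * (2 * (1 + ε) / ε) * (1 + 2 * C + V * (1 + C)) ^ 3)) * Δ.hitProb B F ≤
      (familyTree N).hitProb B F := by
  set s : ℕ → ℝ := truncSize L ν 0 with hs
  have hs0 : ∀ n, 0 < s n := fun n => truncSize_pos hε hm 0 n
  have hs1 : s 0 = 1 := by simp [hs, truncSize]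
  have hs' : ∀ n, (1 + ε) * s n ≤ s (n + 1) := fun n => by
    rw [hs, truncSize_add L ν 0 n 1, mul_comm]
    refine mul_le_mul_of_nonneg_left ?_ (hs0 n).le
    simpa [truncSize] using hm n
  set D := 1 + 2 * C + V * (1 + C) with hD
  have hVC : 0 ≤ V * (1 + C) := by positivity
  have hD0 : 0 < D := by positivity
  set K := A * (2 * (1 + ε) / ε) with hK
  have hK0 : 0 < K := by positivity
  have hfin : ∀ n, (Δ.level n).Finite := fun n => by
    rw [← Set.encard_ne_top_iff, ← ENat.toENNReal_ne_top]
    exact ne_top_of_le_ne_top ENNReal.ofReal_ne_top (hΔ n)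
  have hcnt : ∀ n, ((Δ.toLayeredTree hfin).cnt n Δ.root : ℝ) ≤ A * s n := fun n => by
    have h := (ENat.toENNReal_mono (Δ.cnt_toLayeredTree_le hfin n)).trans (hΔ n)
    rw [ENat.toENNReal_coe, ← ENNReal.ofReal_natCast] at h
    exact (ENNReal.ofReal_le_ofReal_iff (mul_nonneg (by linarith) (hs0 n).le)).1 h
  set M : ℕ → ℝ≥0∞ := fun n => ENNReal.ofReal (s n) with hM
  -- The first term of a sequence is at position zero, so the initial sequence is irrelevant.
  let y : ℕ → ℝ := 0
  refine le_hitProb_familyTree (L := L) hB y F (hN.mono fun n hn => ?_)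
  obtain ⟨hn1, hn2⟩ := hn
  have hdesc : ((truncTree N L).cnt n (familyTree N).root : ℝ) = descCount L n [] N :=
    cnt_truncTree n (familyTree N).root
  have hlow : conductance (initialHull B n) M F n 0 y ≤ ENNReal.ofReal D ^ 3 *
      Measure.infinitePi (fun _ => F)
        ((truncTree N L).Hit (initialHull B n) n (familyTree N).root y) := by
    refine (truncTree N L).conductance_le_measure_Hit M F (isClosed_initialHull B n).measurableSet
      (fun j => (ENNReal.ofReal_pos.2 (hs0 j)).ne') (fun j => ENNReal.ofReal_ne_top)
      (by simp only [hM, hs1, ENNReal.ofReal_one]) rfl y ?_ fun i hi => ?_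
    · rw [← ENNReal.ofReal_natCast, hdesc, ← ENNReal.ofReal_mul hD0.le]
      refine ENNReal.ofReal_le_ofReal (hn1.trans ?_)
      refine mul_le_mul_of_nonneg_right ?_ (descCount_nonneg L n [] N)
      linarith
    · rw [← ENNReal.ofReal_natCast, ← ENNReal.ofReal_pow (hs0 n).le,
        ← ENNReal.ofReal_mul (Nat.cast_nonneg _), ← ENNReal.ofReal_mul hD0.le]
      refine ENNReal.ofReal_le_ofReal ?_
      rcases hi.lt_or_eq with hi | rfl
      · obtain ⟨d, rfl⟩ : ∃ d, n = i + 1 + d := Nat.exists_eq_add_of_le hi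
        rw [pairs_truncTree]
        refine (pairs_le_of_totalFluct_le hε hV hm hσ hC hn2).trans ?_
        refine mul_le_mul_of_nonneg_right ?_ (by positivity)
        linarith
      · rw [LayeredTree.pairs_self, hdesc, sq, ← mul_assoc]
        refine mul_le_mul_of_nonneg_right ?_ (hs0 i).le
        refine (descCount_le_of_totalFluct_le hε hm hn2 le_rfl).trans ?_
        refine mul_le_mul_of_nonneg_right ?_ (hs0 i).le
        linarith
  have hup := (Δ.toLayeredTree hfin).measure_Hit_le_conductance F
    (isClosed_initialHull B n).measurableSet hs0 hε hs' hA (Δ.toLayeredTree_lvl_root hfin) hcnt hs1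
    n y
  have hsub := measure_mono (μ := Measure.infinitePi fun _ : W => F)
    (Δ.hitEvent_subset_Hit hfin B n y)
  have hKD : 0 < K * D ^ 3 := by positivity
  rw [ENNReal.ofReal_div_of_pos hKD, div_eq_mul_inv, mul_right_comm, ← div_eq_mul_inv]
  refine ENNReal.div_le_of_le_mul' ?_
  calc _ ≤ ENNReal.ofReal (1 - Real.exp (-1)) * Measure.infinitePi (fun _ => F)
        ((Δ.toLayeredTree hfin).Hit (initialHull B n) n Δ.root y) := by gcongr; exact hsub
    _ ≤ ENNReal.ofReal K * conductance (initialHull B n) M F n 0 y := hup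
    _ ≤ ENNReal.ofReal K * (ENNReal.ofReal D ^ 3 * Measure.infinitePi (fun _ => F)
        ((truncTree N L).Hit (initialHull B n) n (familyTree N).root y)) := by gcongr
    _ = _ := by
      rw [ENNReal.ofReal_mul hK0.le, ENNReal.ofReal_pow hD0.le, mul_assoc]

end Comparison

theorem theorem6p1 (q : ℕ → PMF ℕ)
    (hq0 : ∀ n ≥ 1, genFun (q n) 0 = 0)
    (hmean : 1 < ⨅ n ≥ 1, genFunDeriv (q n) 1 1)
    (hvar : (⨆ n ≥ 1, genFunDeriv (q n) 2 1) < ∞)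
    {V : Type*} [Infinite V] (Δ : RootedGraphTree V)
    (hΔ : (⨆ n, ((Δ.level n).encard : ℝ≥0∞) / meanSize q n) < ∞) :
    ∀ᵐ N ∂(bpveLaw q), ∃ C₁ : ℝ≥0, 0 < C₁ ∧
      ∀ (F : MeasureTheory.Measure ℝ) [MeasureTheory.IsProbabilityMeasure F]
        (B : Set (ℕ → ℝ)), IsClosed B →
        (familyTree N).hitProb B F ≥ C₁ * Δ.hitProb B F := by
  set ν : ℕ → Measure ℕ := fun k => (q (k + 1)).toMeasure with hν
  obtain ⟨L, ε, σ, p, hε, hσ0, hp, hL, hm, hσ, h1, hsum, hsize⟩ := exists_truncation hmean hvar hν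
  have h0 : ∀ k, ν k {0} = 0 := fun k => by
    rw [hν, PMF.toMeasure_apply_singleton _ _ (measurableSet_singleton 0), ← genFun_zero]
    exact hq0 (k + 1) (by omega)
  set A := (⨆ n, ((Δ.level n).encard : ℝ≥0∞) / meanSize q n).toReal with hA
  have hA0 : 0 ≤ A := ENNReal.toReal_nonneg
  have hs : ∀ n, 0 < truncSize L ν 0 n := fun n => truncSize_pos hε hm 0 n
  have hlevel : ∀ n, ((Δ.level n).encard : ℝ≥0∞) ≤
      ENNReal.ofReal ((1 + 2 * A) * truncSize L ν 0 n) := fun n => by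
    have hM : meanSize q n ≠ ∞ := ne_top_of_le_ne_top ENNReal.ofReal_ne_top (hsize n)
    have h := le_iSup (fun n => ((Δ.level n).encard : ℝ≥0∞) / meanSize q n) n
    rw [← ENNReal.ofReal_toReal hΔ.ne, ← hA] at h
    have h2 : ((Δ.level n).encard : ℝ≥0∞) ≤ ENNReal.ofReal A * meanSize q n := by
      rw [meanSize_eq_prod_range] at h hM ⊢
      refine (ENNReal.div_le_iff (Finset.prod_ne_zero_iff.2 fun k _ => ?_) hM).1 h
      exact (zero_lt_one.trans (hmean.trans_le (iInf₂_le
        (f := fun n (_ : n ≥ 1) => genFunDeriv (q n) 1 1) (k + 1) (by omega)))).ne'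
    refine h2.trans ((mul_le_mul_right (hsize n) _).trans ?_)
    rw [← ENNReal.ofReal_mul hA0]
    refine ENNReal.ofReal_le_ofReal ?_
    linarith [hs n]
  have hae := ae_exists_frequently hε hσ0 hm hσ h0 hp h1 hL hsum
  filter_upwards [show ∀ᵐ N ∂bpveLaw q, _ from hae] with N hN
  obtain ⟨C, hC, hN⟩ := hN
  refine ⟨Real.toNNReal ((1 - Real.exp (-1)) /
    ((1 + 2 * A) * (2 * (1 + ε) / ε) * (1 + 2 * C + σ * (1 + C)) ^ 3)), ?_, fun F _ B hB => ?_⟩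
  · have : Real.exp (-1) < 1 := Real.exp_lt_one_iff.2 (by norm_num)
    have : 0 < 1 - Real.exp (-1) := by linarith
    rw [Real.toNNReal_pos]
    positivity
  · exact mul_hitProb_le_hitProb_familyTree hε hσ0 hm hσ (by linarith) hC hN Δ hlevel F hB
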